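/- All algebras are associative, unital, over $\mathbb{C}$; ideals are two-sided; $H$ is a Hopf algebra with invertible antipode $S$; $I$ is a finite set. A family of ideals $(J_i)_{i\in I}$ of an algebra $R$ is a covering if $\bigcap_i J_i=0$; its covering completion is $R_c=\{(x_i)\in\prod_i R/J_i : x_i=x_j \text{ in } R/(J_i+J_j)\ \forall i,j\}$, and the covering is complete if $R\to R_c$ is bijective. **Bundle.** A locally trivial quantum principal fibre bundle (QPFB) consists of an algebra $B$ with a complete covering $(J_i)_{i\in I}$, a right $H$-comodule algebra $(P,\Delta_P)$, surjective homomorphisms $\chi_i:P\to B_i\otimes H$, where $B_i=B/J_i$, and an injective homomorphism $\iota:B\to P$ such that $(\mathrm{id}\otimes\Delta)\chi_i=(\chi_i\otimes\mathrm{id})\Delta_P$, $\chi_i(\iota(a))=\pi_i(a)\otimes 1$ with $\pi_i : B\to B_i$ the projection, $(\ker\chi_i)_i$ is a complete covering of $P$, and $\iota(B)=\{f:\Delta_P(f)=f\otimes1\}$. Put $B_{ij}=B/(J_i+J_j)$, with projections $\pi^i_j:B_i\to B_{ij}$. A family of transition functions consists of homomorphisms $\tau_{ij}:H\to B_{ij}$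 with $(\pi^i_j\otimes\mathrm{id})\chi_i=\phi_{ij}(\pi^j_i\otimes\mathrm{id})\chi_j$ for all $i,j$, where $\phi_{ij}(a\otimes h)=\sum a\,\tau_{ji}(h_1)\otimes h_2$. **Differential structure.** A differential calculus over an algebra $A$ is an $\mathbb{N}$-graded differential algebra $\Gamma(A)$ with $\Gamma^0(A)=A$, generated by the elements $a$, $da$. Let differential calculi $\Gamma(B_i)$ and a right covariant differential calculus $\Gamma(H)$ (with coaction $\Delta^\Gamma$) be given, and let $R=\{r\in\ker\varepsilon:\sum S^{-1}(r_2)dr_1=0\}$ be the right ideal of $H$ that corresponds to $\Gamma(H)$. With the skew tensor product $\Gamma(B_i)\hat\otimes\Gamma(H)$, let $\Gamma(P)$ be the (unique) differential calculus over $P$ such that every $\chi_i$ extends to a homomorphism of differential algebras $\chi_{i}:\Gamma(P)\to\Gamma(B_i)\hat\otimes\Gamma(H)$ and the kernels $K_i$ of these extensions satisfy $\bigcap_iK_i=0$. Let $\Gamma_c(P)$ be the covering completion of $\Gamma(P)$ with respect to $(K_i)_i$; $\chi_i$ also denotes the induced map on $\Gamma_c(P)$. The right $H$-coaction $\Delta^{\Gamma_c}$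 on $\Gamma_c(P)$ is determined by $(\chi_i\otimes\mathrm{id})\Delta^{\Gamma_c}=(\mathrm{id}\otimes\Delta^\Gamma)\chi_i$ for all $i$. Let $\mathrm{hor}\,\Gamma^1_c(P)=\{\gamma\in\Gamma^1_c(P):\chi_i(\gamma)\in\Gamma(B_i)\hat\otimes H\ \forall i\}$. **Connections.** A left (right) connection is a surjective left (right) $P$-module homomorphism $\mathrm{hor}:\Gamma_c^1(P)\to\mathrm{hor}\,\Gamma_c^1(P)$ with $\mathrm{hor}^2=\mathrm{hor}$, $(\mathrm{hor}\otimes\mathrm{id})\Delta^{\Gamma_c}=\Delta^{\Gamma_c}\mathrm{hor}$ and $\mathrm{hor}(\ker\chi_i)\subset\ker\chi_i$ for all $i$. Its local connection maps are $A_i:H\to\Gamma^1(B_i)$, $A_i(h)=-(\mathrm{id}\otimes\varepsilon)\,\mathrm{hor}_i(1\otimes dh)$, where $\mathrm{hor}_i\circ\chi_i=\chi_i\circ\mathrm{hor}$ and $\varepsilon$ is extended by $0$ to forms of positive degree. **Proposition 13.** For every locally trivial QPFB with a differential structure as above: 1. There is exactly one bijection from the left connections to the right connections under which the local connection maps $A_{l,i}$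 of a left connection and $A_{r,i}$ of the corresponding right connection satisfy $A_{r,i}=-A_{l,i}\circ S$ for all $i\in I$. 2. There is exactly one family of transition functions $(\tau_{ij})$. The families of local connection maps of left (right) connections are exactly the families of linear maps $A_i:H\to\Gamma^1(B_i)$ such that $A_i(1)=0$, the compatibility condition $$\pi^i_j(A_i(h))=\sum\tau_{ij}(h_1)\,\pi^j_i(A_j(h_2))\,\tau_{ji}(h_3)+\sum\tau_{ij}(h_1)\,d\tau_{ji}(h_2)$$ holds in $\Gamma(P)/(K_i+K_j)$ for all $i,j$ and $h\in H$ (where $\pi^i_j(\gamma)$ is the class of any $\rho\in\Gamma(P)$ with $\chi_i(\rho)=\gamma\otimes1$, $\pi^j_i(\gamma)$ is the class of any $\rho$ with $\chi_j(\rho)=\gamma\otimes 1$, and $B_{ij}$ is mapped there by $\iota$), and $R\subset\ker A_i$ (respectively $S^{-1}(R)\subset\ker A_i$) for all $i$. 3. The assignment $(A_i)_i\mapsto(-A_i\circ S)_i$ preserves these conditions: for every family of linear maps $A_i:H\to\Gamma(B_i)$, the family $(A_i)$ takes values in one-forms and vanishes at $1$ if and only if $(-A_i\circ S)$ does; $(A_i)$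 satisfies the compatibility condition if and only if $(-A_i\circ S)$ does; and $R\subset\ker A_i$ for all $i$ if and only if $S^{-1}(R)\subset\ker(-A_i\circ S)$ for all $i$. -/

import Mathlib

open scoped TensorProduct

noncomputable section

/-! ### Coverings of algebras by two-sided ideals -/

section Covering

variable {I R : Type*} [Ring R] [Algebra ℂ R]

instance isTwoSided_sup (J K : Ideal R) [J.IsTwoSided] [K.IsTwoSided] : (J ⊔ K).IsTwoSided where
  mul_mem_of_left b ha := by
    obtain ⟨y, hy, z, hz, rfl⟩ := Submodule.mem_sup.1 ha
    rw [add_mul]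
    exact Submodule.add_mem_sup (J.mul_mem_right b hy) (K.mul_mem_right b hz)

/-- The ideals `J i` cover `R`: their intersection is zero. -/
def IsCovering (J : I → Ideal R) : Prop := ⨅ i, J i = ⊥

/-- The covering completion: families `x i` in `R / J i` whose members agree in `R / (J i + J j)`. -/
def coveringCompletion (J : I → Ideal R) [∀ i, (J i).IsTwoSided] :
    Subalgebra ℂ (∀ i, R ⧸ J i) where
  carrier := {x | ∀ i j,
    Ideal.Quotient.factorₐ ℂ (le_sup_left : J i ≤ J i ⊔ J j) (x i) =
      Ideal.Quotient.factorₐ ℂ (le_sup_right : J j ≤ J i ⊔ J j) (x j)}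
  mul_mem' {x y} hx hy i j := by
    rw [Pi.mul_apply, Pi.mul_apply, map_mul, map_mul, hx i j, hy i j]
  add_mem' {x y} hx hy i j := by
    rw [Pi.add_apply, Pi.add_apply, map_add, map_add, hx i j, hy i j]
  algebraMap_mem' r i j := by
    rw [Pi.algebraMap_apply, Pi.algebraMap_apply, AlgHom.commutes, AlgHom.commutes]

/-- The canonical map of `R` into its covering completion. -/
def toCompletion (J : I → Ideal R) [∀ i, (J i).IsTwoSided] : R →ₐ[ℂ] coveringCompletion J :=
  AlgHom.codRestrict (AlgHom.pi fun i => Ideal.Quotient.mkₐ ℂ (J i)) (coveringCompletion J)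
    (fun _ _ _ => rfl)

/-- A covering is complete if the canonical map onto the covering completion is onto
(it is injective because the intersection of the ideals is zero). -/
def IsCompleteCovering (J : I → Ideal R) [∀ i, (J i).IsTwoSided] : Prop :=
  IsCovering J ∧ Function.Surjective (toCompletion J)

end Covering

/-! ### Right comodule algebras and locally trivial bundles -/

section Hopf

variable {H : Type*} [Ring H] [HopfAlgebra ℂ H]

/-- `Δ` makes the algebra `A` a right `H`-comodule algebra. -/
def IsRightCoaction {A : Type*} [Ring A] [Algebra ℂ A] (Δ : A →ₐ[ℂ] A ⊗[ℂ] H) : Prop :=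
  (∀ a, TensorProduct.assoc ℂ A H H (Δ.toLinearMap.rTensor H (Δ a)) =
      (Coalgebra.comul (R := ℂ) (A := H)).lTensor A (Δ a)) ∧
  (∀ a, TensorProduct.rid ℂ A ((Coalgebra.counit (R := ℂ) (A := H)).lTensor A (Δ a)) = a)

/-- The inverse of the antipode, for a Hopf algebra with invertible antipode. -/
def antipodeInv (hS : Function.Bijective (HopfAlgebra.antipode ℂ : H →ₗ[ℂ] H)) : H →ₗ[ℂ] H :=
  (LinearEquiv.ofBijective (HopfAlgebra.antipode ℂ : H →ₗ[ℂ] H) hS).symm.toLinearMap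

/-- Convolution `h ↦ ∑ f (h₁) * g (h₂)`. -/
def convolve {A : Type*} [Ring A] [Algebra ℂ A] (f g : H →ₗ[ℂ] A) : H →ₗ[ℂ] A :=
  LinearMap.mul' ℂ A ∘ₗ TensorProduct.map f g ∘ₗ Coalgebra.comul

end Hopf

/-- A locally trivial quantum principal fibre bundle with total space `P`, base `B`, structure
group `H`, covering `J`, embedding `ι` of the base and local trivializations `χ`. -/
structure LocallyTrivialQPFB (I H B P : Type*) [Ring H] [HopfAlgebra ℂ H] [Ring B] [Algebra ℂ B]
    [Ring P] [Algebra ℂ P] where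
  J : I → Ideal B
  [twoSided : ∀ i, (J i).IsTwoSided]
  complete_base : IsCompleteCovering J
  coact : P →ₐ[ℂ] P ⊗[ℂ] H
  isRightCoaction : IsRightCoaction coact
  χ : ∀ i, P →ₐ[ℂ] (B ⧸ J i) ⊗[ℂ] H
  χ_surjective : ∀ i, Function.Surjective (χ i)
  ι : B →ₐ[ℂ] P
  ι_injective : Function.Injective ι
  χ_covariant : ∀ i p,
    (Coalgebra.comul (R := ℂ) (A := H)).lTensor (B ⧸ J i) (χ i p) =
      TensorProduct.assoc ℂ (B ⧸ J i) H H ((χ i).toLinearMap.rTensor H (coact p))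
  χ_ι : ∀ i b, χ i (ι b) = Ideal.Quotient.mk (J i) b ⊗ₜ[ℂ] (1 : H)
  complete_total : IsCompleteCovering fun i => RingHom.ker (χ i)
  range_ι : ∀ p, p ∈ Set.range ι ↔ coact p = p ⊗ₜ[ℂ] (1 : H)

attribute [instance] LocallyTrivialQPFB.twoSided

namespace LocallyTrivialQPFB

variable {I H B P : Type*} [Ring H] [HopfAlgebra ℂ H] [Ring B] [Algebra ℂ B]
  [Ring P] [Algebra ℂ P] (X : LocallyTrivialQPFB I H B P)

/-- The local algebra `B_i = B / J_i`. -/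
abbrev Loc (i : I) : Type _ := B ⧸ X.J i

/-- The overlap algebra `B_ij = B / (J_i + J_j)`. -/
abbrev Overlap (i j : I) : Type _ := B ⧸ (X.J i ⊔ X.J j)

/-- The projection `B_i → B_ij`. -/
def resLeft (i j : I) : X.Loc i →ₐ[ℂ] X.Overlap i j :=
  Ideal.Quotient.factorₐ ℂ le_sup_left

/-- The projection `B_j → B_ij`. -/
def resRight (i j : I) : X.Loc j →ₐ[ℂ] X.Overlap i j :=
  Ideal.Quotient.factorₐ ℂ le_sup_right

/-- The identification `B_ji = B_ij`. -/
def overlapSwap (i j : I) : X.Overlap j i →ₐ[ℂ] X.Overlap i j :=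
  Ideal.Quotient.factorₐ ℂ (le_of_eq (sup_comm _ _))

/-- The map `a ⊗ h ↦ ∑ a t(h₁) ⊗ h₂`. -/
def twist {A : Type*} [Ring A] [Algebra ℂ A] (t : H →ₐ[ℂ] A) : A ⊗[ℂ] H →ₗ[ℂ] A ⊗[ℂ] H :=
  (LinearMap.mul' ℂ A).rTensor H ∘ₗ (TensorProduct.assoc ℂ A A H).symm.toLinearMap ∘ₗ
    (t.toLinearMap.rTensor H ∘ₗ Coalgebra.comul).lTensor A

/-- `τ` is the family of transition functions `τ i j : H → B_ij` of the bundle: the change of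
trivialization `φ_ij`, which satisfies `(π^i_j ⊗ id) ∘ χ_i = φ_ij ∘ (π^j_i ⊗ id) ∘ χ_j`, is
`a ⊗ h ↦ ∑ a τ_ji(h₁) ⊗ h₂`. -/
def IsTransition (τ : ∀ i j, H →ₐ[ℂ] X.Overlap i j) : Prop :=
  ∀ i j p, (X.resLeft i j).toLinearMap.rTensor H (X.χ i p) =
    twist ((X.overlapSwap i j).comp (τ j i))
      ((X.resRight i j).toLinearMap.rTensor H (X.χ j p))

end LocallyTrivialQPFB

/-! ### Differential calculi -/

/-- A differential calculus over `B`: an `ℕ`-graded differential algebra with degree zero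
part `B`, generated as an algebra by the elements `b` and `d b`. -/
structure DifferentialCalculus.{u, v} (B : Type u) [Ring B] [Algebra ℂ B] where
  carrier : Type v
  [ring : Ring carrier]
  [algebra : Algebra ℂ carrier]
  deg : ℕ → Submodule ℂ carrier
  [graded : GradedAlgebra deg]
  incl : B →ₐ[ℂ] carrier
  incl_injective : Function.Injective incl
  range_incl : LinearMap.range incl.toLinearMap = deg 0
  d : carrier →ₗ[ℂ] carrier
  d_mem : ∀ n, ∀ x ∈ deg n, d x ∈ deg (n + 1)
  d_d : ∀ x, d (d x) = 0
  leibniz : ∀ n, ∀ x ∈ deg n, ∀ y, d (x * y) = d x * y + (-1 : ℂ) ^ n • (x * d y)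
  generated : Algebra.adjoin ℂ (Set.range incl ∪ Set.range fun b => d (incl b)) = ⊤

attribute [instance] DifferentialCalculus.ring DifferentialCalculus.algebra
  DifferentialCalculus.graded

namespace DifferentialCalculus

section One

variable {B : Type*} [Ring B] [Algebra ℂ B] (Γ : DifferentialCalculus B)

/-- The universal first order map `b ↦ d b`. -/
def dB : B →ₗ[ℂ] Γ.carrier := Γ.d ∘ₗ Γ.incl.toLinearMap

/-- The grading involution `γ ↦ (-1)^n γ` for `γ` of degree `n`. -/
def sign : Γ.carrier →ₗ[ℂ] Γ.carrier :=
  DirectSum.toModule ℂ ℕ Γ.carrier (fun n => (-1 : ℂ) ^ n • (Γ.deg n).subtype) ∘ₗ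
    (DirectSum.decomposeLinearEquiv Γ.deg).toLinearMap

/-- The identification of `B` with the forms of degree zero. -/
def zeroEquiv : B ≃ₗ[ℂ] Γ.deg 0 :=
  (LinearEquiv.ofInjective Γ.incl.toLinearMap Γ.incl_injective).trans
    (LinearEquiv.ofEq _ _ Γ.range_incl)

/-- The degree zero component of a form, as an element of `B`. -/
def zeroPart : Γ.carrier →ₗ[ℂ] B :=
  Γ.zeroEquiv.symm.toLinearMap ∘ₗ DirectSum.component ℂ ℕ (fun n => Γ.deg n) 0 ∘ₗ
    (DirectSum.decomposeLinearEquiv Γ.deg).toLinearMap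

theorem incl_mem (b : B) : Γ.incl b ∈ Γ.deg 0 := by
  rw [← Γ.range_incl]
  exact ⟨b, rfl⟩

theorem d_one : Γ.d 1 = 0 := by
  have h := Γ.leibniz 0 1 (SetLike.one_mem_graded Γ.deg) 1
  simpa using h

theorem sign_of_mem {n : ℕ} {x : Γ.carrier} (hx : x ∈ Γ.deg n) :
    Γ.sign x = (-1 : ℂ) ^ n • x := by
  lift x to Γ.deg n using hx
  simp [sign]

end One

section Two

variable {A B : Type*} [Ring A] [Algebra ℂ A] [Ring B] [Algebra ℂ B]
  (Γ : DifferentialCalculus A) (Λ : DifferentialCalculus B)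

/-- The skew tensor product of two differential calculi, with the product
`(γ ⊗ ρ)(ω ⊗ τ) = (-1)^(mn) γω ⊗ ρτ` for `ω` of degree `n` and `ρ` of degree `m`. -/
abbrev Skew : Type _ := GradedTensorProduct ℂ Γ.deg Λ.deg

/-- The differential `d (γ ⊗ ρ) = dγ ⊗ ρ + (-1)^n γ ⊗ dρ` for `γ` of degree `n`. -/
def skewD : Skew Γ Λ →ₗ[ℂ] Skew Γ Λ :=
  (GradedTensorProduct.of ℂ Γ.deg Λ.deg).toLinearMap ∘ₗ
    (TensorProduct.map Γ.d LinearMap.id + TensorProduct.map Γ.sign Λ.d) ∘ₗ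
      (GradedTensorProduct.of ℂ Γ.deg Λ.deg).symm.toLinearMap

/-- The embedding of `A ⊗ B` as the forms of degree zero. -/
def skewIncl : A ⊗[ℂ] B →ₗ[ℂ] Skew Γ Λ :=
  (GradedTensorProduct.of ℂ Γ.deg Λ.deg).toLinearMap ∘ₗ
    TensorProduct.map Γ.incl.toLinearMap Λ.incl.toLinearMap

/-- The embedding `γ ↦ γ ⊗ 1`. -/
def inLeft : Γ.carrier →ₐ[ℂ] Skew Γ Λ := GradedTensorProduct.includeLeft Γ.deg Λ.deg

/-- The subspace `Γ(A) ⊗ B` of horizontal forms. -/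
def horizontal : Submodule ℂ (Skew Γ Λ) :=
  LinearMap.range ((GradedTensorProduct.of ℂ Γ.deg Λ.deg).toLinearMap ∘ₗ
    Λ.incl.toLinearMap.lTensor Γ.carrier)

theorem skewD_left (a : A) : skewD Γ Λ (skewIncl Γ Λ (a ⊗ₜ 1)) = inLeft Γ Λ (Γ.d (Γ.incl a)) := by
  simp [skewD, skewIncl, inLeft, d_one, GradedTensorProduct.includeLeft_apply]

theorem skewD_right (b : B) : skewD Γ Λ (skewIncl Γ Λ (1 ⊗ₜ b)) =
    GradedTensorProduct.includeRight Γ.deg Λ.deg (Λ.d (Λ.incl b)) := by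
  have h : Γ.sign 1 = 1 := by simpa using Γ.sign_of_mem (SetLike.one_mem_graded Γ.deg)
  simp [skewD, skewIncl, d_one, h]

end Two

end DifferentialCalculus

open DifferentialCalculus

/-- A right covariant differential calculus over a Hopf algebra: the coaction is determined by
`Δ^Γ (h₀ d h₁ ⋯ d hₙ) = Δ(h₀) (d ⊗ id)Δ(h₁) ⋯ (d ⊗ id)Δ(hₙ)`. -/
structure RightCovariantCalculus.{u, v} (H : Type u) [Ring H] [HopfAlgebra ℂ H] extends
    DifferentialCalculus.{u, v} H where
  coact : carrier →ₐ[ℂ] carrier ⊗[ℂ] H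
  isRightCoaction : IsRightCoaction coact
  coact_incl : ∀ h : H, coact (incl h) =
    incl.toLinearMap.rTensor H (Coalgebra.comul (R := ℂ) h)
  coact_d : ∀ h : H, coact (d (incl h)) =
    (toDifferentialCalculus.dB).rTensor H (Coalgebra.comul (R := ℂ) h)

namespace RightCovariantCalculus

variable {H : Type*} [Ring H] [HopfAlgebra ℂ H] (Γ : RightCovariantCalculus H)
  (hS : Function.Bijective (HopfAlgebra.antipode ℂ : H →ₗ[ℂ] H))

/-- The map `η(h) = ∑ S⁻¹(h₂) d h₁`. -/
def eta : H →ₗ[ℂ] Γ.carrier :=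
  LinearMap.mul' ℂ Γ.carrier ∘ₗ
    TensorProduct.map (Γ.incl.toLinearMap ∘ₗ antipodeInv hS) Γ.toDifferentialCalculus.dB ∘ₗ
      (TensorProduct.comm ℂ H H).toLinearMap ∘ₗ Coalgebra.comul

/-- The right ideal `R = ker η ∩ ker ε` of `H` that corresponds to the calculus. -/
def rightIdeal : Submodule ℂ H :=
  LinearMap.ker (Γ.eta hS) ⊓ LinearMap.ker (Coalgebra.counit (R := ℂ) (A := H))

/-- The counit of `H`, extended by zero to the forms of positive degree. -/
def counitΓ : Γ.carrier →ₗ[ℂ] ℂ := Coalgebra.counit ∘ₗ Γ.toDifferentialCalculus.zeroPart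

end RightCovariantCalculus

/-! ### Differential structures on a bundle -/

set_option linter.checkUnivs false in
/-- A differential structure on a locally trivial bundle: differential calculi `Γ(B_i)`, a right
covariant differential calculus `Γ(H)`, and the differential calculus `Γ(P)` that is adapted to
the covering `ker χ_i` and the calculi `Γ(B_i) ⊗ Γ(H)`, i.e. each `χ_i` extends to a homomorphism
of differential algebras and the kernels of the extensions have intersection zero. -/
structure DifferentialStructure.{uI, uH, uB, uP, vH, vB, vP} {I : Type uI} {H : Type uH}
    {B : Type uB} {P : Type uP} [Ring H] [HopfAlgebra ℂ H] [Ring B] [Algebra ℂ B]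
    [Ring P] [Algebra ℂ P] (X : LocallyTrivialQPFB I H B P) where
  ΓB : ∀ i, DifferentialCalculus.{uB, vB} (X.Loc i)
  ΓH : RightCovariantCalculus.{uH, vH} H
  ΓP : DifferentialCalculus.{uP, vP} P
  χΓ : ∀ i, ΓP.carrier →ₐ[ℂ] Skew (ΓB i) ΓH.toDifferentialCalculus
  χΓ_incl : ∀ i p, χΓ i (ΓP.incl p) = skewIncl (ΓB i) ΓH.toDifferentialCalculus (X.χ i p)
  χΓ_d : ∀ i x, χΓ i (ΓP.d x) = skewD (ΓB i) ΓH.toDifferentialCalculus (χΓ i x)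
  covering : IsCovering fun i => RingHom.ker (χΓ i)

namespace DifferentialStructure

variable {I H B P : Type*} [Ring H] [HopfAlgebra ℂ H] [Ring B] [Algebra ℂ B]
  [Ring P] [Algebra ℂ P] {X : LocallyTrivialQPFB I H B P} (D : DifferentialStructure X)

/-- The local calculus `Γ(B_i) ⊗ Γ(H)`. -/
abbrev Local (i : I) : Type _ := Skew (D.ΓB i) D.ΓH.toDifferentialCalculus

theorem χΓ_surjective (i : I) : Function.Surjective (D.χΓ i) := by
  have h0 : ∀ z, skewIncl (D.ΓB i) D.ΓH.toDifferentialCalculus z ∈ (D.χΓ i).range := by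
    intro z
    obtain ⟨p, rfl⟩ := X.χ_surjective i z
    exact ⟨_, D.χΓ_incl i p⟩
  have h1 : ∀ z, skewD (D.ΓB i) D.ΓH.toDifferentialCalculus
      (skewIncl (D.ΓB i) D.ΓH.toDifferentialCalculus z) ∈ (D.χΓ i).range := by
    intro z
    obtain ⟨p, rfl⟩ := X.χ_surjective i z
    exact ⟨D.ΓP.d (D.ΓP.incl p), by
      rw [AlgHom.toRingHom_eq_coe, RingHom.coe_coe, D.χΓ_d, D.χΓ_incl]⟩
  have hL : (D.χΓ i).range.comap (inLeft (D.ΓB i) D.ΓH.toDifferentialCalculus) = ⊤ := by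
    rw [eq_top_iff, ← (D.ΓB i).generated]
    refine Algebra.adjoin_le ?_
    rintro _ (⟨b, rfl⟩ | ⟨b, rfl⟩)
    · have h := h0 (b ⊗ₜ 1)
      simpa [skewIncl, inLeft, GradedTensorProduct.includeLeft_apply] using h
    · have h := h1 (b ⊗ₜ 1)
      rw [skewD_left] at h
      exact h
  have hR : (D.χΓ i).range.comap
      (GradedTensorProduct.includeRight (D.ΓB i).deg D.ΓH.deg) = ⊤ := by
    rw [eq_top_iff, ← D.ΓH.generated]
    refine Algebra.adjoin_le ?_
    rintro _ (⟨b, rfl⟩ | ⟨b, rfl⟩)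
    · have h := h0 (1 ⊗ₜ b)
      simp only [skewIncl, LinearMap.comp_apply, TensorProduct.map_tmul,
        AlgHom.toLinearMap_apply, map_one] at h
      exact h
    · have h := h1 (1 ⊗ₜ b)
      rw [skewD_right] at h
      exact h
  intro y
  change y ∈ (D.χΓ i).range
  induction y using TensorProduct.induction_on with
  | zero => exact zero_mem _
  | add x y hx hy => exact add_mem hx hy
  | tmul a b =>
    have ha : a ∈ (D.χΓ i).range.comap (inLeft (D.ΓB i) D.ΓH.toDifferentialCalculus) :=
      hL ▸ Algebra.mem_top
    have hb : b ∈ (D.χΓ i).range.comap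
        (GradedTensorProduct.includeRight (D.ΓB i).deg D.ΓH.deg) := hR ▸ Algebra.mem_top
    have h := mul_mem ((Subalgebra.mem_comap _ _ _).1 ha) ((Subalgebra.mem_comap _ _ _).1 hb)
    have e : inLeft (D.ΓB i) D.ΓH.toDifferentialCalculus a *
        GradedTensorProduct.includeRight (D.ΓB i).deg D.ΓH.deg b =
          GradedTensorProduct.tmul ℂ a b :=
      GradedTensorProduct.tmul_one_mul_one_tmul _ _ a b
    rw [e] at h
    exact h

/-- The kernel of the extension of `χ_i`, an ideal of `Γ(P)`. -/
abbrev kerχ (i : I) : Ideal D.ΓP.carrier := RingHom.ker (D.χΓ i)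

/-- The covering completion `Γ_c(P)` of `Γ(P)`. -/
abbrev Completed : Subalgebra ℂ (∀ i, D.ΓP.carrier ⧸ D.kerχ i) := coveringCompletion D.kerχ

/-- The one-forms `Γ_c¹(P)`. -/
def forms : Submodule ℂ (∀ i, D.ΓP.carrier ⧸ D.kerχ i) :=
  Subalgebra.toSubmodule D.Completed ⊓
    ⨅ i, ((D.ΓP.deg 1).map (Ideal.Quotient.mkₐ ℂ (D.kerχ i)).toLinearMap).comap
      (LinearMap.proj i)

theorem mem_forms {x : ∀ i, D.ΓP.carrier ⧸ D.kerχ i} : x ∈ D.forms ↔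
    x ∈ D.Completed ∧ ∀ i, ∃ y ∈ D.ΓP.deg 1, Ideal.Quotient.mk (D.kerχ i) y = x i := by
  simp [forms]

/-- The extension of `χ_i` to the one-forms of the completion, with values in
`Γ(B_i) ⊗ Γ(H)`. -/
def χc (i : I) : D.forms →ₗ[ℂ] D.Local i :=
  (Ideal.kerLiftAlg (D.χΓ i)).toLinearMap ∘ₗ LinearMap.proj i ∘ₗ D.forms.subtype

/-- The horizontal one-forms `hor Γ_c¹(P)`: all `χ_i(γ)` lie in `Γ(B_i) ⊗ H`. -/
def horForms : Submodule ℂ D.forms :=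
  ⨅ i, (horizontal (D.ΓB i) D.ΓH.toDifferentialCalculus).comap (D.χc i)

/-- The left action of `P` on the one-forms. -/
def leftMul (p : P) : D.forms →ₗ[ℂ] D.forms :=
  (LinearMap.mulLeft ℂ (toCompletion D.kerχ (D.ΓP.incl p) :
    ∀ i, D.ΓP.carrier ⧸ D.kerχ i)).restrict (by
      intro x hx
      rw [mem_forms] at hx ⊢
      refine ⟨mul_mem (toCompletion D.kerχ (D.ΓP.incl p)).2 hx.1, fun i => ?_⟩
      obtain ⟨y, hy, e⟩ := hx.2 i
      refine ⟨D.ΓP.incl p * y, ?_, ?_⟩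
      · simpa using SetLike.mul_mem_graded (D.ΓP.incl_mem p) hy
      · rw [map_mul, e]
        rfl)

/-- The right action of `P` on the one-forms. -/
def rightMul (p : P) : D.forms →ₗ[ℂ] D.forms :=
  (LinearMap.mulRight ℂ (toCompletion D.kerχ (D.ΓP.incl p) :
    ∀ i, D.ΓP.carrier ⧸ D.kerχ i)).restrict (by
      intro x hx
      rw [mem_forms] at hx ⊢
      refine ⟨mul_mem hx.1 (toCompletion D.kerχ (D.ΓP.incl p)).2, fun i => ?_⟩
      obtain ⟨y, hy, e⟩ := hx.2 i
      refine ⟨y * D.ΓP.incl p, ?_, ?_⟩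
      · simpa using SetLike.mul_mem_graded hy (D.ΓP.incl_mem p)
      · rw [map_mul, e]
        rfl)

/-- The differential `p ↦ d p`, with values in the one-forms of the completion. -/
def dP : P →ₗ[ℂ] D.forms :=
  LinearMap.codRestrict D.forms
    (D.Completed.val.toLinearMap ∘ₗ (toCompletion D.kerχ).toLinearMap ∘ₗ D.ΓP.dB)
    (fun p => D.mem_forms.2 ⟨(toCompletion D.kerχ (D.ΓP.dB p)).2, fun _ =>
      ⟨D.ΓP.dB p, D.ΓP.d_mem 0 _ (D.ΓP.incl_mem p), rfl⟩⟩)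

/-- The right coaction `id ⊗ Δ^Γ` on `Γ(B_i) ⊗ Γ(H)`. -/
def localCoact (i : I) : D.Local i →ₗ[ℂ] D.Local i ⊗[ℂ] H :=
  (GradedTensorProduct.of ℂ (D.ΓB i).deg D.ΓH.deg).toLinearMap.rTensor H ∘ₗ
    (TensorProduct.assoc ℂ (D.ΓB i).carrier D.ΓH.carrier H).symm.toLinearMap ∘ₗ
      D.ΓH.coact.toLinearMap.lTensor (D.ΓB i).carrier ∘ₗ
        (GradedTensorProduct.of ℂ (D.ΓB i).deg D.ΓH.deg).symm.toLinearMap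

/-- `t = Δ^{Γ_c}(γ)`. The coaction of `H` on the completion is the unique map with
`(χ_i ⊗ id) ∘ Δ^{Γ_c} = (id ⊗ Δ^Γ) ∘ χ_i` for all `i`. -/
def IsCoactionOf (γ : D.forms) (t : D.forms ⊗[ℂ] H) : Prop :=
  ∀ i, (D.χc i).rTensor H t = D.localCoact i (D.χc i γ)

/-- `(f ⊗ id) ∘ Δ^{Γ_c} = Δ^{Γ_c} ∘ f`. -/
def IsCovariant (f : D.forms →ₗ[ℂ] D.forms) : Prop :=
  ∀ γ, ∃ t, D.IsCoactionOf γ t ∧ D.IsCoactionOf (f γ) (f.rTensor H t)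

/-! ### Connections -/

/-- The conditions common to left and right connections: a covariant projection of the one-forms
onto the horizontal one-forms that respects the kernels of the `χ_i`. -/
structure IsProjection (f : D.forms →ₗ[ℂ] D.forms) : Prop where
  range_eq : LinearMap.range f = D.horForms
  idem : ∀ γ, f (f γ) = f γ
  covariant : D.IsCovariant f
  ker_le : ∀ i γ, D.χc i γ = 0 → D.χc i (f γ) = 0

/-- A left connection. -/
structure LeftConnection where
  hor : D.forms →ₗ[ℂ] D.forms
  isProjection : D.IsProjection hor
  map_leftMul : ∀ p γ, hor (D.leftMul p γ) = D.leftMul p (hor γ)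

/-- A right connection. -/
structure RightConnection where
  hor : D.forms →ₗ[ℂ] D.forms
  isProjection : D.IsProjection hor
  map_rightMul : ∀ p γ, hor (D.rightMul p γ) = D.rightMul p (hor γ)

/-- The map `id ⊗ ε` on `Γ(B_i) ⊗ Γ(H)`. -/
def idCounit (i : I) : D.Local i →ₗ[ℂ] (D.ΓB i).carrier :=
  (TensorProduct.rid ℂ (D.ΓB i).carrier).toLinearMap ∘ₗ
    D.ΓH.counitΓ.lTensor (D.ΓB i).carrier ∘ₗ
      (GradedTensorProduct.of ℂ (D.ΓB i).deg D.ΓH.deg).symm.toLinearMap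

variable (X) in
/-- A linear map `H → P` with `χ_i(p) = 1 ⊗ h` for the value `p` at `h`. -/
def liftH (i : I) : H →ₗ[ℂ] P :=
  ((X.χ i).toLinearMap.exists_rightInverse_of_surjective
    (LinearMap.range_eq_top.2 (X.χ_surjective i))).choose ∘ₗ
      TensorProduct.mk ℂ (X.Loc i) H 1

variable (X) in
theorem χ_liftH (i : I) (h : H) : X.χ i (liftH X i h) = 1 ⊗ₜ h :=
  LinearMap.congr_fun ((X.χ i).toLinearMap.exists_rightInverse_of_surjective
    (LinearMap.range_eq_top.2 (X.χ_surjective i))).choose_spec (1 ⊗ₜ h)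

/-- The local connection map `A_i(h) = -(id ⊗ ε) hor_i(1 ⊗ d h)`, where `hor_i` is the map that
`hor` induces on the one-forms of `Γ(B_i) ⊗ Γ(H)`, so that `hor_i ∘ χ_i = χ_i ∘ hor`. The one-form
`d p` with `χ_i(p) = 1 ⊗ h` is used as a preimage of `1 ⊗ d h`; see `localMap_eq`. -/
def localMap (hor : D.forms →ₗ[ℂ] D.forms) (i : I) : H →ₗ[ℂ] (D.ΓB i).carrier :=
  -(D.idCounit i ∘ₗ D.χc i ∘ₗ hor ∘ₗ D.dP ∘ₗ liftH X i)

theorem χc_dP_liftH (i : I) (h : H) : D.χc i (D.dP (liftH X i h)) =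
    GradedTensorProduct.includeRight (D.ΓB i).deg D.ΓH.deg (D.ΓH.d (D.ΓH.incl h)) := by
  have e : D.χc i (D.dP (liftH X i h)) = D.χΓ i (D.ΓP.d (D.ΓP.incl (liftH X i h))) := rfl
  rw [e, D.χΓ_d, D.χΓ_incl, χ_liftH, skewD_right]

/-- The local connection map does not depend on the choice of the preimage of `1 ⊗ d h`. -/
theorem localMap_eq {hor : D.forms →ₗ[ℂ] D.forms} (hh : D.IsProjection hor) (i : I) (h : H)
    (γ : D.forms) (hγ : D.χc i γ =
      GradedTensorProduct.includeRight (D.ΓB i).deg D.ΓH.deg (D.ΓH.d (D.ΓH.incl h))) :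
    D.localMap hor i h = -D.idCounit i (D.χc i (hor γ)) := by
  have h0 := hh.ker_le i (D.dP (liftH X i h) - γ) (by rw [map_sub, χc_dP_liftH, hγ, sub_self])
  rw [map_sub, map_sub, sub_eq_zero] at h0
  simp [localMap, h0]

/-! ### Conditions on local connection maps -/

/-- The calculus `Γ(P) / (ker χ_i + ker χ_j)` over the overlap, which contains `Γ_m(B_ij)` as the
subalgebra generated by `b` and `d b`, `b ∈ B_ij`. -/
abbrev OverlapForms (i j : I) : Type _ := D.ΓP.carrier ⧸ (D.kerχ i ⊔ D.kerχ j)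

/-- The projection `(π^i_j ⊗ id)_Γ` of `Γ(B_i) ⊗ Γ(H) = Γ(P) / ker χ_i`. -/
def projLeft (i j : I) : D.Local i →ₐ[ℂ] D.OverlapForms i j :=
  (Ideal.Quotient.factorₐ ℂ (le_sup_left : D.kerχ i ≤ D.kerχ i ⊔ D.kerχ j)).comp
    (Ideal.quotientKerAlgEquivOfSurjective (D.χΓ_surjective i)).symm.toAlgHom

/-- The projection `(π^j_i ⊗ id)_Γ` of `Γ(B_j) ⊗ Γ(H) = Γ(P) / ker χ_j`. -/
def projRight (i j : I) : D.Local j →ₐ[ℂ] D.OverlapForms i j :=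
  (Ideal.Quotient.factorₐ ℂ (le_sup_right : D.kerχ j ≤ D.kerχ i ⊔ D.kerχ j)).comp
    (Ideal.quotientKerAlgEquivOfSurjective (D.χΓ_surjective j)).symm.toAlgHom

theorem d_mem_ker {i j : I} {x : D.ΓP.carrier} (hx : x ∈ D.kerχ i ⊔ D.kerχ j) :
    D.ΓP.d x ∈ D.kerχ i ⊔ D.kerχ j := by
  obtain ⟨y, hy, z, hz, rfl⟩ := Submodule.mem_sup.1 hx
  rw [map_add]
  refine Submodule.add_mem_sup ?_ ?_
  · rw [RingHom.mem_ker] at hy ⊢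
    rw [D.χΓ_d, hy, map_zero]
  · rw [RingHom.mem_ker] at hz ⊢
    rw [D.χΓ_d, hz, map_zero]

/-- The differential of the calculus over the overlap. -/
def overlapD (i j : I) : D.OverlapForms i j →ₗ[ℂ] D.OverlapForms i j :=
  (Submodule.Quotient.restrictScalarsEquiv ℂ (D.kerχ i ⊔ D.kerχ j)).toLinearMap ∘ₗ
    Submodule.mapQ _ _ D.ΓP.d (fun _ hx => D.d_mem_ker hx) ∘ₗ
      (Submodule.Quotient.restrictScalarsEquiv ℂ (D.kerχ i ⊔ D.kerχ j)).symm.toLinearMap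

theorem incl_ι_mem_ker {i : I} {b : B} (hb : b ∈ X.J i) : D.ΓP.incl (X.ι b) ∈ D.kerχ i := by
  rw [RingHom.mem_ker, D.χΓ_incl, X.χ_ι, Ideal.Quotient.eq_zero_iff_mem.2 hb,
    TensorProduct.zero_tmul, map_zero]

/-- The embedding of `B_ij` into the calculus over the overlap, induced by `ι`. -/
def overlapIncl (i j : I) : X.Overlap i j →ₐ[ℂ] D.OverlapForms i j :=
  Ideal.Quotient.liftₐ _ ((Ideal.Quotient.mkₐ ℂ (D.kerχ i ⊔ D.kerχ j)).comp
    (D.ΓP.incl.comp X.ι)) (by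
      intro b hb
      obtain ⟨y, hy, z, hz, rfl⟩ := Submodule.mem_sup.1 hb
      refine Ideal.Quotient.eq_zero_iff_mem.2 ?_
      change D.ΓP.incl (X.ι (y + z)) ∈ _
      rw [map_add, map_add]
      exact Submodule.add_mem_sup (D.incl_ι_mem_ker hy) (D.incl_ι_mem_ker hz))

/-- The compatibility condition
`π^i_j(A_i(h)) = ∑ τ_ij(h₁) π^j_i(A_j(h₂)) τ_ji(h₃) + ∑ τ_ij(h₁) d τ_ji(h₂)`. -/
def IsCompatible (τ : ∀ i j, H →ₐ[ℂ] X.Overlap i j)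
    (A : ∀ i, H →ₗ[ℂ] (D.ΓB i).carrier) : Prop :=
  ∀ i j,
    (D.projLeft i j).toLinearMap ∘ₗ (inLeft _ _).toLinearMap ∘ₗ A i =
      convolve
        (convolve ((D.overlapIncl i j).comp (τ i j)).toLinearMap
          ((D.projRight i j).toLinearMap ∘ₗ (inLeft _ _).toLinearMap ∘ₗ A j))
        ((D.overlapIncl i j).comp ((X.overlapSwap i j).comp (τ j i))).toLinearMap +
      convolve ((D.overlapIncl i j).comp (τ i j)).toLinearMap
        (D.overlapD i j ∘ₗ
          ((D.overlapIncl i j).comp ((X.overlapSwap i j).comp (τ j i))).toLinearMap)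

/-- The kernel condition `R ⊆ ker A_i` of left connections. -/
def LeftKernel (hS : Function.Bijective (HopfAlgebra.antipode ℂ : H →ₗ[ℂ] H))
    (A : ∀ i, H →ₗ[ℂ] (D.ΓB i).carrier) : Prop :=
  ∀ i, D.ΓH.rightIdeal hS ≤ LinearMap.ker (A i)

/-- The kernel condition `S⁻¹(R) ⊆ ker A_i` of right connections. -/
def RightKernel (hS : Function.Bijective (HopfAlgebra.antipode ℂ : H →ₗ[ℂ] H))
    (A : ∀ i, H →ₗ[ℂ] (D.ΓB i).carrier) : Prop :=
  ∀ i, (D.ΓH.rightIdeal hS).map (antipodeInv hS) ≤ LinearMap.ker (A i)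

/-- The maps `A_i` take values in the one-forms of `B_i` and vanish at `1`. -/
def IsNormalized (A : ∀ i, H →ₗ[ℂ] (D.ΓB i).carrier) : Prop :=
  (∀ i h, A i h ∈ (D.ΓB i).deg 1) ∧ ∀ i, A i 1 = 0

/-- The family `-A_i ∘ S`. -/
def negAntipode (A : ∀ i, H →ₗ[ℂ] (D.ΓB i).carrier) : ∀ i, H →ₗ[ℂ] (D.ΓB i).carrier :=
  fun i => -(A i ∘ₗ (HopfAlgebra.antipode ℂ : H →ₗ[ℂ] H))

end DifferentialStructure

end

/-! Everything is reduced to the convolution algebras Hom(H, A), where an algebra homomorphism f is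
a unit with inverse f∘S.

Transition functions. The point is that χ_j(p) determines the image of χ_i(p) over the overlap
(`resLeft_χ_eq_zero`). Given χ_j(p) = 0, averaging p ↦ ∑ p₀ n(p₁), with n a lift of h ↦ ∑ S(h₁)φ(h₂)
through χ_i, gives an element that is still killed by χ_j and whose image under χ_i is b ⊗ 1. It is
coinvariant modulo ker χ_i ∩ ker χ_j, and `exists_coinvariant` replaces it by a true coinvariant
ι(c): averaging with a lift of S through χ_i multiplies the failure of coinvariance by ker χ_i, so
after one pass through the finite set I this failure lies in ⋂ ker χ_i = 0. Hence b ∈ J_i + J_j. The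
resulting change of trivialization is B-linear and colinear, so id ⊗ ε turns it into a homomorphism
τ_ji.

Connections. Left and right connections are treated together; a Boolean records the side from which
functions act. Covariance and horizontality force hor_i(1 ⊗ dk) = -∑ A_i(k₁) ⊗ k₂, hence hor_i(d(a ⊗
h)) = da ⊗ h - ∑ a A_i(h₁) ⊗ h₂ (`IsConnection.local_dLoc`). So a connection is determined by its
local maps. Compatibility says exactly that these forms, taken for χ_i(p) and χ_j(p), agree over the
overlap (`isCompatible_iff`). The kernel condition comes from applying hor_i to η(h) = 0.

Conversely, given (A_i), the kernel condition lets A_i factor through η. The coaction of Γ(H),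
untwisted by the antipode, carries h dk to ∑ η(k₁) ⊗ h k₂, which makes h dk ↦ ∑ h A_i(k₁)k₂ well
defined (`exists_vertical`). The local projections so obtained glue by compatibility (`exists_hor`,
`exists_isConnection`).

The correspondence. In the overlap calculus the values of τ_ij and τ_ji commute with all forms
coming from the base (`commute_transSwap`), because the two copies of H coming from the two
trivializations do. Since S reverses convolution products of commuting maps and exchanges τ_ij with
τ_ji, composing the compatibility condition with S gives the same condition for -A_i∘S; the
inhomogeneous term changes sign by the Leibniz rule for τ_ij * τ_ji = 1. The kernel conditions match
by definition, so A ↦ -A∘S carries the local maps of left connections onto those of right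
connections. -/

noncomputable section

/-! ### Convolution, the antipode and its inverse -/

section Convolution

open Coalgebra HopfAlgebra WithConv LinearMap

variable {H : Type*} [Ring H] [HopfAlgebra ℂ H] {A : Type*} [Ring A] [Algebra ℂ A]

theorem toConv_convolve (f g : H →ₗ[ℂ] A) : toConv (convolve f g) = toConv f * toConv g := rfl

theorem convolve_repr {h : H} {ι : Type*} (r : Repr ℂ h ι) (f g : H →ₗ[ℂ] A) :
    convolve f g h = ∑ i ∈ r.index, f (r.left i) * g (r.right i) := by
  simp [convolve, ← r.eq]

theorem sum_counit_right_smul {h : H} {ι : Type*} (r : Repr ℂ h ι) :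
    ∑ i ∈ r.index, counit (R := ℂ) (r.right i) • r.left i = h := by
  have e := lTensor_counit_comul (R := ℂ) h
  rw [← r.eq] at e
  simpa [-sum_tmul_counit_eq] using congr(TensorProduct.rid ℂ H $e)

theorem algHom_mul_comp_antipode (f : H →ₐ[ℂ] A) :
    toConv f.toLinearMap * toConv (f.toLinearMap ∘ₗ antipode ℂ) = 1 := by
  ext h
  rw [(ℛ ℂ h).convMul_apply]
  simp [← map_mul, ← map_sum, sum_mul_antipode_eq_algebraMap_counit]

theorem comp_antipode_mul_algHom (f : H →ₐ[ℂ] A) :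
    toConv (f.toLinearMap ∘ₗ antipode ℂ) * toConv f.toLinearMap = 1 := by
  ext h
  rw [(ℛ ℂ h).convMul_apply]
  simp [← map_mul, ← map_sum, sum_antipode_mul_eq_algebraMap_counit]

theorem isUnit_toConv_algHom (f : H →ₐ[ℂ] A) : IsUnit (toConv f.toLinearMap) :=
  ⟨⟨_, _, algHom_mul_comp_antipode f, comp_antipode_mul_algHom f⟩, rfl⟩

/-- A left and a right inverse of the same element agree. This later identifies τ_ij∘S with τ_ji. -/
theorem comp_antipode_eq_of_mul_eq_one {f g : H →ₐ[ℂ] A}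
    (h : toConv f.toLinearMap * toConv g.toLinearMap = 1) :
    f.toLinearMap ∘ₗ antipode ℂ = g.toLinearMap :=
  toConv_injective (left_inv_eq_right_inv (comp_antipode_mul_algHom f) h)

/-- Both sides invert Δ in Hom(H, H ⊗ H): the left one because Δ is an algebra homomorphism, the
right one because Δ is the convolution product of the two coordinate embeddings, whose inverses
multiply in the opposite order. -/
theorem comul_comp_antipode : (comul : H →ₗ[ℂ] H ⊗[ℂ] H) ∘ₗ antipode ℂ =
    TensorProduct.map (antipode ℂ) (antipode ℂ) ∘ₗ (TensorProduct.comm ℂ H H).toLinearMap ∘ₗ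
      comul := by
  let l : H →ₐ[ℂ] H ⊗[ℂ] H := Algebra.TensorProduct.includeLeft
  let r : H →ₐ[ℂ] H ⊗[ℂ] H := Algebra.TensorProduct.includeRight
  have e₁ : toConv (comul : H →ₗ[ℂ] H ⊗[ℂ] H) = toConv l.toLinearMap * toConv r.toLinearMap := by
    ext h
    rw [(ℛ ℂ h).convMul_apply]
    simp [l, r, (ℛ ℂ h).eq]
  have e₂ : toConv (TensorProduct.map (antipode ℂ) (antipode ℂ) ∘ₗ
      (TensorProduct.comm ℂ H H).toLinearMap ∘ₗ comul) =
      toConv (r.toLinearMap ∘ₗ antipode ℂ) * toConv (l.toLinearMap ∘ₗ antipode ℂ) := by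
    ext h
    rw [(ℛ ℂ h).convMul_apply]
    simp [l, r, ← (ℛ ℂ h).eq]
  refine toConv_injective (left_inv_eq_right_inv (a := toConv (comul : H →ₗ[ℂ] H ⊗[ℂ] H)) ?_ ?_)
  · exact comp_antipode_mul_algHom (Bialgebra.comulAlgHom ℂ H)
  · rw [e₁, e₂, mul_assoc, ← mul_assoc (toConv r.toLinearMap), algHom_mul_comp_antipode, one_mul,
      algHom_mul_comp_antipode]

theorem convolve_antipode_apply (f g : H →ₗ[ℂ] A) (h : H) {ι : Type*} (r : Repr ℂ h ι) :
    convolve f g (antipode ℂ h) =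
      ∑ i ∈ r.index, f (antipode ℂ (r.right i)) * g (antipode ℂ (r.left i)) := by
  have e := LinearMap.congr_fun (comul_comp_antipode (H := H)) h
  simp only [LinearMap.comp_apply] at e
  simp [convolve, e, ← r.eq]

/-- The antipode reverses the coproduct, so the arguments are exchanged; commuting values allow the
factors to be exchanged as well. -/
theorem convolve_comp_antipode {f g : H →ₗ[ℂ] A} (hc : ∀ x y, Commute (f x) (g y)) :
    convolve f g ∘ₗ antipode ℂ = convolve (g ∘ₗ antipode ℂ) (f ∘ₗ antipode ℂ) := by
  ext h
  rw [LinearMap.comp_apply, convolve_antipode_apply f g h (ℛ ℂ h), convolve_repr (ℛ ℂ h)]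
  exact Finset.sum_congr rfl fun i _ => hc _ _

variable (hS : Function.Bijective (antipode ℂ : H →ₗ[ℂ] H))

@[simp]
theorem antipode_antipodeInv (h : H) : antipode ℂ (antipodeInv hS h) = h :=
  (LinearEquiv.ofBijective (antipode ℂ : H →ₗ[ℂ] H) hS).apply_symm_apply h

@[simp]
theorem antipodeInv_antipode (h : H) : antipodeInv hS (antipode ℂ h) = h :=
  (LinearEquiv.ofBijective (antipode ℂ : H →ₗ[ℂ] H) hS).symm_apply_apply h

@[simp]
theorem counit_antipodeInv (h : H) : counit (R := ℂ) (antipodeInv hS h) = counit (R := ℂ) h := by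
  conv_rhs => rw [← antipode_antipodeInv hS h, counit_antipode]

/-- Applying the injective, antimultiplicative S turns this into the usual antipode identity. -/
theorem sum_antipodeInv_mul {h : H} {ι : Type*} (r : Repr ℂ h ι) :
    ∑ i ∈ r.index, antipodeInv hS (r.right i) * r.left i = algebraMap ℂ H (counit (R := ℂ) h) := by
  apply hS.1
  simp only [map_sum, antipode_mul_antidistrib, antipode_antipodeInv]
  rw [sum_antipode_mul_eq_algebraMap_counit, Algebra.algebraMap_eq_smul_one, map_smul, antipode_one]

end Convolution

/-! ### Contraction of tensors with functionals on H -/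

section Functionals

variable {V W H : Type*} [AddCommGroup V] [Module ℂ V] [AddCommGroup W] [Module ℂ W]
  [AddCommGroup H] [Module ℂ H]

/-- Contraction of the second tensor factor with a functional. -/
def contract (φ : H →ₗ[ℂ] ℂ) : V ⊗[ℂ] H →ₗ[ℂ] V :=
  (TensorProduct.rid ℂ V).toLinearMap ∘ₗ φ.lTensor V

@[simp]
theorem contract_tmul (φ : H →ₗ[ℂ] ℂ) (v : V) (h : H) : contract φ (v ⊗ₜ[ℂ] h) = φ h • v := by
  simp [contract]

theorem contract_rTensor (φ : H →ₗ[ℂ] ℂ) (f : V →ₗ[ℂ] W) (t : V ⊗[ℂ] H) :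
    contract φ (f.rTensor H t) = f (contract φ t) := by
  induction t with
  | zero => simp
  | add x y hx hy => simp [hx, hy]
  | tmul v h => simp

theorem contract_coord {ι : Type*} [DecidableEq ι] (b : Module.Basis ι ℂ H) (k : ι) (t : V ⊗[ℂ] H) :
    contract (b.coord k) t = TensorProduct.equivFinsuppOfBasisRight b t k := by
  induction t with
  | zero => simp
  | add x y hx hy => simp [hx, hy]
  | tmul v h => simp

theorem eq_zero_of_contract {t : V ⊗[ℂ] H} (ht : ∀ φ : H →ₗ[ℂ] ℂ, contract φ t = 0) : t = 0 := by
  classical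
  let b := Module.Basis.ofVectorSpace ℂ H
  apply (TensorProduct.equivFinsuppOfBasisRight (M := V) b).injective
  ext k
  rw [← contract_coord, ht, map_zero, Finsupp.zero_apply]

/-- A tensor all of whose contractions lie in a subspace comes from that subspace. -/
theorem exists_rTensor_subtype (K : Submodule ℂ V) {t : V ⊗[ℂ] H}
    (ht : ∀ φ : H →ₗ[ℂ] ℂ, contract φ t ∈ K) : ∃ s : K ⊗[ℂ] H, K.subtype.rTensor H s = t := by
  classical
  let b := Module.Basis.ofVectorSpace ℂ H
  let e := TensorProduct.equivFinsuppOfBasisRight (M := V) b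
  -- The expansion of t in a basis of H; its coefficients are contractions with the coordinate
  -- functionals.
  refine ⟨∑ k ∈ (e t).support, (⟨contract (b.coord k) t, ht _⟩ : K) ⊗ₜ b k, ?_⟩
  apply e.injective
  ext l
  simp only [e, ← contract_coord, map_sum]
  simp +contextual [Finsupp.single_apply, contract_coord, eq_comm]

end Functionals

/-! ### Averaging, lifting of coinvariants, and kernels of trivializations -/

namespace LocallyTrivialQPFB

open Coalgebra HopfAlgebra WithConv

variable {I H B P : Type*} [Ring H] [HopfAlgebra ℂ H] [Ring B] [Algebra ℂ B]
  [Ring P] [Algebra ℂ P] (X : LocallyTrivialQPFB I H B P)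

theorem χ_rTensor_coact (i : I) (p : P) : (X.χ i).toLinearMap.rTensor H (X.coact p) =
    (TensorProduct.assoc ℂ (X.Loc i) H H).symm
      ((comul (R := ℂ) (A := H)).lTensor (X.Loc i) (X.χ i p)) := by
  rw [X.χ_covariant, LinearEquiv.symm_apply_apply]

/-- The kernel of a trivialization, as a subspace. -/
def kerSub (i : I) : Submodule ℂ P := LinearMap.ker (X.χ i).toLinearMap

theorem mem_kerSub {i : I} {p : P} : p ∈ X.kerSub i ↔ X.χ i p = 0 := Iff.rfl

/-- A subspace that is stable under right multiplication and under the coaction. -/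
structure IsHopfSubmodule (K : Submodule ℂ P) : Prop where
  mul_mem : ∀ k ∈ K, ∀ p, k * p ∈ K
  coact_mem : ∀ k ∈ K, ∀ φ : H →ₗ[ℂ] ℂ, contract φ (X.coact k) ∈ K

theorem isHopfSubmodule_kerSub (i : I) : X.IsHopfSubmodule (X.kerSub i) where
  mul_mem k hk p := by
    rw [mem_kerSub] at hk ⊢
    rw [map_mul, hk, zero_mul]
  coact_mem k hk φ := by
    have e := contract_rTensor φ (X.χ i).toLinearMap (X.coact k)
    rw [χ_rTensor_coact, X.mem_kerSub.1 hk, map_zero, map_zero, map_zero] at e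
    exact e.symm

variable {X} in
theorem IsHopfSubmodule.inf {K L : Submodule ℂ P} (hK : X.IsHopfSubmodule K)
    (hL : X.IsHopfSubmodule L) : X.IsHopfSubmodule (K ⊓ L) where
  mul_mem k hk p := ⟨hK.mul_mem k hk.1 p, hL.mul_mem k hk.2 p⟩
  coact_mem k hk φ := ⟨hK.coact_mem k hk.1 φ, hL.coact_mem k hk.2 φ⟩

/-- Membership in K ⊗ H is expressed by contractions throughout; in this language, the product of K
⊗ H and L ⊗ H lies in KL ⊗ H. -/
theorem contract_mul_mem {A : Type*} [Ring A] [Algebra ℂ A] {K L : Submodule ℂ A} {s t : A ⊗[ℂ] H}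
    (hs : ∀ φ : H →ₗ[ℂ] ℂ, contract φ s ∈ K) (ht : ∀ φ : H →ₗ[ℂ] ℂ, contract φ t ∈ L)
    (φ : H →ₗ[ℂ] ℂ) : contract φ (s * t) ∈ K * L := by
  obtain ⟨s, rfl⟩ := exists_rTensor_subtype K hs
  obtain ⟨t, rfl⟩ := exists_rTensor_subtype L ht
  clear hs ht
  induction s with
  | zero => simp
  | add x y hx hy => simpa [add_mul] using add_mem hx hy
  | tmul k h =>
    induction t with
    | zero => simp
    | add x y hx hy => simpa [mul_add] using add_mem hx hy
    | tmul l g =>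
      simpa using Submodule.smul_mem _ _ (Submodule.mul_mem_mul k.2 l.2)

-- Products are needed besides intersections, because averaging moves the failure of coinvariance
-- into a product with ker χ_i.
variable {X} in
theorem IsHopfSubmodule.mul {K L : Submodule ℂ P} (hK : X.IsHopfSubmodule K)
    (hL : X.IsHopfSubmodule L) : X.IsHopfSubmodule (K * L) where
  mul_mem k hk p := by
    induction hk using Submodule.mul_induction_on' with
    | mem_mul_mem m hm n hn =>
      rw [mul_assoc]
      exact Submodule.mul_mem_mul hm (hL.mul_mem n hn p)
    | add x _ y _ hx hy =>
      rw [add_mul]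
      exact add_mem hx hy
  coact_mem k hk φ := by
    induction hk using Submodule.mul_induction_on' with
    | mem_mul_mem m hm n hn =>
      rw [map_mul]
      exact contract_mul_mem (hK.coact_mem m hm) (hL.coact_mem n hn) φ
    | add x _ y _ hx hy =>
      rw [map_add, map_add]
      exact add_mem hx hy

theorem sum_rTensor_coact {V : Type*} [AddCommGroup V] [Module ℂ V] (f : P →ₗ[ℂ] (H ⊗[ℂ] H) →ₗ[ℂ] V)
    (p : P) : TensorProduct.lift f (TensorProduct.assoc ℂ P H H
      (X.coact.toLinearMap.rTensor H (X.coact p))) =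
    TensorProduct.lift f ((comul (R := ℂ) (A := H)).lTensor P (X.coact p)) := by
  rw [X.isRightCoaction.1]

section Averaging

variable (n : H →ₗ[ℂ] P)

/-- The map `p ↦ ∑ p₀ n(p₁)`. -/
def average : P →ₗ[ℂ] P :=
  LinearMap.mul' ℂ P ∘ₗ n.lTensor P ∘ₗ X.coact.toLinearMap

/-- Covariance of χ_i turns p₀ ⊗ p₁ into a ⊗ h₁ ⊗ h₂, so averaging becomes a ⊗ h ↦ ∑ a ⊗ h₁ m(h₂) in
the trivialization. -/
theorem χ_average (i : I) (m : H →ₗ[ℂ] H) (hn : ∀ h, X.χ i (n h) = 1 ⊗ₜ m h) (p : P) :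
    X.χ i (X.average n p) = (convolve LinearMap.id m).lTensor (X.Loc i) (X.χ i p) := by
  have e₁ : ∀ t : P ⊗[ℂ] H, X.χ i (LinearMap.mul' ℂ P (n.lTensor P t)) =
      LinearMap.mul' ℂ _ ((TensorProduct.mk ℂ (X.Loc i) H 1 ∘ₗ m).lTensor _
        ((X.χ i).toLinearMap.rTensor H t)) := by
    intro t
    induction t with
    | zero => simp
    | add x y hx hy => simp only [map_add, hx, hy]
    | tmul p h => simp [hn]
  have e₂ : ∀ z : X.Loc i ⊗[ℂ] H, LinearMap.mul' ℂ _ ((TensorProduct.mk ℂ (X.Loc i) H 1 ∘ₗ m).lTensor _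
        ((TensorProduct.assoc ℂ (X.Loc i) H H).symm
          ((comul (R := ℂ) (A := H)).lTensor (X.Loc i) z))) =
      (convolve LinearMap.id m).lTensor (X.Loc i) z := by
    intro z
    induction z with
    | zero => simp
    | add x y hx hy => simp only [map_add, hx, hy]
    | tmul a h =>
      rw [LinearMap.lTensor_tmul, LinearMap.lTensor_tmul, convolve_repr (ℛ ℂ h), ← (ℛ ℂ h).eq]
      simp [TensorProduct.tmul_sum]
  rw [← e₂, ← χ_rTensor_coact, ← e₁]
  rfl

theorem average_mem {K : Submodule ℂ P} (hK : X.IsHopfSubmodule K) {p : P} (hp : p ∈ K) :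
    X.average n p ∈ K := by
  obtain ⟨s, hs⟩ := exists_rTensor_subtype K (hK.coact_mem p hp)
  change LinearMap.mul' ℂ P (n.lTensor P (X.coact p)) ∈ K
  rw [← hs]
  clear hs
  induction s with
  | zero => simp
  | add x y hx hy => simpa using add_mem hx hy
  | tmul k h => simpa using hK.mul_mem _ k.2 _

/-- The tensor `∑ n(h₂) ⊗ S(h₁)`. -/
def flipComul : H →ₗ[ℂ] P ⊗[ℂ] H :=
  convolve ((Algebra.TensorProduct.includeRight : H →ₐ[ℂ] P ⊗[ℂ] H).toLinearMap ∘ₗ antipode ℂ)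
    ((Algebra.TensorProduct.includeLeft : P →ₐ[ℂ] P ⊗[ℂ] H).toLinearMap ∘ₗ n)

theorem convolve_flipComul :
    convolve (Algebra.TensorProduct.includeRight : H →ₐ[ℂ] P ⊗[ℂ] H).toLinearMap (flipComul n) =
      (Algebra.TensorProduct.includeLeft : P →ₐ[ℂ] P ⊗[ℂ] H).toLinearMap ∘ₗ n := by
  apply toConv_injective
  rw [toConv_convolve, flipComul, toConv_convolve, ← mul_assoc, algHom_mul_comp_antipode, one_mul]

/-- By coassociativity the factor p₁ from Δ(p₀) meets S(p₂) from the flipped tensor, and they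
cancel. Thus the average would be coinvariant if Δ(n(h)) were equal to ∑ n(h₂) ⊗ S(h₁). -/
theorem coact_mul_flipComul (p : P) :
    LinearMap.mul' ℂ (P ⊗[ℂ] H) (TensorProduct.map X.coact.toLinearMap (flipComul n) (X.coact p)) =
      X.average n p ⊗ₜ 1 := by
  let f : P →ₗ[ℂ] (H ⊗[ℂ] H) →ₗ[ℂ] P ⊗[ℂ] H :=
    (LinearMap.mul ℂ (P ⊗[ℂ] H)).compl₁₂
      (Algebra.TensorProduct.includeLeft : P →ₐ[ℂ] P ⊗[ℂ] H).toLinearMap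
      (LinearMap.mul' ℂ (P ⊗[ℂ] H) ∘ₗ TensorProduct.map
        (Algebra.TensorProduct.includeRight : H →ₐ[ℂ] P ⊗[ℂ] H).toLinearMap (flipComul n))
  have e₁ : ∀ t : P ⊗[ℂ] H, LinearMap.mul' ℂ (P ⊗[ℂ] H)
      (TensorProduct.map X.coact.toLinearMap (flipComul n) t) =
      TensorProduct.lift f (TensorProduct.assoc ℂ P H H (X.coact.toLinearMap.rTensor H t)) := by
    intro t
    induction t with
    | zero => simp
    | add x y hx hy => simp only [map_add, hx, hy]
    | tmul p h =>
      simp only [TensorProduct.map_tmul, LinearMap.mul'_apply, LinearMap.rTensor_tmul,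
        AlgHom.toLinearMap_apply]
      induction X.coact p with
      | zero => simp
      | add x y hx hy => simp only [add_mul, TensorProduct.add_tmul, map_add, hx, hy]
      | tmul q k => simp [f, ← mul_assoc]
  have e₂ : ∀ t : P ⊗[ℂ] H, TensorProduct.lift f ((comul (R := ℂ) (A := H)).lTensor P t) =
      LinearMap.mul' ℂ P (n.lTensor P t) ⊗ₜ 1 := by
    intro t
    induction t with
    | zero => simp
    | add x y hx hy => simp only [map_add, hx, hy, TensorProduct.add_tmul]
    | tmul p h =>
      have e := LinearMap.congr_fun (convolve_flipComul n) h
      simp only [convolve, LinearMap.comp_apply] at e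
      simp only [LinearMap.lTensor_tmul, TensorProduct.lift.tmul, f, LinearMap.compl₁₂_apply,
        LinearMap.comp_apply, e]
      simp
  rw [e₁, sum_rTensor_coact, e₂]
  rfl

/-- Since n lifts S through χ_i and S reverses the coproduct, Δ(n(h)) is the flipped tensor up to
ker χ_i. -/
theorem χ_flipComul (i : I) (hn : ∀ h, X.χ i (n h) = 1 ⊗ₜ antipode ℂ h) (h : H) :
    (X.χ i).toLinearMap.rTensor H (X.coact (n h) - flipComul n h) = 0 := by
  rw [map_sub, χ_rTensor_coact, hn, LinearMap.lTensor_tmul, flipComul, convolve_repr (ℛ ℂ h)]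
  have e := LinearMap.congr_fun (comul_comp_antipode (H := H)) h
  simp only [LinearMap.comp_apply] at e
  rw [e, ← (ℛ ℂ h).eq]
  simp [TensorProduct.tmul_sum, hn]

/-- The new failure of coinvariance is ∑ Δ(p₀) ν(p₁), where ν, the difference between Δ∘n and the
flipped tensor, has values in ker χ_i ⊗ H. As ν(1) = 0, only Δ(p) - p ⊗ 1, which lies in K ⊗ H,
contributes, and so a factor from K and a factor from ker χ_i appear together. -/
theorem coact_average_mem (i : I) (hn : ∀ h, X.χ i (n h) = 1 ⊗ₜ antipode ℂ h) (h1 : n 1 = 1)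
    {K : Submodule ℂ P} (hK : X.IsHopfSubmodule K) {p : P}
    (hp : ∀ φ : H →ₗ[ℂ] ℂ, contract φ (X.coact p - p ⊗ₜ 1) ∈ K) (φ : H →ₗ[ℂ] ℂ) :
    contract φ (X.coact (X.average n p) - X.average n p ⊗ₜ 1) ∈ K * X.kerSub i := by
  let ν : H →ₗ[ℂ] P ⊗[ℂ] H := X.coact.toLinearMap ∘ₗ n - flipComul n
  have hν : ∀ h φ, contract φ (ν h) ∈ X.kerSub i := by
    intro h φ
    have e := contract_rTensor φ (X.χ i).toLinearMap (ν h)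
    rw [show ν h = X.coact (n h) - flipComul n h from rfl, χ_flipComul X n i hn, map_zero] at e
    exact e.symm
  have hν1 : ν 1 = 0 := by
    simp [ν, h1, flipComul, convolve, Algebra.TensorProduct.one_def]
  have e : X.coact (X.average n p) - X.average n p ⊗ₜ 1 =
      LinearMap.mul' ℂ (P ⊗[ℂ] H) (TensorProduct.map X.coact.toLinearMap ν
        (X.coact p - p ⊗ₜ 1)) := by
    rw [map_sub, map_sub, TensorProduct.map_tmul, hν1, TensorProduct.tmul_zero, map_zero, sub_zero,
      ← coact_mul_flipComul]
    change X.coact (LinearMap.mul' ℂ P (n.lTensor P (X.coact p))) - _ = _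
    induction X.coact p with
    | zero => simp
    | add x y hx hy => simp only [map_add, ← hx, ← hy, add_sub_add_comm]
    | tmul q k => simp [ν, mul_sub]
  rw [e]
  obtain ⟨s, hs⟩ := exists_rTensor_subtype K hp
  rw [← hs]
  clear hs e hp
  induction s with
  | zero => simp
  | add x y hx hy => simpa using add_mem hx hy
  | tmul k h => exact contract_mul_mem (hK.coact_mem k k.2) (hν h) φ

theorem average_sub_mem (h1 : n 1 = 1) {K : Submodule ℂ P} (hK : X.IsHopfSubmodule K) {p : P}
    (hp : ∀ φ : H →ₗ[ℂ] ℂ, contract φ (X.coact p - p ⊗ₜ 1) ∈ K) : X.average n p - p ∈ K := by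
  have e : X.average n p - p = LinearMap.mul' ℂ P (n.lTensor P (X.coact p - p ⊗ₜ 1)) := by
    simp [h1, average]
  rw [e]
  obtain ⟨s, hs⟩ := exists_rTensor_subtype K hp
  rw [← hs]
  clear hs e hp
  induction s with
  | zero => simp
  | add x y hx hy => simpa using add_mem hx hy
  | tmul k h => simpa using hK.mul_mem _ k.2 _

end Averaging

theorem exists_section_antipode (i : I) :
    ∃ n : H →ₗ[ℂ] P, (∀ h, X.χ i (n h) = 1 ⊗ₜ antipode ℂ h) ∧ n 1 = 1 := by
  obtain ⟨l, hl⟩ := (X.χ i).toLinearMap.exists_rightInverse_of_surjective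
    (LinearMap.range_eq_top.2 (X.χ_surjective i))
  have hl' : ∀ z, X.χ i (l z) = z := LinearMap.congr_fun hl
  -- A linear section of χ_i need not send 1 to 1. The correction ε(h)(1 - l(1)) repairs this and is
  -- killed by χ_i.
  refine ⟨l ∘ₗ TensorProduct.mk ℂ (X.Loc i) H 1 ∘ₗ antipode ℂ +
    (LinearMap.toSpanSingleton ℂ P (1 - l 1)) ∘ₗ counit, fun h => ?_, ?_⟩
  · simp [hl']
  · simp [← Algebra.TensorProduct.one_def]

/-- Coinvariants can be lifted along the projection of `P` by a Hopf submodule. -/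
theorem exists_coinvariant [Finite I] {K : Submodule ℂ P} (hK : X.IsHopfSubmodule K) {p : P}
    (hp : ∀ φ : H →ₗ[ℂ] ℂ, contract φ (X.coact p - p ⊗ₜ 1) ∈ K) :
    ∃ b, p - X.ι b ∈ K := by
  -- Induction over the patches: K is replaced by K · ker χ_i and p by its average, which differs
  -- from p by an element of K. The final subspace K' lies in all the kernels treated so far.
  have key : ∀ (L : List I) {K : Submodule ℂ P} (_ : X.IsHopfSubmodule K) {p : P}
      (_ : ∀ φ : H →ₗ[ℂ] ℂ, contract φ (X.coact p - p ⊗ₜ 1) ∈ K),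
      ∃ q, p - q ∈ K ∧ ∃ K' ≤ K, (∀ i ∈ L, K' ≤ X.kerSub i) ∧
        ∀ φ : H →ₗ[ℂ] ℂ, contract φ (X.coact q - q ⊗ₜ 1) ∈ K' := by
    intro L
    induction L with
    | nil => exact fun {K} hK {p} hp => ⟨p, by simp, K, le_rfl, by simp, hp⟩
    | cons i L ih =>
      intro K hK p hp
      obtain ⟨n, hn, h1⟩ := X.exists_section_antipode i
      have hle : K * X.kerSub i ≤ K := Submodule.mul_le.2 fun k hk m _ => hK.mul_mem k hk m
      obtain ⟨q, hq, K', hK', hL, hc⟩ :=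
        ih (hK.mul (X.isHopfSubmodule_kerSub i)) (X.coact_average_mem n i hn h1 hK hp)
      refine ⟨q, ?_, K', hK'.trans hle, ?_, hc⟩
      · have := sub_mem (hle hq) (X.average_sub_mem n h1 hK hp)
        rwa [sub_sub_sub_cancel_left] at this
      · rintro j hj
        rcases List.mem_cons.1 hj with rfl | hj
        · refine hK'.trans (Submodule.mul_le.2 fun k _ m hm => ?_)
          rw [mem_kerSub] at hm ⊢
          rw [map_mul, hm, mul_zero]
        · exact hL j hj
  have := Fintype.ofFinite I
  obtain ⟨q, hq, K', -, hL, hc⟩ := key Finset.univ.toList hK hp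
  -- All patches have been treated, so what remains lies in the intersection of the kernels of a
  -- covering.
  have hbot : K' = ⊥ := by
    rw [eq_bot_iff]
    intro k hk
    have h0 : k ∈ (⨅ i, RingHom.ker (X.χ i) : Ideal P) :=
      (Submodule.mem_iInf _).2 fun i => hL i (by simp) hk
    rw [X.complete_total.1] at h0
    exact h0
  obtain ⟨b, rfl⟩ := (X.range_ι q).2 (sub_eq_zero.1 (eq_zero_of_contract fun φ => by
    simpa [hbot] using hc φ))
  exact ⟨b, hq⟩

/-- Both local images of p are coinvariant, so p differs from some ι(c) by an element of ker χ_i ∩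
ker χ_j. Then b - c ∈ J_i and c ∈ J_j. -/
theorem mem_sup_of_χ_eq [Finite I] {i j : I} {p : P} {b : B} (hj : X.χ j p = 0)
    (hi : X.χ i p = Ideal.Quotient.mk (X.J i) b ⊗ₜ 1) : b ∈ X.J i ⊔ X.J j := by
  have hcoinv : ∀ l (a : X.Loc l), X.χ l p = a ⊗ₜ 1 →
      ∀ φ : H →ₗ[ℂ] ℂ, contract φ (X.coact p - p ⊗ₜ 1) ∈ X.kerSub l := by
    intro l a ha φ
    have e := contract_rTensor φ (X.χ l).toLinearMap (X.coact p - p ⊗ₜ 1)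
    rw [map_sub, χ_rTensor_coact, ha] at e
    simp only [LinearMap.lTensor_tmul, Bialgebra.comul_one, Algebra.TensorProduct.one_def,
      TensorProduct.assoc_symm_tmul, LinearMap.rTensor_tmul, AlgHom.toLinearMap_apply, ha,
      sub_self, map_zero] at e
    exact e.symm
  obtain ⟨c, hc⟩ := X.exists_coinvariant
    ((X.isHopfSubmodule_kerSub i).inf (X.isHopfSubmodule_kerSub j))
    (fun φ => ⟨hcoinv i _ hi φ, hcoinv j 0 (by simp [hj]) φ⟩)
  have h1 : ∀ l (x : X.Loc l), x ⊗ₜ[ℂ] (1 : H) = 0 → x = 0 := by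
    intro l x hx
    simpa using congr(contract (counit (R := ℂ) (A := H)) $hx)
  have hci := X.mem_kerSub.1 hc.1
  have hcj := X.mem_kerSub.1 hc.2
  rw [map_sub, X.χ_ι, hi, ← TensorProduct.sub_tmul] at hci
  rw [map_sub, X.χ_ι, hj, zero_sub, neg_eq_zero] at hcj
  have h2 := Ideal.Quotient.eq.1 (sub_eq_zero.1 (h1 _ _ hci))
  have h3 := Ideal.Quotient.eq_zero_iff_mem.1 (h1 _ _ hcj)
  simpa using Submodule.add_mem_sup h2 h3

/-- It suffices to test each contraction with a functional φ. A suitable average of p stays in ker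
χ_j and has the contraction of χ_i(p), tensored with 1, as its image under χ_i; `mem_sup_of_χ_eq`
then applies. -/
theorem resLeft_χ_eq_zero [Finite I] {i j : I} {p : P} (hj : X.χ j p = 0) :
    (X.resLeft i j).toLinearMap.rTensor H (X.χ i p) = 0 := by
  refine eq_zero_of_contract fun φ => ?_
  rw [contract_rTensor]
  -- Chosen so that id * m = id * S * φ = φ(·)1 in the convolution algebra.
  let m : H →ₗ[ℂ] H := convolve (antipode ℂ) (Algebra.linearMap ℂ H ∘ₗ φ)
  obtain ⟨l, hl⟩ := (X.χ i).toLinearMap.exists_rightInverse_of_surjective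
    (LinearMap.range_eq_top.2 (X.χ_surjective i))
  have hl' : ∀ z, X.χ i (l z) = z := LinearMap.congr_fun hl
  let n : H →ₗ[ℂ] P := l ∘ₗ TensorProduct.mk ℂ (X.Loc i) H 1 ∘ₗ m
  have hm : convolve LinearMap.id m = Algebra.linearMap ℂ H ∘ₗ φ := by
    apply toConv_injective
    rw [toConv_convolve, toConv_convolve, ← mul_assoc, LinearMap.id_mul_antipode, one_mul]
  have e₁ := X.χ_average n i m (fun h => by simp [n, hl']) p
  have e₂ : ∀ z : X.Loc i ⊗[ℂ] H, (Algebra.linearMap ℂ H ∘ₗ φ).lTensor (X.Loc i) z =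
      contract φ z ⊗ₜ 1 := by
    intro z
    induction z with
    | zero => simp
    | add x y hx hy => simp only [map_add, hx, hy, TensorProduct.add_tmul]
    | tmul a h => simp [Algebra.algebraMap_eq_smul_one, TensorProduct.smul_tmul]
  rw [hm, e₂] at e₁
  obtain ⟨b, hb⟩ := Ideal.Quotient.mk_surjective (contract φ (X.χ i p))
  rw [← hb] at e₁ ⊢
  have h0 := X.mem_sup_of_χ_eq
    (X.mem_kerSub.1 (X.average_mem n (X.isHopfSubmodule_kerSub j) (X.mem_kerSub.2 hj))) e₁
  exact Ideal.Quotient.eq_zero_iff_mem.2 h0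

end LocallyTrivialQPFB

/-! ### Transition functions: existence, uniqueness, convolution inverses -/

namespace LocallyTrivialQPFB

open Coalgebra HopfAlgebra WithConv

variable {I H B P : Type*} [Ring H] [HopfAlgebra ℂ H] [Ring B] [Algebra ℂ B]
  [Ring P] [Algebra ℂ P] (X : LocallyTrivialQPFB I H B P)

@[simp]
theorem overlapSwap_overlapSwap (i j : I) (x : X.Overlap i j) :
    X.overlapSwap i j (X.overlapSwap j i x) = x := by
  obtain ⟨b, rfl⟩ := Ideal.Quotient.mk_surjective x
  rfl

@[simp]
theorem overlapSwap_resLeft (i j : I) (a : X.Loc j) :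
    X.overlapSwap i j (X.resLeft j i a) = X.resRight i j a := by
  obtain ⟨b, rfl⟩ := Ideal.Quotient.mk_surjective a
  rfl

@[simp]
theorem overlapSwap_resRight (i j : I) (a : X.Loc i) :
    X.overlapSwap i j (X.resRight j i a) = X.resLeft i j a := by
  obtain ⟨b, rfl⟩ := Ideal.Quotient.mk_surjective a
  rfl

theorem twist_tmul {A : Type*} [Ring A] [Algebra ℂ A] (t : H →ₐ[ℂ] A) (a : A) (h : H) {ι : Type*}
    (r : Repr ℂ h ι) :
    twist t (a ⊗ₜ h) = ∑ k ∈ r.index, (a * t (r.left k)) ⊗ₜ[ℂ] r.right k := by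
  simp [twist, ← r.eq, TensorProduct.tmul_sum]

theorem contract_counit_twist {A : Type*} [Ring A] [Algebra ℂ A] (t : H →ₐ[ℂ] A) (a : A) (h : H) :
    contract counit (twist t (a ⊗ₜ h)) = a * t h := by
  rw [twist_tmul t a h (ℛ ℂ h), map_sum]
  simp only [contract_tmul, ← mul_smul_comm, ← map_smul, ← Finset.mul_sum, ← map_sum]
  rw [sum_counit_right_smul]

/-- The change of trivialization on the overlap. -/
theorem exists_overlapMap [Finite I] (i j : I) :
    ∃ Ψ : X.Loc j ⊗[ℂ] H →ₐ[ℂ] X.Overlap i j ⊗[ℂ] H,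
      ∀ p, Ψ (X.χ j p) = (X.resLeft i j).toLinearMap.rTensor H (X.χ i p) := by
  let F : P →ₐ[ℂ] X.Overlap i j ⊗[ℂ] H :=
    (Algebra.TensorProduct.map (X.resLeft i j) (AlgHom.id ℂ H)).comp (X.χ i)
  let e := Ideal.quotientKerAlgEquivOfSurjective (X.χ_surjective j)
  have h0 : ∀ p ∈ RingHom.ker (X.χ j), F p = 0 := fun p hp => X.resLeft_χ_eq_zero hp
  refine ⟨(Ideal.Quotient.liftₐ (RingHom.ker (X.χ j)) F h0).comp e.symm.toAlgHom, fun p => ?_⟩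
  have h : e.symm (X.χ j p) = Ideal.Quotient.mk _ p := e.symm_apply_eq.2 rfl
  change Ideal.Quotient.liftₐ (RingHom.ker (X.χ j)) F h0 (e.symm (X.χ j p)) = _
  rw [h]
  rfl

/-- The change of trivialization Ψ is multiplicative, is the restriction map on B_j, and is
H-colinear. A colinear map is recovered from its composite with id ⊗ ε, so Ψ(1 ⊗ h) is the twist by
σ(h) = (id ⊗ ε)Ψ(1 ⊗ h), a homomorphism since Ψ and ε are. -/
theorem exists_isTransition [Finite I] :
    ∃ τ : ∀ i j, H →ₐ[ℂ] X.Overlap i j, X.IsTransition τ := by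
  choose Ψ hΨ using X.exists_overlapMap
  let ev : ∀ i j, X.Overlap i j ⊗[ℂ] H →ₐ[ℂ] X.Overlap i j := fun i j =>
    (Algebra.TensorProduct.rid ℂ ℂ (X.Overlap i j)).toAlgHom.comp
      (Algebra.TensorProduct.map (AlgHom.id ℂ _) (Bialgebra.counitAlgHom ℂ H))
  let σ : ∀ i j, H →ₐ[ℂ] X.Overlap i j := fun i j =>
    ((ev i j).comp (Ψ i j)).comp Algebra.TensorProduct.includeRight
  have hev : ∀ i j t, ev i j t = contract counit t := by
    intro i j t
    induction t with
    | zero => simp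
    | add x y hx hy => simp only [map_add, hx, hy]
    | tmul a h => simp [ev]
  have hleft : ∀ i j a, Ψ i j (a ⊗ₜ 1) = X.resRight i j a ⊗ₜ 1 := by
    intro i j a
    obtain ⟨b, rfl⟩ := Ideal.Quotient.mk_surjective a
    rw [← X.χ_ι, hΨ, X.χ_ι]
    rfl
  -- Colinearity of Ψ follows from that of χ_i and χ_j, since χ_j is onto.
  have hcov : ∀ i j z, (comul (R := ℂ) (A := H)).lTensor (X.Overlap i j) (Ψ i j z) =
      TensorProduct.assoc ℂ _ H H ((Ψ i j).toLinearMap.rTensor H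
        ((TensorProduct.assoc ℂ _ H H).symm
          ((comul (R := ℂ) (A := H)).lTensor (X.Loc j) z))) := by
    intro i j z
    obtain ⟨p, rfl⟩ := X.χ_surjective j z
    have e₁ : (Ψ i j).toLinearMap ∘ₗ (X.χ j).toLinearMap =
        (X.resLeft i j).toLinearMap.rTensor H ∘ₗ (X.χ i).toLinearMap := LinearMap.ext (hΨ i j)
    rw [← χ_rTensor_coact, ← LinearMap.comp_apply, ← LinearMap.rTensor_comp, e₁,
      LinearMap.rTensor_comp, LinearMap.comp_apply, χ_rTensor_coact, hΨ]
    induction X.χ i p with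
    | zero => simp
    | add x y hx hy => simp only [map_add, hx, hy]
    | tmul a h =>
      simp only [LinearMap.rTensor_tmul, LinearMap.lTensor_tmul]
      induction (comul h : H ⊗[ℂ] H) with
      | zero => simp
      | add x y hx hy => simp only [TensorProduct.tmul_add, map_add, hx, hy]
      | tmul k l => simp
  have hright : ∀ i j h, Ψ i j (1 ⊗ₜ h) = twist (σ i j) (1 ⊗ₜ h) := by
    intro i j h
    have e₂ : ∀ t : X.Overlap i j ⊗[ℂ] H, (contract (V := X.Overlap i j) counit).rTensor H
        ((TensorProduct.assoc ℂ _ H H).symm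
          ((comul (R := ℂ) (A := H)).lTensor (X.Overlap i j) t)) = t := by
      intro t
      induction t with
      | zero => simp
      | add x y hx hy => simp only [map_add, hx, hy]
      | tmul a h =>
        have e₃ : ∀ s : H ⊗[ℂ] H, (contract (V := X.Overlap i j) counit).rTensor H
            ((TensorProduct.assoc ℂ _ H H).symm (a ⊗ₜ s)) =
            a ⊗ₜ TensorProduct.lid ℂ H ((counit (R := ℂ) (A := H)).rTensor H s) := by
          intro s
          induction s with
          | zero => simp
          | add x y hx hy => simp only [TensorProduct.tmul_add, map_add, hx, hy]
          | tmul k l => simp [TensorProduct.smul_tmul]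
        rw [LinearMap.lTensor_tmul, e₃]
        simp
    rw [← e₂ (Ψ i j (1 ⊗ₜ h)), hcov, LinearEquiv.symm_apply_apply, LinearMap.lTensor_tmul,
      twist_tmul _ _ _ (ℛ ℂ h)]
    conv_lhs => rw [← (ℛ ℂ h).eq]
    simp [TensorProduct.tmul_sum, σ, hev]
  -- The indices are exchanged because φ_ij is built from τ_ji.
  refine ⟨fun i j => (X.overlapSwap i j).comp (σ j i), fun i j p => ?_⟩
  have e₄ : (X.overlapSwap i j).comp ((X.overlapSwap j i).comp (σ i j)) = σ i j :=
    AlgHom.ext fun h => X.overlapSwap_overlapSwap i j _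
  rw [e₄, ← hΨ]
  induction X.χ j p with
  | zero => simp
  | add x y hx hy => simp only [map_add, hx, hy]
  | tmul a h =>
    have e₅ : a ⊗ₜ[ℂ] h = (a ⊗ₜ 1) * (1 ⊗ₜ h) := by simp
    rw [e₅, map_mul, hleft, hright, ← e₅, twist_tmul _ _ _ (ℛ ℂ h), LinearMap.rTensor_tmul,
      twist_tmul _ _ _ (ℛ ℂ h), Finset.mul_sum]
    simp

variable {X} {τ τ' : ∀ i j, H →ₐ[ℂ] X.Overlap i j}

/-- Applying id ⊗ ε to the transition relation isolates τ_ji(h); the right side no longer involves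
τ, which gives uniqueness. -/
theorem IsTransition.eq_of_χ_eq (hτ : X.IsTransition τ) {i j : I} {p : P} {h : H}
    (hp : X.χ j p = 1 ⊗ₜ h) : X.overlapSwap i j (τ j i h) =
      contract counit ((X.resLeft i j).toLinearMap.rTensor H (X.χ i p)) := by
  rw [hτ, hp, LinearMap.rTensor_tmul, contract_counit_twist]
  simp

theorem IsTransition.unique (hτ : X.IsTransition τ) (hτ' : X.IsTransition τ') : τ = τ' := by
  funext j i
  ext h
  obtain ⟨p, hp⟩ := X.χ_surjective j (1 ⊗ₜ h)
  rw [← X.overlapSwap_overlapSwap j i (τ j i h), hτ.eq_of_χ_eq hp, ← hτ'.eq_of_χ_eq hp,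
    overlapSwap_overlapSwap]

theorem existsUnique_isTransition [Finite I] (X : LocallyTrivialQPFB I H B P) :
    ∃! τ : ∀ i j, H →ₐ[ℂ] X.Overlap i j, X.IsTransition τ :=
  let ⟨τ, hτ⟩ := X.exists_isTransition
  ⟨τ, hτ, fun _ h => IsTransition.unique h hτ⟩

theorem rTensor_overlapSwap_twist (t : H →ₐ[ℂ] X.Overlap j i) (z : X.Overlap j i ⊗[ℂ] H) :
    (X.overlapSwap i j).toLinearMap.rTensor H (twist t z) =
      twist ((X.overlapSwap i j).comp t) ((X.overlapSwap i j).toLinearMap.rTensor H z) := by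
  induction z with
  | zero => simp
  | add x y hx hy => simp only [map_add, hx, hy]
  | tmul a h => simp [twist_tmul _ _ _ (ℛ ℂ h)]

/-- The change of trivialization in the opposite direction. -/
theorem IsTransition.resRight_χ (hτ : X.IsTransition τ) (i j : I) (p : P) :
    (X.resRight i j).toLinearMap.rTensor H (X.χ j p) =
      twist (τ i j) ((X.resLeft i j).toLinearMap.rTensor H (X.χ i p)) := by
  have e := congr((X.overlapSwap i j).toLinearMap.rTensor H $(hτ j i p))
  rw [rTensor_overlapSwap_twist] at e
  have e₁ : (X.overlapSwap i j).toLinearMap ∘ₗ (X.resLeft j i).toLinearMap =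
      (X.resRight i j).toLinearMap :=
    LinearMap.ext fun a => X.overlapSwap_resLeft i j a
  have e₂ : (X.overlapSwap i j).toLinearMap ∘ₗ (X.resRight j i).toLinearMap =
      (X.resLeft i j).toLinearMap :=
    LinearMap.ext fun a => X.overlapSwap_resRight i j a
  have e₃ : (X.overlapSwap i j).comp ((X.overlapSwap j i).comp (τ i j)) = τ i j :=
    AlgHom.ext fun h => X.overlapSwap_overlapSwap i j _
  rwa [← LinearMap.rTensor_comp_apply, e₁, ← LinearMap.rTensor_comp_apply, e₂, e₃] at e

theorem contract_counit_twist_twist {A : Type*} [Ring A] [Algebra ℂ A] (s t : H →ₐ[ℂ] A) (h : H) :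
    contract counit (twist t (twist s (1 ⊗ₜ h))) = convolve s.toLinearMap t.toLinearMap h := by
  rw [twist_tmul _ _ _ (ℛ ℂ h), convolve_repr (ℛ ℂ h), map_sum, map_sum]
  simp [contract_counit_twist]

/-- Passing from the trivialization over i to that over j and back is the identity; id ⊗ ε at 1 ⊗ h
reads this off as a convolution identity. -/
theorem IsTransition.mul_eq_one (hτ : X.IsTransition τ) (i j : I) :
    toConv (τ i j).toLinearMap * toConv ((X.overlapSwap i j).comp (τ j i)).toLinearMap = 1 := by
  ext h
  obtain ⟨p, hp⟩ := X.χ_surjective i (1 ⊗ₜ h)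
  have e := hτ i j p
  rw [hτ.resRight_χ, hp, LinearMap.rTensor_tmul, AlgHom.toLinearMap_apply, map_one] at e
  have e' := congr(contract counit $e)
  rw [contract_counit_twist_twist, contract_tmul] at e'
  rw [LinearMap.convOne_apply, Algebra.algebraMap_eq_smul_one, e']
  rfl

theorem IsTransition.mul_eq_one' (hτ : X.IsTransition τ) (i j : I) :
    toConv ((X.overlapSwap i j).comp (τ j i)).toLinearMap * toConv (τ i j).toLinearMap = 1 := by
  ext h
  obtain ⟨p, hp⟩ := X.χ_surjective j (1 ⊗ₜ h)
  have e := hτ.resRight_χ i j p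
  rw [hτ, hp, LinearMap.rTensor_tmul, AlgHom.toLinearMap_apply, map_one] at e
  have e' := congr(contract counit $e)
  rw [contract_counit_twist_twist, contract_tmul] at e'
  rw [LinearMap.convOne_apply, Algebra.algebraMap_eq_smul_one, e']
  rfl

end LocallyTrivialQPFB

open DifferentialCalculus

/-! ### One-sided multiplication, for a common treatment of left and right connections -/

section Side

variable {A A' : Type*} [Ring A] [Algebra ℂ A] [Ring A'] [Algebra ℂ A']

/-- Multiplication from the left (`b = true`) or from the right (`b = false`). -/
def sideMul (b : Bool) : A →ₗ[ℂ] A →ₗ[ℂ] A :=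
  if b then LinearMap.mul ℂ A else (LinearMap.mul ℂ A).flip

@[simp]
theorem sideMul_true (x y : A) : sideMul true x y = x * y := rfl

@[simp]
theorem sideMul_false (x y : A) : sideMul false x y = y * x := rfl

theorem map_sideMul (b : Bool) (f : A →ₐ[ℂ] A') (x y : A) :
    f (sideMul b x y) = sideMul b (f x) (f y) := by
  cases b <;> simp

theorem sideMul_sideMul (b : Bool) (x y z : A) :
    sideMul b (sideMul b x y) z = sideMul b x (sideMul b y z) := by
  cases b <;> simp [mul_assoc]

theorem sideMul_one (b : Bool) (x : A) : sideMul b x 1 = x := by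
  cases b <;> simp

theorem one_sideMul (b : Bool) (x : A) : sideMul b 1 x = x := by
  cases b <;> simp

end Side

/-! ### Forms of degree zero and one, in a calculus and in a skew tensor product -/

namespace DifferentialCalculus

section One

variable {B : Type*} [Ring B] [Algebra ℂ B] (Γ : DifferentialCalculus B)

/-- The projection onto the forms of degree `n`. -/
def proj (n : ℕ) : Γ.carrier →ₗ[ℂ] Γ.carrier :=
  (Γ.deg n).subtype ∘ₗ DirectSum.component ℂ ℕ (fun n => Γ.deg n) n ∘ₗ
    (DirectSum.decomposeLinearEquiv Γ.deg).toLinearMap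

theorem proj_mem (n : ℕ) (x : Γ.carrier) : Γ.proj n x ∈ Γ.deg n := SetLike.coe_mem _

theorem proj_of_mem {n : ℕ} {x : Γ.carrier} (hx : x ∈ Γ.deg n) : Γ.proj n x = x :=
  DirectSum.decompose_of_mem_same _ hx

theorem proj_of_mem_ne {m n : ℕ} {x : Γ.carrier} (hx : x ∈ Γ.deg m) (h : m ≠ n) :
    Γ.proj n x = 0 :=
  DirectSum.decompose_of_mem_ne _ hx h

theorem proj_eq_ite {m n : ℕ} {x : Γ.carrier} (hx : x ∈ Γ.deg m) :
    Γ.proj n x = if m = n then x else 0 := by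
  split_ifs with h
  · subst h; exact Γ.proj_of_mem hx
  · exact Γ.proj_of_mem_ne hx h

theorem homogeneous_induction {p : Γ.carrier → Prop} (x : Γ.carrier) (h0 : p 0)
    (h : ∀ n, ∀ x ∈ Γ.deg n, p x) (hadd : ∀ x y, p x → p y → p (x + y)) : p x := by
  induction x using DirectSum.Decomposition.inductionOn Γ.deg with
  | zero => exact h0
  | homogeneous m => exact h _ _ m.2
  | add x y hx hy => exact hadd x y hx hy

theorem exists_incl_of_mem {x : Γ.carrier} (hx : x ∈ Γ.deg 0) : ∃ b, Γ.incl b = x := by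
  rw [← Γ.range_incl] at hx
  exact hx

theorem proj_zero_mul (x y : Γ.carrier) : Γ.proj 0 (x * y) = Γ.proj 0 x * Γ.proj 0 y := by
  induction x using Γ.homogeneous_induction with
  | h0 => simp
  | hadd x x' hx hx' => simp [add_mul, hx, hx']
  | h m x hx =>
    induction y using Γ.homogeneous_induction with
    | h0 => simp
    | hadd y y' hy hy' => simp [mul_add, hy, hy']
    | h n y hy =>
      have hxy := SetLike.mul_mem_graded hx hy
      rw [Γ.proj_eq_ite hxy, Γ.proj_eq_ite hx, Γ.proj_eq_ite hy]
      rcases m with _ | m <;> rcases n with _ | n <;> simp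

theorem proj_one_mul (x y : Γ.carrier) :
    Γ.proj 1 (x * y) = Γ.proj 0 x * Γ.proj 1 y + Γ.proj 1 x * Γ.proj 0 y := by
  induction x using Γ.homogeneous_induction with
  | h0 => simp
  | hadd x x' hx hx' => simp only [add_mul, map_add, hx, hx']; abel
  | h m x hx =>
    induction y using Γ.homogeneous_induction with
    | h0 => simp
    | hadd y y' hy hy' => simp only [mul_add, map_add, hy, hy']; abel
    | h n y hy =>
      have hxy := SetLike.mul_mem_graded hx hy
      rw [Γ.proj_eq_ite hxy, Γ.proj_eq_ite hx, Γ.proj_eq_ite hy, Γ.proj_eq_ite hx,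
        Γ.proj_eq_ite hy]
      rcases m with _ | _ | m <;> rcases n with _ | _ | n <;> simp <;> omega

theorem dB_mem (b : B) : Γ.dB b ∈ Γ.deg 1 := Γ.d_mem 0 _ (Γ.incl_mem b)

theorem dB_mul (a b : B) : Γ.dB (a * b) = Γ.dB a * Γ.incl b + Γ.incl a * Γ.dB b := by
  have h := Γ.leibniz 0 _ (Γ.incl_mem a) (Γ.incl b)
  simpa [dB] using h

@[simp]
theorem dB_one : Γ.dB 1 = 0 := by simp [dB, d_one]

theorem induction_generated {p : Γ.carrier → Prop} (x : Γ.carrier) (hincl : ∀ b, p (Γ.incl b))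
    (hd : ∀ b, p (Γ.dB b)) (hadd : ∀ x y, p x → p y → p (x + y))
    (hmul : ∀ x y, p x → p y → p (x * y)) : p x := by
  have hx : x ∈ Algebra.adjoin ℂ (Set.range Γ.incl ∪ Set.range fun b => Γ.d (Γ.incl b)) := by
    rw [Γ.generated]
    exact Algebra.mem_top
  induction hx using Algebra.adjoin_induction with
  | mem x hx =>
    rcases hx with ⟨b, rfl⟩ | ⟨b, rfl⟩
    · exact hincl b
    · exact hd b
  | algebraMap r => simpa using hincl (algebraMap ℂ B r)
  | add x y _ _ hx hy => exact hadd x y hx hy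
  | mul x y _ _ hx hy => exact hmul x y hx hy

/-- By the Leibniz rule p dq b = p d(qb) - pq db. -/
theorem mul_incl_mem_span {x : Γ.carrier}
    (hx : x ∈ Submodule.span ℂ {x | ∃ p q, x = Γ.incl p * Γ.dB q}) (b : B) :
    x * Γ.incl b ∈ Submodule.span ℂ {x | ∃ p q, x = Γ.incl p * Γ.dB q} := by
  induction hx using Submodule.span_induction with
  | mem x hx =>
    obtain ⟨p, q, rfl⟩ := hx
    have e : Γ.incl p * Γ.dB q * Γ.incl b =
        Γ.incl p * Γ.dB (q * b) - Γ.incl (p * q) * Γ.dB b := by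
      rw [dB_mul, map_mul, mul_add, ← mul_assoc, ← mul_assoc, add_sub_cancel_right]
    rw [e]
    exact sub_mem (Submodule.subset_span ⟨_, _, rfl⟩) (Submodule.subset_span ⟨_, _, rfl⟩)
  | zero => simp
  | add x y _ _ hx hy => rw [add_mul]; exact add_mem hx hy
  | smul c x _ hx => rw [smul_mul_assoc]; exact Submodule.smul_mem _ _ hx

theorem incl_mul_mem_span {x : Γ.carrier}
    (hx : x ∈ Submodule.span ℂ {x | ∃ p q, x = Γ.incl p * Γ.dB q}) (b : B) :
    Γ.incl b * x ∈ Submodule.span ℂ {x | ∃ p q, x = Γ.incl p * Γ.dB q} := by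
  induction hx using Submodule.span_induction with
  | mem x hx =>
    obtain ⟨p, q, rfl⟩ := hx
    rw [← mul_assoc, ← map_mul]
    exact Submodule.subset_span ⟨_, _, rfl⟩
  | zero => simp
  | add x y _ _ hx hy => rw [mul_add]; exact add_mem hx hy
  | smul c x _ hx => rw [mul_smul_comm]; exact Submodule.smul_mem _ _ hx

/-- Induction over the algebra generated by a and da, applied to the degree one component: that of a
product xy is x₀y₁ + x₁y₀, and the span is a bimodule over the forms of degree zero. -/
theorem deg_one_le_span_left : Γ.deg 1 ≤ Submodule.span ℂ {x | ∃ p q, x = Γ.incl p * Γ.dB q} := by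
  have key : ∀ x, Γ.proj 1 x ∈ Submodule.span ℂ {x | ∃ p q, x = Γ.incl p * Γ.dB q} := by
    intro x
    induction x using Γ.induction_generated with
    | hincl b => simp [Γ.proj_of_mem_ne (Γ.incl_mem b) zero_ne_one]
    | hd b =>
      rw [Γ.proj_of_mem (Γ.dB_mem b)]
      exact Submodule.subset_span ⟨1, b, by simp⟩
    | hadd x y hx hy => rw [map_add]; exact add_mem hx hy
    | hmul x y hx hy =>
      obtain ⟨a, ha⟩ := Γ.exists_incl_of_mem (Γ.proj_mem 0 x)
      obtain ⟨b, hb⟩ := Γ.exists_incl_of_mem (Γ.proj_mem 0 y)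
      rw [proj_one_mul, ← ha, ← hb]
      exact add_mem (Γ.incl_mul_mem_span hy a) (Γ.mul_incl_mem_span hx b)
  intro x hx
  rw [← Γ.proj_of_mem hx]
  exact key x

/-- The one-forms are spanned by the forms `p d q`, and also by the forms `d q p`. -/
theorem deg_one_le_span (b : Bool) :
    Γ.deg 1 ≤ Submodule.span ℂ {x | ∃ p q, x = sideMul b (Γ.incl p) (Γ.dB q)} := by
  cases b with
  | true => exact Γ.deg_one_le_span_left
  | false =>
    refine Γ.deg_one_le_span_left.trans (Submodule.span_le.2 ?_)
    rintro _ ⟨p, q, rfl⟩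
    -- The Leibniz rule in the form p dq = d(pq) - dp q.
    have e : Γ.incl p * Γ.dB q =
        sideMul false (Γ.incl 1) (Γ.dB (p * q)) - sideMul false (Γ.incl q) (Γ.dB p) := by
      simp [dB_mul]
    rw [SetLike.mem_coe, e]
    exact sub_mem (Submodule.subset_span ⟨_, _, rfl⟩) (Submodule.subset_span ⟨_, _, rfl⟩)

theorem zeroPart_incl (b : B) : Γ.zeroPart (Γ.incl b) = b := by
  have h : DirectSum.component ℂ ℕ (fun n => Γ.deg n) 0 (DirectSum.decompose Γ.deg (Γ.incl b)) =
      Γ.zeroEquiv b :=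
    Subtype.ext (Γ.proj_of_mem (Γ.incl_mem b))
  change Γ.zeroEquiv.symm (DirectSum.component ℂ ℕ (fun n => Γ.deg n) 0
    (DirectSum.decompose Γ.deg (Γ.incl b))) = b
  rw [h, LinearEquiv.symm_apply_apply]

theorem zeroPart_of_mem {n : ℕ} (hn : n ≠ 0) {x : Γ.carrier} (hx : x ∈ Γ.deg n) :
    Γ.zeroPart x = 0 := by
  have h : DirectSum.component ℂ ℕ (fun n => Γ.deg n) 0 (DirectSum.decompose Γ.deg x) = 0 :=
    Subtype.ext (Γ.proj_of_mem_ne hx hn)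
  change Γ.zeroEquiv.symm (DirectSum.component ℂ ℕ (fun n => Γ.deg n) 0
    (DirectSum.decompose Γ.deg x)) = 0
  rw [h, map_zero]

end One

section Two

variable {A B : Type*} [Ring A] [Algebra ℂ A] [Ring B] [Algebra ℂ B]
  (Γ : DifferentialCalculus A) (Λ : DifferentialCalculus B)

/-- The embedding `ρ ↦ 1 ⊗ ρ`. -/
def inRight : Λ.carrier →ₐ[ℂ] Skew Γ Λ := GradedTensorProduct.includeRight Γ.deg Λ.deg

/-- The embedding `b ↦ 1 ⊗ b` of the algebra. -/
def inRight₀ : B →ₐ[ℂ] Skew Γ Λ := (inRight Γ Λ).comp Λ.incl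

theorem inRight_incl (b : B) : inRight Γ Λ (Λ.incl b) = inRight₀ Γ Λ b := rfl

theorem of_tmul (γ : Γ.carrier) (ω : Λ.carrier) :
    GradedTensorProduct.of ℂ Γ.deg Λ.deg (γ ⊗ₜ ω) = inLeft Γ Λ γ * inRight Γ Λ ω :=
  (GradedTensorProduct.tmul_one_mul_one_tmul Γ.deg Λ.deg γ ω).symm

theorem of_symm_mul (γ : Γ.carrier) (ω : Λ.carrier) :
    (GradedTensorProduct.of ℂ Γ.deg Λ.deg).symm (inLeft Γ Λ γ * inRight Γ Λ ω) = γ ⊗ₜ ω := by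
  rw [← of_tmul, GradedTensorProduct.of_symm_of]

theorem skew_induction {p : Skew Γ Λ → Prop} (x : Skew Γ Λ)
    (hmul : ∀ γ ω, p (inLeft Γ Λ γ * inRight Γ Λ ω)) (hadd : ∀ x y, p x → p y → p (x + y)) :
    p x := by
  induction x using TensorProduct.induction_on with
  | zero =>
    have h := hmul 0 0
    rw [map_zero, zero_mul] at h
    exact h
  | add x y hx hy => exact hadd x y hx hy
  | tmul γ ω =>
    have h := hmul γ ω
    rw [← of_tmul] at h
    exact h

/-- One factor has degree zero, so no sign appears. With `commute_inRight_incl`, this is what allows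
coefficients to act from either side. -/
theorem commute_inRight₀_inLeft (b : B) (γ : Γ.carrier) :
    Commute (inRight₀ Γ Λ b) (inLeft Γ Λ γ) := by
  induction γ using Γ.homogeneous_induction with
  | h0 => simp
  | hadd x y hx hy => rw [map_add]; exact hx.add_right hy
  | h n γ hγ =>
    have h := GradedTensorProduct.tmul_zero_coe_mul_coe_tmul (R := ℂ) Γ.deg Λ.deg 1
      ⟨_, Λ.incl_mem b⟩ ⟨γ, hγ⟩ 1
    rw [one_mul, mul_one] at h
    exact h.trans (of_tmul Γ Λ _ _)

theorem commute_inRight_incl (ω : Λ.carrier) (a : A) :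
    Commute (inRight Γ Λ ω) (inLeft Γ Λ (Γ.incl a)) := by
  induction ω using Λ.homogeneous_induction with
  | h0 => simp
  | hadd x y hx hy => rw [map_add]; exact hx.add_left hy
  | h n ω hω =>
    have h := GradedTensorProduct.tmul_coe_mul_zero_coe_tmul (R := ℂ) Γ.deg Λ.deg 1
      ⟨ω, hω⟩ ⟨_, Γ.incl_mem a⟩ 1
    rw [one_mul, mul_one] at h
    exact h.trans (of_tmul Γ Λ _ _)

theorem skewIncl_tmul (a : A) (b : B) :
    skewIncl Γ Λ (a ⊗ₜ b) = inLeft Γ Λ (Γ.incl a) * inRight₀ Γ Λ b :=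
  of_tmul Γ Λ _ _

theorem sign_of_mem_zero {x : Γ.carrier} (hx : x ∈ Γ.deg 0) : Γ.sign x = x := by
  simpa using Γ.sign_of_mem hx

theorem skewD_skewIncl_tmul (a : A) (b : B) : skewD Γ Λ (skewIncl Γ Λ (a ⊗ₜ b)) =
    inLeft Γ Λ (Γ.dB a) * inRight₀ Γ Λ b + inLeft Γ Λ (Γ.incl a) * inRight Γ Λ (Λ.dB b) := by
  rw [← inRight_incl, ← of_tmul, ← of_tmul]
  simp [skewD, skewIncl, sign_of_mem_zero Γ (Γ.incl_mem a), dB]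

theorem skewIncl_mul (x y : A ⊗[ℂ] B) : skewIncl Γ Λ (x * y) = skewIncl Γ Λ x * skewIncl Γ Λ y := by
  induction x with
  | zero => simp
  | add x x' hx hx' => simp only [add_mul, map_add, hx, hx']
  | tmul a b =>
    induction y with
    | zero => simp
    | add y y' hy hy' => simp only [mul_add, map_add, hy, hy']
    | tmul a' b' =>
      rw [Algebra.TensorProduct.tmul_mul_tmul, skewIncl_tmul, skewIncl_tmul, skewIncl_tmul,
        map_mul, map_mul, map_mul, mul_assoc, mul_assoc,
        (commute_inRight₀_inLeft Γ Λ b _).left_comm]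

/-- The projection of the skew tensor product onto the forms of total degree zero. -/
def skewProjZero : Skew Γ Λ →ₗ[ℂ] Skew Γ Λ :=
  (GradedTensorProduct.of ℂ Γ.deg Λ.deg).toLinearMap ∘ₗ
    TensorProduct.map (Γ.proj 0) (Λ.proj 0) ∘ₗ
      (GradedTensorProduct.of ℂ Γ.deg Λ.deg).symm.toLinearMap

/-- The projection of the skew tensor product onto the forms of total degree one. -/
def skewProjOne : Skew Γ Λ →ₗ[ℂ] Skew Γ Λ :=
  (GradedTensorProduct.of ℂ Γ.deg Λ.deg).toLinearMap ∘ₗ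
    (TensorProduct.map (Γ.proj 0) (Λ.proj 1) + TensorProduct.map (Γ.proj 1) (Λ.proj 0)) ∘ₗ
      (GradedTensorProduct.of ℂ Γ.deg Λ.deg).symm.toLinearMap

theorem skewProjZero_mul_inRight (γ : Γ.carrier) (ω : Λ.carrier) :
    skewProjZero Γ Λ (inLeft Γ Λ γ * inRight Γ Λ ω) =
      inLeft Γ Λ (Γ.proj 0 γ) * inRight Γ Λ (Λ.proj 0 ω) := by
  rw [← of_tmul, ← of_tmul]
  simp [skewProjZero]

theorem skewProjOne_mul_inRight (γ : Γ.carrier) (ω : Λ.carrier) :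
    skewProjOne Γ Λ (inLeft Γ Λ γ * inRight Γ Λ ω) =
      inLeft Γ Λ (Γ.proj 0 γ) * inRight Γ Λ (Λ.proj 1 ω) +
        inLeft Γ Λ (Γ.proj 1 γ) * inRight Γ Λ (Λ.proj 0 ω) := by
  rw [← of_tmul, ← of_tmul, ← of_tmul]
  simp [skewProjOne]

theorem skew_mul_homogeneous {k l : ℕ} (γ : Γ.carrier) {ω : Λ.carrier} (hω : ω ∈ Λ.deg k)
    {γ' : Γ.carrier} (hγ' : γ' ∈ Γ.deg l) (ω' : Λ.carrier) :
    inLeft Γ Λ γ * inRight Γ Λ ω * (inLeft Γ Λ γ' * inRight Γ Λ ω') =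
      (-1 : ℤˣ) ^ (k * l) • (inLeft Γ Λ (γ * γ') * inRight Γ Λ (ω * ω')) := by
  rw [← of_tmul, ← of_tmul, ← of_tmul]
  exact GradedTensorProduct.tmul_coe_mul_coe_tmul Γ.deg Λ.deg γ ⟨ω, hω⟩ ⟨γ', hγ'⟩ ω'

theorem skew_homogeneous_induction {p : Skew Γ Λ → Prop} (x : Skew Γ Λ) (h0 : p 0)
    (h : ∀ m n, ∀ γ ∈ Γ.deg m, ∀ ω ∈ Λ.deg n, p (inLeft Γ Λ γ * inRight Γ Λ ω))
    (hadd : ∀ x y, p x → p y → p (x + y)) : p x := by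
  induction x using skew_induction with
  | hadd x y hx hy => exact hadd x y hx hy
  | hmul γ ω =>
    induction γ using Γ.homogeneous_induction with
    | h0 => simpa using h0
    | hadd x y hx hy => rw [map_add, add_mul]; exact hadd _ _ hx hy
    | h m γ hγ =>
      induction ω using Λ.homogeneous_induction with
      | h0 => simpa using h0
      | hadd x y hx hy => rw [map_add, mul_add]; exact hadd _ _ hx hy
      | h n ω hω => exact h m n γ hγ ω hω

/-- On homogeneous elements the product is a sign times an element whose total degree is the sum of
those of the factors, and sums 0 and 1 in ℕ decompose only in the obvious ways. -/
theorem skewProj_mul (x y : Skew Γ Λ) :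
    skewProjZero Γ Λ (x * y) = skewProjZero Γ Λ x * skewProjZero Γ Λ y ∧
    skewProjOne Γ Λ (x * y) =
      skewProjZero Γ Λ x * skewProjOne Γ Λ y + skewProjOne Γ Λ x * skewProjZero Γ Λ y := by
  have cases_deg : ∀ m n, ∀ γ ∈ Γ.deg m, ∀ ω ∈ Λ.deg n,
      (skewProjZero Γ Λ (inLeft Γ Λ γ * inRight Γ Λ ω) =
        if m + n = 0 then inLeft Γ Λ γ * inRight Γ Λ ω else 0) ∧
      (skewProjOne Γ Λ (inLeft Γ Λ γ * inRight Γ Λ ω) =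
        if m + n = 1 then inLeft Γ Λ γ * inRight Γ Λ ω else 0) := by
    intro m n γ hγ ω hω
    rw [skewProjZero_mul_inRight, skewProjOne_mul_inRight, Γ.proj_eq_ite hγ, Λ.proj_eq_ite hω,
      Γ.proj_eq_ite hγ, Λ.proj_eq_ite hω]
    rcases m with _ | _ | m <;> rcases n with _ | _ | n <;> simp <;> omega
  induction x using skew_homogeneous_induction with
  | h0 => simp
  | hadd x x' hx hx' =>
    simp only [add_mul, map_add, hx, hx', true_and]
    abel
  | h m n γ hγ ω hω =>
    induction y using skew_homogeneous_induction with
    | h0 => simp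
    | hadd y y' hy hy' =>
      simp only [mul_add, map_add, hy, hy', true_and]
      abel
    | h m' n' γ' hγ' ω' hω' =>
      have e := skew_mul_homogeneous Γ Λ γ hω hγ' ω'
      have c := cases_deg _ _ _ (SetLike.mul_mem_graded hγ hγ') _ (SetLike.mul_mem_graded hω hω')
      have hz : ∀ (f : Skew Γ Λ →ₗ[ℂ] Skew Γ Λ) (z : ℤˣ) (x : Skew Γ Λ), f (z • x) = z • f x :=
        fun f z x => by rw [Units.smul_def, Units.smul_def, map_zsmul]
      rw [(cases_deg m n γ hγ ω hω).1, (cases_deg m n γ hγ ω hω).2,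
        (cases_deg m' n' γ' hγ' ω' hω').1, (cases_deg m' n' γ' hγ' ω' hω').2]
      have c₁ : skewProjZero Γ Λ (inLeft Γ Λ γ * inRight Γ Λ ω *
          (inLeft Γ Λ γ' * inRight Γ Λ ω')) = if (m + n) + (m' + n') = 0 then
            inLeft Γ Λ γ * inRight Γ Λ ω * (inLeft Γ Λ γ' * inRight Γ Λ ω') else 0 := by
        rw [e, hz, c.1, smul_ite, smul_zero]
        exact if_congr (by omega) rfl rfl
      have c₂ : skewProjOne Γ Λ (inLeft Γ Λ γ * inRight Γ Λ ω *
          (inLeft Γ Λ γ' * inRight Γ Λ ω')) = if (m + n) + (m' + n') = 1 then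
            inLeft Γ Λ γ * inRight Γ Λ ω * (inLeft Γ Λ γ' * inRight Γ Λ ω') else 0 := by
        rw [e, hz, c.2, smul_ite, smul_zero]
        exact if_congr (by omega) rfl rfl
      rw [c₁, c₂]
      generalize m + n = k, m' + n' = l
      rcases k with _ | _ | k <;> rcases l with _ | _ | l <;> simp <;> omega

end Two

end DifferentialCalculus

/-! ### Local calculi, one-forms of the completion and coactions -/

namespace DifferentialStructure

open Coalgebra HopfAlgebra WithConv

variable {I H B P : Type*} [Ring H] [HopfAlgebra ℂ H] [Ring B] [Algebra ℂ B]
  [Ring P] [Algebra ℂ P] {X : LocallyTrivialQPFB I H B P} (D : DifferentialStructure X)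

/-- The embedding of `Γ(B_i)` into the local calculus. -/
abbrev inL (i : I) : (D.ΓB i).carrier →ₐ[ℂ] D.Local i := inLeft (D.ΓB i) D.ΓH.toDifferentialCalculus

/-- The embedding of `Γ(H)` into the local calculus. -/
abbrev inR (i : I) : D.ΓH.carrier →ₐ[ℂ] D.Local i := inRight (D.ΓB i) D.ΓH.toDifferentialCalculus

/-- The embedding of `H` into the local calculus. -/
abbrev inH (i : I) : H →ₐ[ℂ] D.Local i := inRight₀ (D.ΓB i) D.ΓH.toDifferentialCalculus

/-- The embedding of `B_i ⊗ H` into the local calculus. -/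
abbrev inZero (i : I) : X.Loc i ⊗[ℂ] H →ₗ[ℂ] D.Local i :=
  skewIncl (D.ΓB i) D.ΓH.toDifferentialCalculus

/-- The differential of the local calculus on `B_i ⊗ H`. -/
def dLoc (i : I) : X.Loc i ⊗[ℂ] H →ₗ[ℂ] D.Local i :=
  skewD (D.ΓB i) D.ΓH.toDifferentialCalculus ∘ₗ D.inZero i

theorem dLoc_tmul (i : I) (a : X.Loc i) (h : H) : D.dLoc i (a ⊗ₜ h) =
    D.inL i ((D.ΓB i).dB a) * D.inH i h + D.inL i ((D.ΓB i).incl a) * D.inR i (D.ΓH.dB h) :=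
  skewD_skewIncl_tmul _ _ _ _

theorem χΓ_dB (i : I) (p : P) : D.χΓ i (D.ΓP.dB p) = D.dLoc i (X.χ i p) := by
  rw [dB, LinearMap.comp_apply, D.χΓ_d, AlgHom.toLinearMap_apply, D.χΓ_incl]
  rfl

/-- That the extended χ_i respects degrees is not an assumption. It holds on the generators p and
dp, and both low-degree projections obey the same product rules in Γ(P) and in the local calculus.
-/
theorem χΓ_proj (i : I) (y : D.ΓP.carrier) :
    D.χΓ i (D.ΓP.proj 0 y) = skewProjZero _ _ (D.χΓ i y) ∧
    D.χΓ i (D.ΓP.proj 1 y) = skewProjOne _ _ (D.χΓ i y) := by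
  induction y using D.ΓP.induction_generated with
  | hincl p =>
    rw [proj_of_mem _ (incl_mem _ _), proj_of_mem_ne _ (incl_mem _ _) zero_ne_one, D.χΓ_incl,
      map_zero]
    induction X.χ i p with
    | zero => simp
    | add x y hx hy => simp only [map_add, ← hx.1, ← hx.2, ← hy.1, ← hy.2, add_zero, and_self]
    | tmul a h =>
      rw [skewIncl_tmul, ← inRight_incl, skewProjZero_mul_inRight, skewProjOne_mul_inRight]
      simp [proj_of_mem _ (incl_mem _ _), proj_of_mem_ne _ (incl_mem _ _) zero_ne_one]
  | hd p =>
    rw [proj_of_mem _ (dB_mem _ _), proj_of_mem_ne _ (dB_mem _ _) one_ne_zero, χΓ_dB, map_zero]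
    induction X.χ i p with
    | zero => simp
    | add x y hx hy => simp only [map_add, ← hx.1, ← hx.2, ← hy.1, ← hy.2, add_zero, and_self]
    | tmul a h =>
      rw [dLoc_tmul, ← inRight_incl, map_add, map_add, skewProjZero_mul_inRight,
        skewProjOne_mul_inRight, skewProjZero_mul_inRight, skewProjOne_mul_inRight]
      simp [proj_of_mem _ (incl_mem _ _), proj_of_mem_ne _ (incl_mem _ _) zero_ne_one,
        proj_of_mem _ (dB_mem _ _), proj_of_mem_ne _ (dB_mem _ _) one_ne_zero]
  | hadd x y hx hy => simp only [map_add, hx.1, hx.2, hy.1, hy.2, and_self]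
  | hmul x y hx hy =>
    simp only [proj_zero_mul, proj_one_mul, map_add, map_mul (D.χΓ i)]
    rw [(skewProj_mul _ _ _ _).1, (skewProj_mul _ _ _ _).2, hx.1, hx.2, hy.1, hy.2]
    exact ⟨rfl, rfl⟩

/-! ### One-forms of the completion -/

theorem χc_eq {i : I} {γ : D.forms} {y : D.ΓP.carrier} (h : Ideal.Quotient.mk _ y = γ.1 i) :
    D.χc i γ = D.χΓ i y := by
  change Ideal.kerLiftAlg (D.χΓ i) (γ.1 i) = _
  rw [← h]
  rfl

theorem forms_ext {γ γ' : D.forms} (h : ∀ i, D.χc i γ = D.χc i γ') : γ = γ' :=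
  Subtype.ext (funext fun i => Ideal.kerLiftAlg_injective (D.χΓ i) (h i))

/-- The members of a one-form over two patches have a common representative. -/
theorem exists_common_lift (γ : D.forms) (i j : I) :
    ∃ y ∈ D.ΓP.deg 1, D.χΓ i y = D.χc i γ ∧ D.χΓ j y = D.χc j γ := by
  obtain ⟨hc, hd⟩ := D.mem_forms.1 γ.2
  obtain ⟨y, hy, ey⟩ := hd i
  obtain ⟨z, hz, ez⟩ := hd j
  have h := hc i j
  rw [← ey, ← ez] at h
  obtain ⟨k, hk, l, hl, e⟩ := Submodule.mem_sup.1 (Ideal.Quotient.eq.1 h)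
  -- The correction terms from the two kernels may have other degrees. Their degree one parts
  -- suffice, and they stay in the kernels by `χΓ_proj`.
  have e₁ : y - D.ΓP.proj 1 k = z + D.ΓP.proj 1 l := by
    have := congr(D.ΓP.proj 1 $e)
    rw [map_add, map_sub, proj_of_mem _ hy, proj_of_mem _ hz] at this
    rw [sub_eq_iff_eq_add, add_assoc, add_comm (D.ΓP.proj 1 l), this, add_sub_cancel]
  have hk' : D.χΓ i (D.ΓP.proj 1 k) = 0 := by rw [(D.χΓ_proj i k).2, hk, map_zero]
  have hl' : D.χΓ j (D.ΓP.proj 1 l) = 0 := by rw [(D.χΓ_proj j l).2, hl, map_zero]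
  refine ⟨y - D.ΓP.proj 1 k, sub_mem hy (proj_mem _ _ _), ?_, ?_⟩
  · rw [map_sub, hk', sub_zero, D.χc_eq ey]
  · rw [e₁, map_add, hl', add_zero, D.χc_eq ez]

theorem exists_lift (γ : D.forms) (i : I) : ∃ y ∈ D.ΓP.deg 1, D.χΓ i y = D.χc i γ :=
  let ⟨y, hy, h, _⟩ := D.exists_common_lift γ i i
  ⟨y, hy, h⟩

/-- Families of local one-forms that agree on the overlaps glue. -/
theorem exists_forms (w : ∀ i, D.Local i)
    (h : ∀ i j, ∃ y ∈ D.ΓP.deg 1, D.χΓ i y = w i ∧ D.χΓ j y = w j) :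
    ∃ γ : D.forms, ∀ i, D.χc i γ = w i := by
  choose y hy hyi hyj using h
  let x : ∀ i, D.ΓP.carrier ⧸ D.kerχ i := fun i => Ideal.Quotient.mk _ (y i i)
  refine ⟨⟨x, D.mem_forms.2 ⟨fun i j => ?_, fun i => ⟨y i i, hy i i, rfl⟩⟩⟩, fun i => ?_⟩
  · refine Ideal.Quotient.eq.2 ?_
    have e : y i i - y j j = (y i i - y i j) + (y i j - y j j) := by abel
    rw [e]
    refine Submodule.add_mem_sup ?_ ?_
    · rw [RingHom.mem_ker, map_sub, hyi, hyi, sub_self]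
    · rw [RingHom.mem_ker, map_sub, hyj, hyi, sub_self]
  · rw [D.χc_eq (y := y i i) rfl, hyi]

theorem χc_dP (i : I) (p : P) : D.χc i (D.dP p) = D.dLoc i (X.χ i p) := by
  rw [D.χc_eq (y := D.ΓP.dB p) rfl, χΓ_dB]

/-- The left (`b = true`) or right (`b = false`) action of `P` on one-forms. -/
def sideAct (b : Bool) (p : P) : D.forms →ₗ[ℂ] D.forms :=
  if b then D.leftMul p else D.rightMul p

theorem χc_sideAct (b : Bool) (i : I) (p : P) (γ : D.forms) :
    D.χc i (D.sideAct b p γ) = sideMul b (D.inZero i (X.χ i p)) (D.χc i γ) := by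
  rw [← D.χΓ_incl]
  cases b
  · exact map_mul (Ideal.kerLiftAlg (D.χΓ i)) (γ.1 i) (Ideal.Quotient.mk _ (D.ΓP.incl p))
  · exact map_mul (Ideal.kerLiftAlg (D.χΓ i)) (Ideal.Quotient.mk _ (D.ΓP.incl p)) (γ.1 i)

/-! ### The local coaction -/

/-- The coaction of `Γ(H)` with values in the local calculus. -/
def coactR (i : I) : D.ΓH.carrier →ₐ[ℂ] D.Local i ⊗[ℂ] H :=
  (Algebra.TensorProduct.map (D.inR i) (AlgHom.id ℂ H)).comp D.ΓH.coact

theorem localCoact_mul (i : I) (γ : (D.ΓB i).carrier) (ω : D.ΓH.carrier) :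
    D.localCoact i (D.inL i γ * D.inR i ω) = (D.inL i γ ⊗ₜ 1) * D.coactR i ω := by
  simp only [localCoact, LinearMap.comp_apply, LinearEquiv.coe_coe, coactR, AlgHom.comp_apply]
  rw [of_symm_mul, LinearMap.lTensor_tmul, AlgHom.toLinearMap_apply]
  induction D.ΓH.coact ω with
  | zero => simp
  | add x y hx hy => simp only [TensorProduct.tmul_add, map_add, mul_add, hx, hy]
  | tmul ρ h => simp [of_tmul]

theorem coactR_incl (i : I) (h : H) : D.coactR i (D.ΓH.incl h) =
    (D.inH i).toLinearMap.rTensor H (comul (R := ℂ) h) := by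
  rw [coactR, AlgHom.comp_apply, D.ΓH.coact_incl]
  induction (comul (R := ℂ) h : H ⊗[ℂ] H) with
  | zero => simp
  | add x y hx hy => simp only [map_add, hx, hy]
  | tmul ρ h => simp [inRight_incl]

theorem coactR_dB (i : I) (h : H) : D.coactR i (D.ΓH.dB h) =
    ((D.inR i).toLinearMap ∘ₗ D.ΓH.dB).rTensor H (comul (R := ℂ) h) := by
  have e := D.ΓH.coact_d h
  rw [coactR, AlgHom.comp_apply, show D.ΓH.dB h = D.ΓH.d (D.ΓH.incl h) from rfl, e]
  induction (comul (R := ℂ) h : H ⊗[ℂ] H) with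
  | zero => simp
  | add x y hx hy => simp only [map_add, hx, hy]
  | tmul ρ h => simp

theorem commute_coactR_incl (i : I) (h : H) (γ : (D.ΓB i).carrier) :
    Commute (D.coactR i (D.ΓH.incl h)) (D.inL i γ ⊗ₜ 1) := by
  rw [coactR_incl]
  induction (comul (R := ℂ) h : H ⊗[ℂ] H) with
  | zero => simp
  | add x y hx hy => rw [map_add]; exact hx.add_left hy
  | tmul k l =>
    simp only [LinearMap.rTensor_tmul, AlgHom.toLinearMap_apply]
    rw [Commute, SemiconjBy, Algebra.TensorProduct.tmul_mul_tmul,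
      Algebra.TensorProduct.tmul_mul_tmul, one_mul, mul_one,
      (commute_inRight₀_inLeft _ _ k γ).eq]

theorem commute_coactR_inL_incl (i : I) (ω : D.ΓH.carrier) (a : X.Loc i) :
    Commute (D.coactR i ω) (D.inL i ((D.ΓB i).incl a) ⊗ₜ 1) := by
  rw [coactR, AlgHom.comp_apply]
  induction D.ΓH.coact ω with
  | zero => simp
  | add x y hx hy => rw [map_add]; exact hx.add_left hy
  | tmul k l =>
    rw [Algebra.TensorProduct.map_tmul, Commute, SemiconjBy, Algebra.TensorProduct.tmul_mul_tmul,
      Algebra.TensorProduct.tmul_mul_tmul, one_mul, mul_one,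
      (commute_inRight_incl _ _ k a).eq]

theorem localCoact_inZero_tmul (i : I) (a : X.Loc i) (h : H) : D.localCoact i (D.inZero i (a ⊗ₜ h)) =
    (D.inL i ((D.ΓB i).incl a) ⊗ₜ 1) * D.coactR i (D.ΓH.incl h) := by
  rw [skewIncl_tmul, ← inRight_incl, localCoact_mul]

/-- The coaction is defined only as a linear map; multiplicativity is needed just when one factor
has degree zero, where reordering produces no signs. -/
theorem localCoact_sideMul (b : Bool) (i : I) (x : X.Loc i ⊗[ℂ] H) (w : D.Local i) :
    D.localCoact i (sideMul b (D.inZero i x) w) =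
      sideMul b (D.localCoact i (D.inZero i x)) (D.localCoact i w) := by
  have hm : ∀ u v : D.Local i, (u * v) ⊗ₜ[ℂ] (1 : H) = (u ⊗ₜ 1) * (v ⊗ₜ 1) := by simp
  induction x with
  | zero => simp
  | add x y hx hy => simp only [map_add, LinearMap.add_apply, hx, hy]
  | tmul a h =>
    induction w using skew_induction with
    | hadd x y hx hy => simp only [map_add, hx, hy]
    | hmul γ ω =>
      rw [localCoact_inZero_tmul, localCoact_mul, skewIncl_tmul]
      cases b
      · rw [sideMul_false, sideMul_false, mul_assoc, ← mul_assoc (D.inR i ω),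
          (commute_inRight_incl _ _ ω a).eq, ← inRight_incl, mul_assoc, ← map_mul, ← mul_assoc,
          ← map_mul, localCoact_mul, mul_assoc, ← mul_assoc (D.coactR i ω),
          (D.commute_coactR_inL_incl i ω a).eq, map_mul, map_mul, hm]
        simp only [mul_assoc]
      · rw [sideMul_true, sideMul_true, mul_assoc, ← mul_assoc (D.inH i h),
          (commute_inRight₀_inLeft _ _ h γ).eq, ← inRight_incl, mul_assoc, ← map_mul, ← mul_assoc,
          ← map_mul, localCoact_mul, mul_assoc, ← mul_assoc (D.coactR i _),
          (D.commute_coactR_incl i h γ).eq, map_mul, map_mul, hm]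
        simp only [mul_assoc]

/-- The coaction `id ⊗ Δ` on `B_i ⊗ H`. -/
abbrev coactZero (X : LocallyTrivialQPFB I H B P) (i : I) :
    X.Loc i ⊗[ℂ] H →ₗ[ℂ] (X.Loc i ⊗[ℂ] H) ⊗[ℂ] H :=
  (TensorProduct.assoc ℂ (X.Loc i) H H).symm.toLinearMap ∘ₗ
    (comul (R := ℂ) (A := H)).lTensor (X.Loc i)

theorem localCoact_inZero (i : I) (z : X.Loc i ⊗[ℂ] H) : D.localCoact i (D.inZero i z) =
    (D.inZero i).rTensor H (coactZero X i z) := by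
  induction z with
  | zero => simp
  | add x y hx hy => simp only [map_add, hx, hy]
  | tmul a h =>
    rw [localCoact_inZero_tmul, coactR_incl]
    simp only [LinearMap.comp_apply, LinearMap.lTensor_tmul]
    induction (comul (R := ℂ) h : H ⊗[ℂ] H) with
    | zero => simp
    | add x y hx hy => simp only [TensorProduct.tmul_add, map_add, mul_add, hx, hy]
    | tmul k l => simp [skewIncl_tmul]

theorem localCoact_dLoc (i : I) (z : X.Loc i ⊗[ℂ] H) : D.localCoact i (D.dLoc i z) =
    (D.dLoc i).rTensor H (coactZero X i z) := by
  induction z with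
  | zero => simp
  | add x y hx hy => simp only [map_add, hx, hy]
  | tmul a h =>
    rw [dLoc_tmul, map_add, localCoact_mul, ← inRight_incl, localCoact_mul, coactR_incl, coactR_dB]
    simp only [LinearMap.comp_apply, LinearMap.lTensor_tmul]
    induction (comul (R := ℂ) h : H ⊗[ℂ] H) with
    | zero => simp
    | add x y hx hy =>
      simp only [TensorProduct.tmul_add, map_add, mul_add, ← hx, ← hy]
      abel
    | tmul k l => simp [dLoc_tmul, TensorProduct.add_tmul]

/-! ### The coaction on the one-forms of the completion -/

/-- For p dq the tensor is Δ(p)(d ⊗ id)Δ(q). Only existence is claimed, so no well-definedness has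
to be checked when these are summed. -/
theorem exists_coact_of_mem {y : D.ΓP.carrier} (hy : y ∈ D.ΓP.deg 1) :
    ∃ t : D.ΓP.carrier ⊗[ℂ] H, (∀ φ : H →ₗ[ℂ] ℂ, contract φ t ∈ D.ΓP.deg 1) ∧
      ∀ i, (D.χΓ i).toLinearMap.rTensor H t = D.localCoact i (D.χΓ i y) := by
  have hspan := D.ΓP.deg_one_le_span true hy
  clear hy
  induction hspan using Submodule.span_induction with
  | zero => exact ⟨0, by simp, by simp⟩
  | add x y _ _ hx hy =>
    obtain ⟨s, hs, hs'⟩ := hx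
    obtain ⟨t, ht, ht'⟩ := hy
    refine ⟨s + t, fun φ => ?_, fun i => ?_⟩
    · rw [map_add]
      exact add_mem (hs φ) (ht φ)
    · rw [map_add, hs', ht', map_add, map_add]
  | smul c x _ hx =>
    obtain ⟨s, hs, hs'⟩ := hx
    refine ⟨c • s, fun φ => ?_, fun i => ?_⟩
    · rw [map_smul]
      exact Submodule.smul_mem _ _ (hs φ)
    · rw [map_smul, hs', map_smul, map_smul]
  | mem x hx =>
    obtain ⟨p, q, rfl⟩ := hx
    refine ⟨D.ΓP.incl.toLinearMap.rTensor H (X.coact p) * D.ΓP.dB.rTensor H (X.coact q),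
      fun φ => ?_, fun i => ?_⟩
    · have h := LocallyTrivialQPFB.contract_mul_mem (K := D.ΓP.deg 0) (L := D.ΓP.deg 1)
        (s := D.ΓP.incl.toLinearMap.rTensor H (X.coact p)) (t := D.ΓP.dB.rTensor H (X.coact q))
        (fun φ => by rw [contract_rTensor]; exact incl_mem _ _)
        (fun φ => by rw [contract_rTensor]; exact dB_mem _ _) φ
      refine (Submodule.mul_le.2 fun m hm n hn => ?_ : D.ΓP.deg 0 * D.ΓP.deg 1 ≤ D.ΓP.deg 1) h
      simpa using SetLike.mul_mem_graded hm hn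
    · have e : ∀ s t : D.ΓP.carrier ⊗[ℂ] H, (D.χΓ i).toLinearMap.rTensor H (s * t) =
          (D.χΓ i).toLinearMap.rTensor H s * (D.χΓ i).toLinearMap.rTensor H t :=
        map_mul (Algebra.TensorProduct.map (D.χΓ i) (AlgHom.id ℂ H))
      have e₁ : (D.χΓ i).toLinearMap ∘ₗ D.ΓP.incl.toLinearMap =
          D.inZero i ∘ₗ (X.χ i).toLinearMap := LinearMap.ext (D.χΓ_incl i)
      have e₂ : (D.χΓ i).toLinearMap ∘ₗ D.ΓP.dB = D.dLoc i ∘ₗ (X.χ i).toLinearMap :=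
        LinearMap.ext (D.χΓ_dB i)
      have e₃ := D.localCoact_sideMul true i (X.χ i p) (D.dLoc i (X.χ i q))
      rw [sideMul_true, sideMul_true] at e₃
      rw [sideMul_true, map_mul (D.χΓ i), D.χΓ_incl, D.χΓ_dB, e₃,
        localCoact_inZero, localCoact_dLoc, e, ← LinearMap.rTensor_comp_apply, e₁,
        ← LinearMap.rTensor_comp_apply, e₂, LinearMap.rTensor_comp_apply,
        LinearMap.rTensor_comp_apply, X.χ_rTensor_coact, X.χ_rTensor_coact]
      rfl

/-- For each functional on H the contractions of the local coactions agree on overlaps and glue to a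
one-form; the tensor is reassembled from these along a basis of H. -/
theorem exists_isCoactionOf [Finite I] (γ : D.forms) : ∃ t, D.IsCoactionOf γ t := by
  classical
  have := Fintype.ofFinite I
  have hφ : ∀ φ : H →ₗ[ℂ] ℂ, ∃ ρ : D.forms, ∀ i,
      D.χc i ρ = contract φ (D.localCoact i (D.χc i γ)) := by
    intro φ
    refine D.exists_forms _ fun i j => ?_
    obtain ⟨y, hy, hi, hj⟩ := D.exists_common_lift γ i j
    obtain ⟨t, ht, ht'⟩ := D.exists_coact_of_mem hy
    refine ⟨contract φ t, ht φ, ?_, ?_⟩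
    · rw [← hi, ← ht', contract_rTensor]
      rfl
    · rw [← hj, ← ht', contract_rTensor]
      rfl
  choose ρ hρ using hφ
  let b := Module.Basis.ofVectorSpace ℂ H
  -- Since I is finite, finitely many basis vectors of H serve all patches at once.
  let F := Finset.univ.biUnion fun i =>
    (TensorProduct.equivFinsuppOfBasisRight b (D.localCoact i (D.χc i γ))).support
  refine ⟨∑ k ∈ F, ρ (b.coord k) ⊗ₜ b k, fun i => ?_⟩
  apply (TensorProduct.equivFinsuppOfBasisRight (M := D.Local i) b).injective
  ext l
  simp only [map_sum, LinearMap.rTensor_tmul, Finsupp.finsetSum_apply, hρ, contract_coord]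
  rw [Finset.sum_eq_single l]
  · simp
  · intro k _ hk
    simp [hk]
  · intro hl
    have h0 : TensorProduct.equivFinsuppOfBasisRight b (D.localCoact i (D.χc i γ)) l = 0 := by
      by_contra h
      exact hl (Finset.mem_biUnion.2 ⟨i, Finset.mem_univ i, Finsupp.mem_support_iff.2 h⟩)
    rw [h0]
    simp

/-! ### Horizontal forms and the counit -/

@[elab_as_elim]
theorem horizontal_induction (i : I) {p : D.Local i → Prop} {w : D.Local i}
    (hw : w ∈ horizontal (D.ΓB i) D.ΓH.toDifferentialCalculus)
    (hmul : ∀ γ h, p (D.inL i γ * D.inH i h)) (hadd : ∀ x y, p x → p y → p (x + y)) : p w := by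
  obtain ⟨z, rfl⟩ := hw
  induction z with
  | zero => simpa using hmul 0 0
  | add x y hx hy => rw [map_add]; exact hadd _ _ hx hy
  | tmul γ h =>
    have e := hmul γ h
    rw [← inRight_incl, ← of_tmul] at e
    exact e

theorem mul_inH_mem_horizontal (i : I) (γ : (D.ΓB i).carrier) (h : H) :
    D.inL i γ * D.inH i h ∈ horizontal (D.ΓB i) D.ΓH.toDifferentialCalculus :=
  ⟨γ ⊗ₜ h, of_tmul _ _ _ _⟩

theorem inL_mem_horizontal (i : I) (γ : (D.ΓB i).carrier) :
    D.inL i γ ∈ horizontal (D.ΓB i) D.ΓH.toDifferentialCalculus := by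
  simpa using D.mul_inH_mem_horizontal i γ 1

theorem sideMul_mem_horizontal (b : Bool) (i : I) (x : X.Loc i ⊗[ℂ] H) {w : D.Local i}
    (hw : w ∈ horizontal (D.ΓB i) D.ΓH.toDifferentialCalculus) :
    sideMul b (D.inZero i x) w ∈ horizontal (D.ΓB i) D.ΓH.toDifferentialCalculus := by
  induction x with
  | zero => simp
  | add x y hx hy => rw [map_add, map_add]; exact add_mem hx hy
  | tmul a k =>
    refine D.horizontal_induction i hw (fun γ h => ?_) fun x y hx hy => ?_
    · rw [skewIncl_tmul]
      cases b
      · rw [sideMul_false, mul_assoc, ← mul_assoc (D.inH i h),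
          (commute_inRight₀_inLeft _ _ h _).eq, mul_assoc, ← map_mul, ← mul_assoc, ← map_mul]
        exact D.mul_inH_mem_horizontal i _ _
      · rw [sideMul_true, mul_assoc, ← mul_assoc (D.inH i k),
          (commute_inRight₀_inLeft _ _ k _).eq, mul_assoc, ← map_mul, ← mul_assoc, ← map_mul]
        exact D.mul_inH_mem_horizontal i _ _
    · rw [map_add]
      exact add_mem hx hy

theorem counitΓ_incl (h : H) : D.ΓH.counitΓ (D.ΓH.incl h) = counit h := by
  rw [RightCovariantCalculus.counitΓ, LinearMap.comp_apply, zeroPart_incl]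

theorem counitΓ_of_mem {ω : D.ΓH.carrier} (hω : ω ∈ D.ΓH.deg 1) : D.ΓH.counitΓ ω = 0 := by
  rw [RightCovariantCalculus.counitΓ, LinearMap.comp_apply, zeroPart_of_mem _ one_ne_zero hω,
    map_zero]

theorem idCounit_mul (i : I) (γ : (D.ΓB i).carrier) (ω : D.ΓH.carrier) :
    D.idCounit i (D.inL i γ * D.inR i ω) = D.ΓH.counitΓ ω • γ := by
  simp only [idCounit, LinearMap.comp_apply, LinearEquiv.coe_coe]
  rw [of_symm_mul]
  simp

theorem idCounit_mul_inH (i : I) (γ : (D.ΓB i).carrier) (h : H) :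
    D.idCounit i (D.inL i γ * D.inH i h) = counit (R := ℂ) h • γ := by
  rw [← inRight_incl, idCounit_mul, counitΓ_incl]

theorem idCounit_sideMul_inH (b : Bool) (i : I) (k : H) {w : D.Local i}
    (hw : w ∈ horizontal (D.ΓB i) D.ΓH.toDifferentialCalculus) :
    D.idCounit i (sideMul b (D.inH i k) w) = counit (R := ℂ) k • D.idCounit i w := by
  refine D.horizontal_induction i hw (fun γ h => ?_) fun x y hx hy => ?_
  · cases b
    · rw [sideMul_false, mul_assoc, ← map_mul, idCounit_mul_inH, idCounit_mul_inH,
        Bialgebra.counit_mul, mul_comm, mul_smul]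
    · rw [sideMul_true, ← mul_assoc, (commute_inRight₀_inLeft _ _ k _).eq, mul_assoc, ← map_mul,
        idCounit_mul_inH, idCounit_mul_inH, Bialgebra.counit_mul, mul_smul]
  · simp only [map_add, hx, hy, smul_add]

/-- A horizontal form is recovered from its coaction by means of `id ⊗ ε`. -/
theorem lift_idCounit_localCoact (i : I) {w : D.Local i}
    (hw : w ∈ horizontal (D.ΓB i) D.ΓH.toDifferentialCalculus) :
    LinearMap.mul' ℂ (D.Local i) (TensorProduct.map ((D.inL i).toLinearMap ∘ₗ D.idCounit i)
      (D.inH i).toLinearMap (D.localCoact i w)) = w := by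
  refine D.horizontal_induction i hw (fun γ h => ?_) fun x y hx hy => ?_
  · rw [← inRight_incl, localCoact_mul, coactR_incl, inRight_incl]
    have e : ∀ t : H ⊗[ℂ] H, LinearMap.mul' ℂ (D.Local i)
        (TensorProduct.map ((D.inL i).toLinearMap ∘ₗ D.idCounit i) (D.inH i).toLinearMap
          (D.inL i γ ⊗ₜ 1 * (D.inH i).toLinearMap.rTensor H t)) =
        D.inL i γ * D.inH i (TensorProduct.lid ℂ H (counit.rTensor H t)) := by
      intro t
      induction t with
      | zero => simp
      | add x y hx hy => simp only [map_add, mul_add, hx, hy]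
      | tmul k l => simp [idCounit_mul_inH]
    rw [e]
    simp
  · simp only [map_add, hx, hy]

end DifferentialStructure

/-! ### Constants in the convolution algebra -/

section ConvolutionConstants

open Coalgebra WithConv

variable {H : Type*} [Ring H] [HopfAlgebra ℂ H] {A : Type*} [Ring A] [Algebra ℂ A]

/-- The constant `z`, as an element `h ↦ ε(h) z` of the convolution algebra. -/
def convConst (z : A) : WithConv (H →ₗ[ℂ] A) := toConv (LinearMap.toSpanSingleton ℂ A z ∘ₗ counit)

theorem convConst_mul (z : A) (f : H →ₗ[ℂ] A) :
    convConst z * toConv f = toConv (LinearMap.mulLeft ℂ z ∘ₗ f) := by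
  ext h
  rw [(ℛ ℂ h).convMul_apply]
  simp only [convConst, LinearMap.comp_apply, LinearMap.toSpanSingleton_apply, smul_mul_assoc,
    ← mul_smul_comm, ← map_smul, ← Finset.mul_sum, ← map_sum]
  change z * f _ = z * f h
  rw [sum_counit_smul]

theorem mul_convConst (z : A) (f : H →ₗ[ℂ] A) :
    toConv f * convConst z = toConv (LinearMap.mulRight ℂ z ∘ₗ f) := by
  ext h
  rw [(ℛ ℂ h).convMul_apply]
  simp only [convConst, LinearMap.comp_apply, LinearMap.toSpanSingleton_apply, mul_smul_comm,
    ← smul_mul_assoc, ← map_smul, ← Finset.sum_mul, ← map_sum]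
  change f _ * z = f h * z
  rw [sum_counit_right_smul]

/-- Translates pointwise commutation with z into the convolution algebra, where units can be
cancelled. -/
theorem commute_convConst_iff {z : A} {f : H →ₗ[ℂ] A} :
    Commute (toConv f) (convConst z) ↔ ∀ h, Commute (f h) z := by
  rw [Commute, SemiconjBy, convConst_mul, mul_convConst]
  constructor
  · intro e h
    exact LinearMap.congr_fun (toConv_injective e) h
  · intro e
    congr 1
    ext h
    exact e h

theorem toConv_comp_algHom {A' : Type*} [Ring A'] [Algebra ℂ A'] (F : A →ₐ[ℂ] A')
    (f g : H →ₗ[ℂ] A) : F.toLinearMap ∘ₗ convolve f g =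
      convolve (F.toLinearMap ∘ₗ f) (F.toLinearMap ∘ₗ g) :=
  LinearMap.algHom_comp_convMul_distrib F (toConv f) (toConv g)

end ConvolutionConstants

namespace DifferentialStructure

open Coalgebra HopfAlgebra WithConv

variable {I H B P : Type*} [Ring H] [HopfAlgebra ℂ H] [Ring B] [Algebra ℂ B]
  [Ring P] [Algebra ℂ P] {X : LocallyTrivialQPFB I H B P} (D : DifferentialStructure X)

/-! ### The calculus over an overlap -/

theorem projLeft_χΓ (i j : I) (y : D.ΓP.carrier) :
    D.projLeft i j (D.χΓ i y) = Ideal.Quotient.mk _ y := by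
  have h : (Ideal.quotientKerAlgEquivOfSurjective (D.χΓ_surjective i)).symm (D.χΓ i y) =
      Ideal.Quotient.mk _ y := (AlgEquiv.symm_apply_eq _).2 rfl
  change Ideal.Quotient.factorₐ ℂ (le_sup_left : D.kerχ i ≤ D.kerχ i ⊔ D.kerχ j)
    ((Ideal.quotientKerAlgEquivOfSurjective (D.χΓ_surjective i)).symm (D.χΓ i y)) = _
  rw [h]
  rfl

theorem projRight_χΓ (i j : I) (y : D.ΓP.carrier) :
    D.projRight i j (D.χΓ j y) = Ideal.Quotient.mk _ y := by
  have h : (Ideal.quotientKerAlgEquivOfSurjective (D.χΓ_surjective j)).symm (D.χΓ j y) =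
      Ideal.Quotient.mk _ y := (AlgEquiv.symm_apply_eq _).2 rfl
  change Ideal.Quotient.factorₐ ℂ (le_sup_right : D.kerχ j ≤ D.kerχ i ⊔ D.kerχ j)
    ((Ideal.quotientKerAlgEquivOfSurjective (D.χΓ_surjective j)).symm (D.χΓ j y)) = _
  rw [h]
  rfl

theorem overlapD_mk (i j : I) (y : D.ΓP.carrier) :
    D.overlapD i j (Ideal.Quotient.mk _ y) = Ideal.Quotient.mk _ (D.ΓP.d y) := rfl

theorem inL_incl_mk (i : I) (b : B) :
    D.inL i ((D.ΓB i).incl (Ideal.Quotient.mk _ b)) = D.χΓ i (D.ΓP.incl (X.ι b)) := by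
  rw [D.χΓ_incl, X.χ_ι, skewIncl_tmul, map_one, mul_one]

theorem inL_dB_mk (i : I) (b : B) :
    D.inL i ((D.ΓB i).dB (Ideal.Quotient.mk _ b)) = D.χΓ i (D.ΓP.dB (X.ι b)) := by
  rw [D.χΓ_dB, X.χ_ι, dLoc_tmul, dB_one, map_one, map_zero, mul_one, mul_zero, add_zero]

theorem projLeft_incl (i j : I) (a : X.Loc i) :
    D.projLeft i j (D.inL i ((D.ΓB i).incl a)) = D.overlapIncl i j (X.resLeft i j a) := by
  obtain ⟨b, rfl⟩ := Ideal.Quotient.mk_surjective a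
  rw [inL_incl_mk, projLeft_χΓ]
  rfl

theorem projRight_incl (i j : I) (a : X.Loc j) :
    D.projRight i j (D.inL j ((D.ΓB j).incl a)) = D.overlapIncl i j (X.resRight i j a) := by
  obtain ⟨b, rfl⟩ := Ideal.Quotient.mk_surjective a
  rw [inL_incl_mk, projRight_χΓ]
  rfl

theorem projLeft_dB (i j : I) (a : X.Loc i) : D.projLeft i j (D.inL i ((D.ΓB i).dB a)) =
    D.overlapD i j (D.overlapIncl i j (X.resLeft i j a)) := by
  obtain ⟨b, rfl⟩ := Ideal.Quotient.mk_surjective a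
  rw [inL_dB_mk, projLeft_χΓ]
  rfl

theorem projRight_dB (i j : I) (a : X.Loc j) : D.projRight i j (D.inL j ((D.ΓB j).dB a)) =
    D.overlapD i j (D.overlapIncl i j (X.resRight i j a)) := by
  obtain ⟨b, rfl⟩ := Ideal.Quotient.mk_surjective a
  rw [inL_dB_mk, projRight_χΓ]
  rfl

theorem overlapD_incl_mul (i j : I) (x y : X.Overlap i j) :
    D.overlapD i j (D.overlapIncl i j x * D.overlapIncl i j y) =
      D.overlapD i j (D.overlapIncl i j x) * D.overlapIncl i j y +
        D.overlapIncl i j x * D.overlapD i j (D.overlapIncl i j y) := by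
  obtain ⟨a, rfl⟩ := Ideal.Quotient.mk_surjective x
  obtain ⟨b, rfl⟩ := Ideal.Quotient.mk_surjective y
  have e₁ : D.overlapIncl i j (Ideal.Quotient.mk _ a) * D.overlapIncl i j (Ideal.Quotient.mk _ b) =
      Ideal.Quotient.mk _ (D.ΓP.incl (X.ι a * X.ι b)) := by
    rw [map_mul D.ΓP.incl, map_mul (Ideal.Quotient.mk _)]
    rfl
  rw [e₁, overlapD_mk]
  refine congr(Ideal.Quotient.mk (D.kerχ i ⊔ D.kerχ j) $(D.ΓP.dB_mul (X.ι a) (X.ι b))).trans ?_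
  rw [map_add, map_mul (Ideal.Quotient.mk _), map_mul (Ideal.Quotient.mk _)]
  rfl

theorem overlapD_one (i j : I) : D.overlapD i j 1 = 0 := by
  have h := D.overlapD_incl_mul i j 1 1
  simpa using h

/-- The image of `H` in the overlap calculus under the trivialization over `i`. -/
def leftH (i j : I) : H →ₐ[ℂ] D.OverlapForms i j := (D.projLeft i j).comp (D.inH i)

/-- The image of `H` in the overlap calculus under the trivialization over `j`. -/
def rightH (i j : I) : H →ₐ[ℂ] D.OverlapForms i j := (D.projRight i j).comp (D.inH j)

/-- The forms on the base in the overlap calculus. -/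
def baseForms (i j : I) : Subalgebra ℂ (D.OverlapForms i j) :=
  ((D.projLeft i j).comp (D.inL i)).range

theorem projLeft_inL_mem (i j : I) (γ : (D.ΓB i).carrier) :
    D.projLeft i j (D.inL i γ) ∈ D.baseForms i j := ⟨γ, rfl⟩

theorem overlapIncl_mem (i j : I) (x : X.Overlap i j) :
    D.overlapIncl i j x ∈ D.baseForms i j := by
  obtain ⟨b, rfl⟩ := Ideal.Quotient.mk_surjective x
  exact ⟨(D.ΓB i).incl (Ideal.Quotient.mk _ b), D.projLeft_incl i j _⟩

theorem overlapD_incl_mem (i j : I) (x : X.Overlap i j) :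
    D.overlapD i j (D.overlapIncl i j x) ∈ D.baseForms i j := by
  obtain ⟨b, rfl⟩ := Ideal.Quotient.mk_surjective x
  exact ⟨(D.ΓB i).dB (Ideal.Quotient.mk _ b), D.projLeft_dB i j _⟩

/-- Both Γ(B_i) and Γ(B_j) are generated by classes of b and db with b ∈ B, and these have the same
images over the overlap. `projLeft_inL_mem_range` is the converse inclusion. -/
theorem projRight_inL_mem (i j : I) (γ : (D.ΓB j).carrier) :
    D.projRight i j (D.inL j γ) ∈ D.baseForms i j := by
  induction γ using (D.ΓB j).induction_generated with
  | hincl b => rw [projRight_incl]; exact D.overlapIncl_mem i j _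
  | hd b => rw [projRight_dB]; exact D.overlapD_incl_mem i j _
  | hadd x y hx hy => rw [map_add, map_add]; exact add_mem hx hy
  | hmul x y hx hy => rw [map_mul, map_mul]; exact mul_mem hx hy

theorem projLeft_inL_mem_range (i j : I) (γ : (D.ΓB i).carrier) :
    D.projLeft i j (D.inL i γ) ∈ ((D.projRight i j).comp (D.inL j)).range := by
  induction γ using (D.ΓB i).induction_generated with
  | hincl a =>
    obtain ⟨b, rfl⟩ := Ideal.Quotient.mk_surjective a
    refine ⟨(D.ΓB j).incl (Ideal.Quotient.mk _ b), ?_⟩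
    refine Eq.trans ?_ (D.projLeft_incl i j _).symm
    exact D.projRight_incl i j (Ideal.Quotient.mk _ b)
  | hd a =>
    obtain ⟨b, rfl⟩ := Ideal.Quotient.mk_surjective a
    refine ⟨(D.ΓB j).dB (Ideal.Quotient.mk _ b), ?_⟩
    refine Eq.trans ?_ (D.projLeft_dB i j _).symm
    exact D.projRight_dB i j (Ideal.Quotient.mk _ b)
  | hadd x y hx hy => rw [map_add, map_add]; exact add_mem hx hy
  | hmul x y hx hy => rw [map_mul, map_mul]; exact mul_mem hx hy

theorem commute_leftH {i j : I} (h : H) {z : D.OverlapForms i j} (hz : z ∈ D.baseForms i j) :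
    Commute (D.leftH i j h) z := by
  obtain ⟨γ, rfl⟩ := hz
  exact (commute_inRight₀_inLeft _ _ h γ).map (D.projLeft i j)

theorem commute_rightH {i j : I} (h : H) {z : D.OverlapForms i j} (hz : z ∈ D.baseForms i j) :
    Commute (D.rightH i j h) z := by
  obtain ⟨δ, rfl⟩ := hz
  obtain ⟨γ, hγ⟩ := D.projLeft_inL_mem_range i j δ
  change Commute _ (D.projLeft i j (D.inL i δ))
  rw [← hγ]
  exact (commute_inRight₀_inLeft _ _ h γ).map (D.projRight i j)

/-- The transition function `τ_ij` with values in the overlap calculus. -/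
def trans (τ : ∀ i j, H →ₐ[ℂ] X.Overlap i j) (i j : I) : H →ₐ[ℂ] D.OverlapForms i j :=
  (D.overlapIncl i j).comp (τ i j)

/-- The transition function `τ_ji` with values in the overlap calculus. -/
def transSwap (τ : ∀ i j, H →ₐ[ℂ] X.Overlap i j) (i j : I) : H →ₐ[ℂ] D.OverlapForms i j :=
  (D.overlapIncl i j).comp ((X.overlapSwap i j).comp (τ j i))

variable {τ : ∀ i j, H →ₐ[ℂ] X.Overlap i j}

theorem trans_mem (i j : I) (h : H) : D.trans τ i j h ∈ D.baseForms i j := D.overlapIncl_mem i j _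

theorem projLeft_inZero (i j : I) (z : X.Loc i ⊗[ℂ] H) : D.projLeft i j (D.inZero i z) =
    LinearMap.mul' ℂ _ (TensorProduct.map (D.overlapIncl i j).toLinearMap (D.leftH i j).toLinearMap
      ((X.resLeft i j).toLinearMap.rTensor H z)) := by
  induction z with
  | zero => simp
  | add x y hx hy => simp only [map_add, hx, hy]
  | tmul a h =>
    rw [skewIncl_tmul, map_mul, projLeft_incl]
    rfl

theorem trans_mul_transSwap (hτ : X.IsTransition τ) (i j : I) :
    toConv (D.trans τ i j).toLinearMap * toConv (D.transSwap τ i j).toLinearMap = 1 := by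
  have h := congr((D.overlapIncl i j).toLinearMap ∘ₗ ofConv $(hτ.mul_eq_one i j))
  rw [← toConv_convolve] at h
  refine congr(toConv $((toConv_comp_algHom _ _ _).symm.trans h)).trans ?_
  ext k
  simp

theorem transSwap_mul_trans (hτ : X.IsTransition τ) (i j : I) :
    toConv (D.transSwap τ i j).toLinearMap * toConv (D.trans τ i j).toLinearMap = 1 := by
  have h := congr((D.overlapIncl i j).toLinearMap ∘ₗ ofConv $(hτ.mul_eq_one' i j))
  rw [← toConv_convolve] at h
  refine congr(toConv $((toConv_comp_algHom _ _ _).symm.trans h)).trans ?_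
  ext k
  simp

theorem trans_comp_antipode (hτ : X.IsTransition τ) (i j : I) :
    (D.trans τ i j).toLinearMap ∘ₗ antipode ℂ = (D.transSwap τ i j).toLinearMap :=
  comp_antipode_eq_of_mul_eq_one (D.trans_mul_transSwap hτ i j)

theorem transSwap_comp_antipode (hτ : X.IsTransition τ) (i j : I) :
    (D.transSwap τ i j).toLinearMap ∘ₗ antipode ℂ = (D.trans τ i j).toLinearMap :=
  comp_antipode_eq_of_mul_eq_one (D.transSwap_mul_trans hτ i j)

/-- The class of a single p with χ_j(p) = 1 ⊗ h is read in both trivializations. -/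
theorem rightH_eq (hτ : X.IsTransition τ) (i j : I) : toConv (D.rightH i j).toLinearMap =
    toConv (D.transSwap τ i j).toLinearMap * toConv (D.leftH i j).toLinearMap := by
  ext h
  obtain ⟨p, hp⟩ := X.χ_surjective j (1 ⊗ₜ h)
  have e₁ : D.rightH i j h = Ideal.Quotient.mk _ (D.ΓP.incl p) := by
    rw [← projRight_χΓ, D.χΓ_incl, hp, skewIncl_tmul, map_one, map_one, one_mul]
    rfl
  have e₂ := D.projLeft_inZero i j (X.χ i p)
  rw [← D.χΓ_incl, projLeft_χΓ, ← e₁, hτ, hp, LinearMap.rTensor_tmul, AlgHom.toLinearMap_apply,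
    map_one, LocallyTrivialQPFB.twist_tmul _ _ _ (ℛ ℂ h)] at e₂
  rw [(ℛ ℂ h).convMul_apply]
  refine e₂.trans ?_
  simp [transSwap]

/-- Both images of H commute with z, and one is the convolution product of τ_ji with the other;
cancelling the invertible factor leaves τ_ji. -/
theorem commute_transSwap (hτ : X.IsTransition τ) (i j : I) (h : H) {z : D.OverlapForms i j} (hz : z ∈ D.baseForms i j) :
    Commute (D.transSwap τ i j h) z := by
  refine commute_convConst_iff (f := (D.transSwap τ i j).toLinearMap).1 ?_ h
  have hU : Commute (toConv (D.leftH i j).toLinearMap) (convConst z) :=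
    commute_convConst_iff.2 fun k => D.commute_leftH k hz
  have hV : Commute (toConv (D.rightH i j).toLinearMap) (convConst z) :=
    commute_convConst_iff.2 fun k => D.commute_rightH k hz
  rw [D.rightH_eq hτ] at hV
  apply (isUnit_toConv_algHom (D.leftH i j)).mul_right_cancel
  rw [mul_assoc, ← hU.eq, ← mul_assoc, hV.eq, mul_assoc]

theorem commute_trans (hτ : X.IsTransition τ) (i j : I) (h : H) {z : D.OverlapForms i j} (hz : z ∈ D.baseForms i j) :
    Commute (D.trans τ i j h) z := by
  have e := LinearMap.congr_fun (D.transSwap_comp_antipode hτ i j) h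
  rw [show D.trans τ i j h = D.transSwap τ i j (antipode ℂ h) from e.symm]
  exact D.commute_transSwap hτ i j _ hz

/-- The differential of the convolution identity τ_ij * τ_ji = 1. -/
theorem overlapD_trans_mul (hτ : X.IsTransition τ) (i j : I) :
    toConv (D.overlapD i j ∘ₗ (D.trans τ i j).toLinearMap) *
        toConv (D.transSwap τ i j).toLinearMap +
      toConv (D.trans τ i j).toLinearMap *
        toConv (D.overlapD i j ∘ₗ (D.transSwap τ i j).toLinearMap) = 0 := by
  ext h
  have e := congr(D.overlapD i j (ofConv $(D.trans_mul_transSwap hτ i j) h))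
  rw [← toConv_convolve, ofConv_toConv, convolve_repr (ℛ ℂ h), map_sum] at e
  change (toConv _ * toConv _ : WithConv (H →ₗ[ℂ] D.OverlapForms i j)) h +
    (toConv _ * toConv _ : WithConv (H →ₗ[ℂ] D.OverlapForms i j)) h = 0
  rw [(ℛ ℂ h).convMul_apply, (ℛ ℂ h).convMul_apply, ← Finset.sum_add_distrib]
  refine Eq.trans (Finset.sum_congr rfl fun k _ => ?_) (e.trans ?_)
  · exact (D.overlapD_incl_mul i j _ _).symm
  · change D.overlapD i j (algebraMap ℂ _ (counit h)) = 0
    rw [Algebra.algebraMap_eq_smul_one, map_smul, overlapD_one, smul_zero]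

end DifferentialStructure

/-! ### Forms of the shape δ(v) x(h) - o(v) w(h) -/

section FormMap

variable {H V V' Q Q' : Type*} [AddCommGroup H] [Module ℂ H] [AddCommGroup V] [Module ℂ V]
  [AddCommGroup V'] [Module ℂ V'] [Ring Q] [Algebra ℂ Q] [Ring Q'] [Algebra ℂ Q']

/-- The map `v ⊗ h ↦ δ(v) x(h) - o(v) w(h)`, where `o(v)` acts from the side `b`. -/
def formMap (b : Bool) (δ o : V →ₗ[ℂ] Q) (x w : H →ₗ[ℂ] Q) : V ⊗[ℂ] H →ₗ[ℂ] Q :=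
  LinearMap.mul' ℂ Q ∘ₗ TensorProduct.map δ x - TensorProduct.lift ((sideMul b).compl₁₂ o w)

@[simp]
theorem formMap_tmul (b : Bool) (δ o : V →ₗ[ℂ] Q) (x w : H →ₗ[ℂ] Q) (v : V) (h : H) :
    formMap b δ o x w (v ⊗ₜ h) = δ v * x h - sideMul b (o v) (w h) := by
  simp [formMap]

theorem algHom_formMap (F : Q →ₐ[ℂ] Q') (b : Bool) (δ o : V →ₗ[ℂ] Q) (x w : H →ₗ[ℂ] Q)
    (z : V ⊗[ℂ] H) : F (formMap b δ o x w z) =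
      formMap b (F.toLinearMap ∘ₗ δ) (F.toLinearMap ∘ₗ o) (F.toLinearMap ∘ₗ x)
        (F.toLinearMap ∘ₗ w) z := by
  induction z with
  | zero => simp
  | add y z hy hz => simp only [map_add, hy, hz]
  | tmul v h => simp [map_sideMul]

theorem formMap_rTensor (b : Bool) (δ o : V →ₗ[ℂ] Q) (x w : H →ₗ[ℂ] Q) (r : V' →ₗ[ℂ] V)
    (z : V' ⊗[ℂ] H) : formMap b δ o x w (r.rTensor H z) = formMap b (δ ∘ₗ r) (o ∘ₗ r) x w z := by
  induction z with
  | zero => simp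
  | add y z hy hz => simp only [map_add, hy, hz]
  | tmul v h => simp

end FormMap

/-! ### Convolution identities behind the compatibility condition -/

section Convolve

open Coalgebra HopfAlgebra WithConv

variable {H Q C : Type*} [Ring H] [HopfAlgebra ℂ H] [Ring Q] [Algebra ℂ Q] [Ring C] [Algebra ℂ C]

theorem convolve_assoc (f g k : H →ₗ[ℂ] Q) :
    convolve (convolve f g) k = convolve f (convolve g k) :=
  toConv_injective (mul_assoc (toConv f) (toConv g) (toConv k))

theorem sub_convolve (f g k : H →ₗ[ℂ] Q) :
    convolve (f - g) k = convolve f k - convolve g k := by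
  ext h
  simp [convolve_repr (ℛ ℂ h), sub_mul]

theorem convolve_neg (f g : H →ₗ[ℂ] Q) : convolve f (-g) = -convolve f g := by
  ext h
  simp [convolve_repr (ℛ ℂ h)]

theorem neg_convolve (f g : H →ₗ[ℂ] Q) : convolve (-f) g = -convolve f g := by
  ext h
  simp [convolve_repr (ℛ ℂ h)]

theorem convolve_zero_left (g : H →ₗ[ℂ] Q) : convolve 0 g = 0 := by
  ext h
  simp [convolve_repr (ℛ ℂ h)]

theorem eq_zero_of_convolve_algHom (x : H →ₐ[ℂ] Q) {f : H →ₗ[ℂ] Q}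
    (h : convolve f x.toLinearMap = 0) : f = 0 := by
  apply toConv_injective
  apply (isUnit_toConv_algHom x).mul_right_cancel
  rw [← toConv_convolve, ← toConv_convolve, h, convolve_zero_left]

/-- Multiplying by the inverse s of t from the left puts the compatibility condition into the form s
a = d + b s, which is what the change of trivialization produces. -/
theorem toConv_eq_iff {t s : H →ₗ[ℂ] Q} (hts : toConv t * toConv s = 1)
    (hst : toConv s * toConv t = 1) (a b d : H →ₗ[ℂ] Q) :
    toConv a = toConv t * toConv b * toConv s + toConv t * toConv d ↔
      convolve s a - d - convolve b s = 0 := by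
  rw [sub_sub, sub_eq_zero]
  refine Iff.trans ?_ toConv_injective.eq_iff
  change _ ↔ toConv s * toConv a = toConv d + toConv b * toConv s
  constructor
  · intro e
    rw [e, mul_add, ← mul_assoc, ← mul_assoc, ← mul_assoc, hst, one_mul, one_mul, add_comm]
  · intro e
    rw [← one_mul (toConv a), ← hts, mul_assoc, e, mul_add, mul_assoc, add_comm]

/-- The gauge transformation computed abstractly. The Leibniz rule splits δ(c s(h₁)) x(h₂); the part
with δ(c) cancels because the other trivialization uses s * x, and the rest is the defect of
compatibility convolved with x. The commutation hypotheses allow o(c) to be moved to the right end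
when it acts from the right. -/
theorem formMap_sub_formMap_twist (b : Bool) (δ : C →ₗ[ℂ] Q) (o : C →ₐ[ℂ] Q) (s : H →ₐ[ℂ] C)
    (x : H →ₐ[ℂ] Q) (a a' : H →ₗ[ℂ] Q)
    (hδ : ∀ c c', δ (c * c') = δ c * o c' + o c * δ c')
    (hs : ∀ h c, Commute (o (s h)) (o c)) (hsa : ∀ h k, Commute (o (s h)) (a k))
    (hx : ∀ h c, Commute (x h) (o c)) (hδs : ∀ h c, Commute (δ (s h)) (o c)) (c : C) (h : H) :
    formMap b δ o.toLinearMap (convolve (o.comp s).toLinearMap x.toLinearMap)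
        (convolve a' (convolve (o.comp s).toLinearMap x.toLinearMap)) (c ⊗ₜ h) -
      formMap b δ o.toLinearMap x.toLinearMap (convolve a x.toLinearMap)
        (LocallyTrivialQPFB.twist s (c ⊗ₜ h)) =
      sideMul b (o c) (convolve (convolve (o.comp s).toLinearMap a - δ ∘ₗ s.toLinearMap -
        convolve a' (o.comp s).toLinearMap) x.toLinearMap h) := by
  have hcomm : ∀ k l : H, Commute (o (s k)) (convolve a x.toLinearMap l) := by
    intro k l
    rw [convolve_repr (ℛ ℂ l)]
    exact Commute.sum_right _ _ _ fun m _ => (hsa _ _).mul_right (hx _ _).symm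
  have key : formMap b δ o.toLinearMap x.toLinearMap (convolve a x.toLinearMap)
        (LocallyTrivialQPFB.twist s (c ⊗ₜ h)) =
      δ c * convolve (o.comp s).toLinearMap x.toLinearMap h +
      sideMul b (o c) (convolve (δ ∘ₗ s.toLinearMap) x.toLinearMap h) -
      sideMul b (o c) (convolve (o.comp s).toLinearMap (convolve a x.toLinearMap) h) := by
    rw [LocallyTrivialQPFB.twist_tmul _ _ _ (ℛ ℂ h), convolve_repr (ℛ ℂ h),
      convolve_repr (ℛ ℂ h), convolve_repr (ℛ ℂ h) (o.comp s).toLinearMap (convolve _ _),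
      map_sum, map_sum, map_sum, Finset.mul_sum, ← Finset.sum_add_distrib,
      ← Finset.sum_sub_distrib]
    refine Finset.sum_congr rfl fun m _ => ?_
    simp only [formMap_tmul, AlgHom.toLinearMap_apply, AlgHom.comp_apply, LinearMap.comp_apply]
    rw [hδ, map_mul, add_mul, mul_assoc, mul_assoc (o c)]
    congr 1
    · congr 1
      cases b
      · rw [sideMul_false, mul_assoc, (hx _ c).eq, ← mul_assoc, ← mul_assoc, (hδs _ c).eq]
      · rw [sideMul_true]
    · cases b
      · rw [sideMul_false, sideMul_false, ← (hs _ c).eq, (hcomm _ _).eq, ← mul_assoc]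
      · rw [sideMul_true, sideMul_true, mul_assoc]
  rw [key, sub_convolve, sub_convolve, formMap_tmul, convolve_assoc, convolve_assoc,
    LinearMap.sub_apply, LinearMap.sub_apply, map_sub, map_sub, AlgHom.toLinearMap_apply]
  abel

end Convolve

/-! ### Compatibility as agreement of the forms hor_i(dp) over overlaps -/

namespace DifferentialStructure

open Coalgebra HopfAlgebra WithConv

variable {I H B P : Type*} [Ring H] [HopfAlgebra ℂ H] [Ring B] [Algebra ℂ B]
  [Ring P] [Algebra ℂ P] {X : LocallyTrivialQPFB I H B P} (D : DifferentialStructure X)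
  {τ : ∀ i j, H →ₐ[ℂ] X.Overlap i j}

/-- The local connection map `A` as a map to the overlap calculus, for the first index. -/
def leftA (i j : I) (A : H →ₗ[ℂ] (D.ΓB i).carrier) : H →ₗ[ℂ] D.OverlapForms i j :=
  (D.projLeft i j).toLinearMap ∘ₗ (D.inL i).toLinearMap ∘ₗ A

/-- The local connection map `A` as a map to the overlap calculus, for the second index. -/
def rightA (i j : I) (A : H →ₗ[ℂ] (D.ΓB j).carrier) : H →ₗ[ℂ] D.OverlapForms i j :=
  (D.projRight i j).toLinearMap ∘ₗ (D.inL j).toLinearMap ∘ₗ A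

theorem leftA_mem (i j : I) (A : H →ₗ[ℂ] (D.ΓB i).carrier) (h : H) :
    D.leftA i j A h ∈ D.baseForms i j := D.projLeft_inL_mem i j _

theorem rightA_mem (i j : I) (A : H →ₗ[ℂ] (D.ΓB j).carrier) (h : H) :
    D.rightA i j A h ∈ D.baseForms i j := D.projRight_inL_mem i j _

theorem isCompatible_iff_conv (τ : ∀ i j, H →ₐ[ℂ] X.Overlap i j)
    (A : ∀ i, H →ₗ[ℂ] (D.ΓB i).carrier) : D.IsCompatible τ A ↔ ∀ i j,
      toConv (D.leftA i j (A i)) =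
        toConv (D.trans τ i j).toLinearMap * toConv (D.rightA i j (A j)) *
          toConv (D.transSwap τ i j).toLinearMap +
        toConv (D.trans τ i j).toLinearMap *
          toConv (D.overlapD i j ∘ₗ (D.transSwap τ i j).toLinearMap) :=
  forall₂_congr fun _ _ => toConv_injective.eq_iff.symm

theorem overlapD_incl_mul' (i j : I) (x y : X.Overlap i j) :
    D.overlapD i j (D.overlapIncl i j (x * y)) =
      D.overlapD i j (D.overlapIncl i j x) * D.overlapIncl i j y +
        D.overlapIncl i j x * D.overlapD i j (D.overlapIncl i j y) := by
  rw [map_mul, overlapD_incl_mul]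

/-- Differentiate the relation that τ_ji(h) and c commute; the terms containing dc cancel because
τ_ji(h) commutes with dc as well. -/
theorem commute_overlapD_transSwap (hτ : X.IsTransition τ) (i j : I) (h : H)
    (c : X.Overlap i j) :
    Commute (D.overlapD i j (D.transSwap τ i j h)) (D.overlapIncl i j c) := by
  have e := congr(D.overlapD i j $((D.commute_transSwap hτ i j h (D.overlapIncl_mem i j c)).eq))
  have c' := (D.commute_transSwap hτ i j h (D.overlapD_incl_mem i j c)).eq
  simp only [transSwap, AlgHom.comp_apply (D.overlapIncl i j)] at e c' ⊢
  rw [overlapD_incl_mul, overlapD_incl_mul, c', add_comm] at e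
  exact add_left_cancel e

/-- The form `hor_i(d z)`, for the local connection map `A` of a left (`b = true`) or right
(`b = false`) connection. -/
def connForm (b : Bool) (i : I) (A : H →ₗ[ℂ] (D.ΓB i).carrier) :
    X.Loc i ⊗[ℂ] H →ₗ[ℂ] D.Local i :=
  formMap b ((D.inL i).toLinearMap ∘ₗ (D.ΓB i).dB)
    ((D.inL i).toLinearMap ∘ₗ (D.ΓB i).incl.toLinearMap) (D.inH i).toLinearMap
    (convolve ((D.inL i).toLinearMap ∘ₗ A) (D.inH i).toLinearMap)

/-- The counterpart of `connForm` over an overlap. -/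
def overlapForm (b : Bool) (i j : I) (x a : H →ₗ[ℂ] D.OverlapForms i j) :
    X.Overlap i j ⊗[ℂ] H →ₗ[ℂ] D.OverlapForms i j :=
  formMap b (D.overlapD i j ∘ₗ (D.overlapIncl i j).toLinearMap) (D.overlapIncl i j).toLinearMap x
    (convolve a x)

theorem projLeft_connForm (b : Bool) (i j : I) (A : H →ₗ[ℂ] (D.ΓB i).carrier)
    (z : X.Loc i ⊗[ℂ] H) : D.projLeft i j (D.connForm b i A z) =
      D.overlapForm b i j (D.leftH i j).toLinearMap (D.leftA i j A)
        ((X.resLeft i j).toLinearMap.rTensor H z) := by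
  rw [overlapForm, formMap_rTensor, connForm, algHom_formMap, toConv_comp_algHom]
  congr 1
  · congr 1
    · exact LinearMap.ext (D.projLeft_dB i j)
    · exact LinearMap.ext (D.projLeft_incl i j)

theorem projRight_connForm (b : Bool) (i j : I) (A : H →ₗ[ℂ] (D.ΓB j).carrier)
    (z : X.Loc j ⊗[ℂ] H) : D.projRight i j (D.connForm b j A z) =
      D.overlapForm b i j (D.rightH i j).toLinearMap (D.rightA i j A)
        ((X.resRight i j).toLinearMap.rTensor H z) := by
  rw [overlapForm, formMap_rTensor, connForm, algHom_formMap, toConv_comp_algHom]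
  congr 1
  · congr 1
    · exact LinearMap.ext (D.projRight_dB i j)
    · exact LinearMap.ext (D.projRight_incl i j)

theorem overlapForm_twist (hτ : X.IsTransition τ) (b : Bool) (i j : I)
    (a a' : H →ₗ[ℂ] D.OverlapForms i j) (ha : ∀ h, a h ∈ D.baseForms i j)
    (c : X.Overlap i j) (h : H) :
    D.overlapForm b i j (D.rightH i j).toLinearMap a' (c ⊗ₜ h) -
      D.overlapForm b i j (D.leftH i j).toLinearMap a
        (LocallyTrivialQPFB.twist ((X.overlapSwap i j).comp (τ j i)) (c ⊗ₜ h)) =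
      sideMul b (D.overlapIncl i j c)
        (convolve (convolve (D.transSwap τ i j).toLinearMap a -
          D.overlapD i j ∘ₗ (D.transSwap τ i j).toLinearMap -
          convolve a' (D.transSwap τ i j).toLinearMap) (D.leftH i j).toLinearMap h) := by
  have e : (D.rightH i j).toLinearMap =
      convolve (D.transSwap τ i j).toLinearMap (D.leftH i j).toLinearMap :=
    toConv_injective (D.rightH_eq hτ i j)
  rw [e]
  exact formMap_sub_formMap_twist b (D.overlapD i j ∘ₗ (D.overlapIncl i j).toLinearMap)
    (D.overlapIncl i j) ((X.overlapSwap i j).comp (τ j i)) (D.leftH i j) a a'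
    (D.overlapD_incl_mul' i j)
    (fun k c => D.commute_transSwap hτ i j k (D.overlapIncl_mem i j c))
    (fun k l => D.commute_transSwap hτ i j k (ha l))
    (fun k c => D.commute_leftH k (D.overlapIncl_mem i j c))
    (D.commute_overlapD_transSwap hτ i j) c h

theorem isCompatible_iff_conv' (hτ : X.IsTransition τ) (A : ∀ i, H →ₗ[ℂ] (D.ΓB i).carrier) :
    D.IsCompatible τ A ↔ ∀ i j,
      convolve (D.transSwap τ i j).toLinearMap (D.leftA i j (A i)) -
        D.overlapD i j ∘ₗ (D.transSwap τ i j).toLinearMap -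
        convolve (D.rightA i j (A j)) (D.transSwap τ i j).toLinearMap = 0 := by
  rw [isCompatible_iff_conv]
  refine forall₂_congr fun i j => ?_
  exact toConv_eq_iff (D.trans_mul_transSwap hτ i j) (D.transSwap_mul_trans hτ i j) _ _ _

/-- By `overlapForm_twist` the difference of the two forms is the defect of compatibility convolved
with the image of H, times a coefficient. Conversely, coefficient 1 suffices, since that image is
convolution-invertible. The criterion holds for either side b, so left and right connections share
one compatibility condition. -/
theorem isCompatible_iff (hτ : X.IsTransition τ) (b : Bool)
    (A : ∀ i, H →ₗ[ℂ] (D.ΓB i).carrier) : D.IsCompatible τ A ↔ ∀ i j p,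
      D.projLeft i j (D.connForm b i (A i) (X.χ i p)) =
        D.projRight i j (D.connForm b j (A j) (X.χ j p)) := by
  rw [D.isCompatible_iff_conv' hτ]
  refine forall₂_congr fun i j => ?_
  constructor
  · intro e p
    rw [projLeft_connForm, projRight_connForm, hτ]
    generalize (X.resRight i j).toLinearMap.rTensor H (X.χ j p) = z
    induction z with
    | zero => simp
    | add x y hx hy => simp only [map_add, hx, hy]
    | tmul c h =>
      have h0 := D.overlapForm_twist hτ b i j (D.leftA i j (A i)) (D.rightA i j (A j))
        (D.leftA_mem i j _) c h
      rw [e, convolve_zero_left, LinearMap.zero_apply, map_zero] at h0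
      exact (sub_eq_zero.1 h0).symm
  · intro e
    refine eq_zero_of_convolve_algHom (D.leftH i j) (LinearMap.ext fun h => ?_)
    obtain ⟨p, hp⟩ := X.χ_surjective j (1 ⊗ₜ h)
    have ep := e p
    rw [projLeft_connForm, projRight_connForm, hτ, hp, LinearMap.rTensor_tmul,
      AlgHom.toLinearMap_apply, map_one] at ep
    have h0 := D.overlapForm_twist hτ b i j (D.leftA i j (A i)) (D.rightA i j (A j))
        (D.leftA_mem i j _) 1 h
    rw [ep, sub_self, map_one, one_sideMul] at h0
    exact h0.symm

/-! ### The family `-A_i ∘ S` -/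

/-- Compose the condition with S. All the factors commute, so S reverses the products and exchanges
τ_ij with τ_ji: τ_ij * A_j * τ_ji becomes τ_ij * (A_j∘S) * τ_ji, while τ_ij * dτ_ji becomes dτ_ij *
τ_ji = -τ_ij * dτ_ji. Surjectivity of S gives the converse. -/
theorem isCompatible_negAntipode (hS : Function.Bijective (antipode ℂ : H →ₗ[ℂ] H))
    (hτ : X.IsTransition τ) (A : ∀ i, H →ₗ[ℂ] (D.ΓB i).carrier) :
    D.IsCompatible τ A ↔ D.IsCompatible τ (D.negAntipode A) := by
  refine forall₂_congr fun i j => ?_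
  change D.leftA i j (A i) = convolve (convolve (D.trans τ i j).toLinearMap
      (D.rightA i j (A j))) (D.transSwap τ i j).toLinearMap +
        convolve (D.trans τ i j).toLinearMap
          (D.overlapD i j ∘ₗ (D.transSwap τ i j).toLinearMap) ↔
    D.leftA i j (-(A i ∘ₗ antipode ℂ)) = convolve (convolve (D.trans τ i j).toLinearMap
      (D.rightA i j (-(A j ∘ₗ antipode ℂ)))) (D.transSwap τ i j).toLinearMap +
        convolve (D.trans τ i j).toLinearMap
          (D.overlapD i j ∘ₗ (D.transSwap τ i j).toLinearMap)
  have hneg₁ : D.leftA i j (-(A i ∘ₗ antipode ℂ)) = -(D.leftA i j (A i) ∘ₗ antipode ℂ) := by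
    ext h; simp [leftA]
  have hneg₂ : D.rightA i j (-(A j ∘ₗ antipode ℂ)) = -(D.rightA i j (A j) ∘ₗ antipode ℂ) := by
    ext h; simp [rightA]
  have h₁ : convolve (convolve (D.trans τ i j).toLinearMap (D.rightA i j (A j)))
      (D.transSwap τ i j).toLinearMap ∘ₗ antipode ℂ =
      convolve (convolve (D.trans τ i j).toLinearMap (D.rightA i j (A j) ∘ₗ antipode ℂ))
        (D.transSwap τ i j).toLinearMap := by
    have hmem : ∀ x, convolve (D.trans τ i j).toLinearMap (D.rightA i j (A j)) x ∈
        D.baseForms i j := by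
      intro x
      rw [convolve_repr (ℛ ℂ x)]
      exact sum_mem fun m _ => mul_mem (D.trans_mem i j _) (D.rightA_mem i j _ _)
    rw [convolve_comp_antipode fun x y => (D.commute_transSwap hτ i j y (hmem x)).symm,
      convolve_comp_antipode fun x y => D.commute_trans hτ i j x (D.rightA_mem i j _ y),
      D.trans_comp_antipode hτ, D.transSwap_comp_antipode hτ]
    apply toConv_injective
    simp only [toConv_convolve, mul_assoc]
  have h₂ : convolve (D.trans τ i j).toLinearMap
        (D.overlapD i j ∘ₗ (D.transSwap τ i j).toLinearMap) ∘ₗ antipode ℂ =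
      -convolve (D.trans τ i j).toLinearMap
        (D.overlapD i j ∘ₗ (D.transSwap τ i j).toLinearMap) := by
    rw [convolve_comp_antipode fun x y => D.commute_trans hτ i j x (D.overlapD_incl_mem i j _),
      LinearMap.comp_assoc, D.trans_comp_antipode hτ, D.transSwap_comp_antipode hτ]
    exact toConv_injective (eq_neg_of_add_eq_zero_left (D.overlapD_trans_mul hτ i j))
  rw [hneg₁, hneg₂, convolve_neg, neg_convolve, ← h₁, ← neg_inj (a := -(_ ∘ₗ _)), neg_neg,
    neg_add, neg_neg, ← h₂, ← LinearMap.add_comp]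
  constructor
  · intro e
    rw [← e]
  · intro e
    ext h
    obtain ⟨k, rfl⟩ := hS.2 h
    exact LinearMap.congr_fun e k

theorem isNormalized_negAntipode (hS : Function.Bijective (antipode ℂ : H →ₗ[ℂ] H))
    (A : ∀ i, H →ₗ[ℂ] (D.ΓB i).carrier) :
    D.IsNormalized A ↔ D.IsNormalized (D.negAntipode A) := by
  refine and_congr (forall_congr' fun i => ?_) (forall_congr' fun i => ?_)
  · rw [hS.2.forall]
    exact forall_congr' fun h => neg_mem_iff.symm
  · simp [negAntipode]

theorem leftKernel_iff_rightKernel (hS : Function.Bijective (antipode ℂ : H →ₗ[ℂ] H))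
    (A : ∀ i, H →ₗ[ℂ] (D.ΓB i).carrier) :
    D.LeftKernel hS A ↔ D.RightKernel hS (D.negAntipode A) := by
  refine forall_congr' fun i => ?_
  rw [Submodule.map_le_iff_le_comap]
  refine forall₂_congr fun h _ => ?_
  simp [negAntipode]

theorem negAntipode_injective (hS : Function.Bijective (antipode ℂ : H →ₗ[ℂ] H)) :
    Function.Injective D.negAntipode := by
  intro A A' e
  ext i h
  obtain ⟨k, rfl⟩ := hS.2 h
  exact neg_injective (LinearMap.congr_fun (congr_fun e i) k)

theorem exists_negAntipode_eq (hS : Function.Bijective (antipode ℂ : H →ₗ[ℂ] H))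
    (A : ∀ i, H →ₗ[ℂ] (D.ΓB i).carrier) : ∃ A', D.negAntipode A' = A := by
  refine ⟨fun i => -(A i ∘ₗ antipodeInv hS), ?_⟩
  ext i h
  simp [negAntipode]

end DifferentialStructure

/-! ### Factorization through a linear map, and the map η in left and right form -/

theorem exists_comp_eq_of_ker_le {U V W : Type*} [AddCommGroup U] [Module ℂ U] [AddCommGroup V]
    [Module ℂ V] [AddCommGroup W] [Module ℂ W] (f : U →ₗ[ℂ] V) (f' : U →ₗ[ℂ] W)
    (h : LinearMap.ker f ≤ LinearMap.ker f') : ∃ g : V →ₗ[ℂ] W, g ∘ₗ f = f' := by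
  obtain ⟨s, hs⟩ := f.rangeRestrict.exists_rightInverse_of_surjective
    (LinearMap.range_rangeRestrict _)
  obtain ⟨g, hg⟩ := LinearMap.exists_extend (f' ∘ₗ s)
  refine ⟨g, LinearMap.ext fun u => ?_⟩
  have e₁ : g (f u) = f' (s (f.rangeRestrict u)) := LinearMap.congr_fun hg (f.rangeRestrict u)
  have e₂ : f (s (f.rangeRestrict u)) = f u :=
    congr_arg Subtype.val (LinearMap.congr_fun hs (f.rangeRestrict u))
  rw [LinearMap.comp_apply, e₁, ← sub_eq_zero, ← map_sub]
  exact h (by rw [LinearMap.mem_ker, map_sub, e₂, sub_self])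

namespace RightCovariantCalculus

open Coalgebra HopfAlgebra

variable {H : Type*} [Ring H] [HopfAlgebra ℂ H] (Λ : RightCovariantCalculus H)
  (hS : Function.Bijective (antipode ℂ : H →ₗ[ℂ] H))

/-- The map `h ↦ ∑ σ(h₂) d h₁`, where `σ(h₂)` acts from the side `b`. -/
def etaSide (b : Bool) (σ : H →ₗ[ℂ] H) : H →ₗ[ℂ] Λ.carrier :=
  TensorProduct.lift ((sideMul b).compl₁₂ (Λ.incl.toLinearMap ∘ₗ σ) Λ.dB) ∘ₗ
    (TensorProduct.comm ℂ H H).toLinearMap ∘ₗ comul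

theorem etaSide_repr (b : Bool) (σ : H →ₗ[ℂ] H) {h : H} {ι : Type*} (r : Repr ℂ h ι) :
    Λ.etaSide b σ h = ∑ m ∈ r.index, sideMul b (Λ.incl (σ (r.right m))) (Λ.dB (r.left m)) := by
  simp [etaSide, ← r.eq]

variable (H) in
/-- The map `σ` for which `etaSide b σ` is the map `η` of the calculus, up to the antipode. -/
def sideAntipode (b : Bool) : H →ₗ[ℂ] H := if b then antipodeInv hS else antipode ℂ

theorem counit_sideAntipode (b : Bool) (h : H) :
    counit (R := ℂ) (sideAntipode H hS b h) = counit (R := ℂ) h := by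
  cases b
  · exact counit_antipode h
  · exact counit_antipodeInv hS h

theorem etaSide_true : Λ.etaSide true (sideAntipode H hS true) = Λ.eta hS := by
  ext h
  rw [Λ.etaSide_repr _ _ (ℛ ℂ h)]
  simp [eta, sideAntipode, ← (ℛ ℂ h).eq]

/-- Differentiating ∑ h₁S(h₂) = ε(h) gives ∑ dh₁ S(h₂) = -∑ h₁ dS(h₂), and the last sum is η(S(h))
because S reverses the coproduct. This is the source of S⁻¹(R) in the condition for right
connections. -/
theorem etaSide_false (h : H) :
    Λ.etaSide false (sideAntipode H hS false) h = -Λ.eta hS (antipode ℂ h) := by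
  have e := LinearMap.congr_fun (comul_comp_antipode (H := H)) h
  simp only [LinearMap.comp_apply] at e
  rw [Λ.etaSide_repr _ _ (ℛ ℂ h), eq_neg_iff_add_eq_zero]
  have e₁ : Λ.eta hS (antipode ℂ h) = ∑ m ∈ (ℛ ℂ h).index,
      Λ.incl ((ℛ ℂ h).left m) * Λ.dB (antipode ℂ ((ℛ ℂ h).right m)) := by
    simp [eta, e, ← (ℛ ℂ h).eq]
  rw [e₁, ← Finset.sum_add_distrib]
  have e₂ := congr(Λ.dB $(sum_mul_antipode_eq_algebraMap_counit (ℛ ℂ h)))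
  rw [map_sum, Algebra.algebraMap_eq_smul_one, map_smul, dB_one, smul_zero] at e₂
  rw [← e₂]
  refine Finset.sum_congr rfl fun m _ => ?_
  rw [dB_mul, sideMul_false]
  rfl

theorem etaSide_one (b : Bool) : Λ.etaSide b (sideAntipode H hS b) 1 = 0 := by
  simp [etaSide, Bialgebra.comul_one, Algebra.TensorProduct.one_def]

end RightCovariantCalculus

/-! ### From connections to local connection maps -/

namespace DifferentialStructure

open Coalgebra HopfAlgebra RightCovariantCalculus

variable {I H B P : Type*} [Ring H] [HopfAlgebra ℂ H] [Ring B] [Algebra ℂ B]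
  [Ring P] [Algebra ℂ P] {X : LocallyTrivialQPFB I H B P} (D : DifferentialStructure X)
  (hS : Function.Bijective (antipode ℂ : H →ₗ[ℂ] H))

/-- The kernel condition of left (`b = true`) or right (`b = false`) connections. -/
def SideKernel (b : Bool) (A : ∀ i, H →ₗ[ℂ] (D.ΓB i).carrier) : Prop :=
  ∀ i h, D.ΓH.etaSide b (sideAntipode H hS b) h = 0 → counit (R := ℂ) h = 0 → A i h = 0

theorem leftKernel_iff (A : ∀ i, H →ₗ[ℂ] (D.ΓB i).carrier) :
    D.LeftKernel hS A ↔ D.SideKernel hS true A := by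
  refine forall_congr' fun i => forall_congr' fun h => ?_
  rw [etaSide_true, rightIdeal, Submodule.mem_inf, LinearMap.mem_ker, LinearMap.mem_ker,
    LinearMap.mem_ker, and_imp]

theorem rightKernel_iff (A : ∀ i, H →ₗ[ℂ] (D.ΓB i).carrier) :
    D.RightKernel hS A ↔ D.SideKernel hS false A := by
  refine forall_congr' fun i => ?_
  rw [Submodule.map_le_iff_le_comap]
  change (∀ h, _) ↔ _
  rw [hS.2.forall]
  refine forall_congr' fun h => ?_
  rw [etaSide_false, rightIdeal, Submodule.mem_inf, LinearMap.mem_ker, LinearMap.mem_ker,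
    Submodule.mem_comap, LinearMap.mem_ker, antipodeInv_antipode, counit_antipode, and_imp,
    neg_eq_zero]

/-- Left (`b = true`) or right (`b = false`) connections. -/
structure IsConnection (b : Bool) (hor : D.forms →ₗ[ℂ] D.forms) : Prop
    extends D.IsProjection hor where
  map_sideAct : ∀ p γ, hor (D.sideAct b p γ) = D.sideAct b p (hor γ)

theorem LeftConnection.isConnection (ω : D.LeftConnection) : D.IsConnection true ω.hor :=
  ⟨ω.isProjection, ω.map_leftMul⟩

theorem RightConnection.isConnection (ω : D.RightConnection) : D.IsConnection false ω.hor :=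
  ⟨ω.isProjection, ω.map_rightMul⟩

theorem mem_horForms {γ : D.forms} : γ ∈ D.horForms ↔
    ∀ i, D.χc i γ ∈ horizontal (D.ΓB i) D.ΓH.toDifferentialCalculus := by
  simp [horForms]

theorem χc_dP_liftH' (i : I) (h : H) :
    D.χc i (D.dP (liftH X i h)) = D.inR i (D.ΓH.dB h) := D.χc_dP_liftH i h

variable {D}

theorem IsProjection.apply_of_mem {hor : D.forms →ₗ[ℂ] D.forms} (h : D.IsProjection hor)
    {γ : D.forms} (hγ : γ ∈ D.horForms) : hor γ = γ := by
  rw [← h.range_eq] at hγ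
  obtain ⟨δ, rfl⟩ := hγ
  exact h.idem δ

theorem IsProjection.apply_mem {hor : D.forms →ₗ[ℂ] D.forms} (h : D.IsProjection hor)
    (γ : D.forms) : hor γ ∈ D.horForms := by
  rw [← h.range_eq]
  exact ⟨γ, rfl⟩

/-- A projection that respects the kernels of the `χ_i` induces maps of the local calculi. -/
theorem IsProjection.exists_local {hor : D.forms →ₗ[ℂ] D.forms} (h : D.IsProjection hor) (i : I) :
    ∃ g : D.Local i →ₗ[ℂ] D.Local i, ∀ γ, g (D.χc i γ) = D.χc i (hor γ) := by
  obtain ⟨g, hg⟩ := exists_comp_eq_of_ker_le (D.χc i) (D.χc i ∘ₗ hor) fun γ hγ => h.ker_le i γ hγ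
  exact ⟨g, LinearMap.congr_fun hg⟩

variable (D) in
theorem localCoact_inR_dB (i : I) (h : H) : D.localCoact i (D.inR i (D.ΓH.dB h)) =
    ((D.inR i).toLinearMap ∘ₗ D.ΓH.dB).rTensor H (comul (R := ℂ) h) := by
  have e := D.localCoact_mul i 1 (D.ΓH.dB h)
  rw [map_one, one_mul, coactR_dB, ← Algebra.TensorProduct.one_def, one_mul] at e
  exact e

/-- By covariance the coaction of hor_i(dk) is ∑ hor_i(dk₁) ⊗ k₂. This form is horizontal, hence is
recovered from its coaction through id ⊗ ε, which sends hor_i(dk₁) to -A_i(k₁). -/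
theorem IsProjection.local_inR_dB {hor : D.forms →ₗ[ℂ] D.forms} (h : D.IsProjection hor) {i : I}
    {g : D.Local i →ₗ[ℂ] D.Local i} (hg : ∀ γ, g (D.χc i γ) = D.χc i (hor γ)) :
    g ∘ₗ (D.inR i).toLinearMap ∘ₗ D.ΓH.dB =
      -convolve ((D.inL i).toLinearMap ∘ₗ D.localMap hor i) (D.inH i).toLinearMap := by
  have hW : ∀ k, g (D.inR i (D.ΓH.dB k)) = D.χc i (hor (D.dP (liftH X i k))) := by
    intro k
    rw [← hg, D.χc_dP_liftH']
  have hA : D.localMap hor i = -(D.idCounit i ∘ₗ g ∘ₗ (D.inR i).toLinearMap ∘ₗ D.ΓH.dB) := by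
    ext k
    simp [localMap, hW]
  ext k
  obtain ⟨t, ht, ht'⟩ := h.covariant (D.dP (liftH X i k))
  have e : (g ∘ₗ (D.inR i).toLinearMap ∘ₗ D.ΓH.dB).rTensor H (comul (R := ℂ) k) =
      D.localCoact i (g (D.inR i (D.ΓH.dB k))) := by
    have e₁ := ht i
    have e₂ := ht' i
    rw [← LinearMap.rTensor_comp_apply, show D.χc i ∘ₗ hor = g ∘ₗ D.χc i from
      LinearMap.ext fun γ => (hg γ).symm, LinearMap.rTensor_comp_apply, e₁, χc_dP_liftH, ← hW] at e₂
    refine Eq.trans ?_ e₂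
    rw [LinearMap.rTensor_comp_apply]
    congr 1
    exact (D.localCoact_inR_dB i k).symm
  have hm : g (D.inR i (D.ΓH.dB k)) ∈ horizontal (D.ΓB i) D.ΓH.toDifferentialCalculus := by
    rw [hW]
    exact D.mem_horForms.1 (h.apply_mem _) i
  have e₃ := D.lift_idCounit_localCoact i hm
  rw [← e, ← (ℛ ℂ k).eq] at e₃
  rw [LinearMap.neg_apply, convolve_repr (ℛ ℂ k), hA]
  refine e₃.symm.trans ?_
  simp

theorem IsConnection.local_sideMul {b : Bool} {hor : D.forms →ₗ[ℂ] D.forms}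
    (h : D.IsConnection b hor) {i : I} {g : D.Local i →ₗ[ℂ] D.Local i}
    (hg : ∀ γ, g (D.χc i γ) = D.χc i (hor γ)) (x : X.Loc i ⊗[ℂ] H) (γ : D.forms) :
    g (sideMul b (D.inZero i x) (D.χc i γ)) = sideMul b (D.inZero i x) (g (D.χc i γ)) := by
  obtain ⟨p, rfl⟩ := X.χ_surjective i x
  rw [← χc_sideAct, hg, hg, h.map_sideAct, χc_sideAct]

variable (D) in
theorem sideMul_inH_inL (b : Bool) (i : I) (h : H) (γ : (D.ΓB i).carrier) :
    sideMul b (D.inH i h) (D.inL i γ) = D.inL i γ * D.inH i h := by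
  cases b
  · rfl
  · exact (commute_inRight₀_inLeft _ _ h γ).eq

variable (D) in
theorem sideMul_inL_incl_inR (b : Bool) (i : I) (a : X.Loc i) (ω : D.ΓH.carrier) :
    sideMul b (D.inL i ((D.ΓB i).incl a)) (D.inR i ω) =
      D.inL i ((D.ΓB i).incl a) * D.inR i ω := by
  cases b
  · exact (commute_inRight_incl _ _ ω a).eq
  · rfl

theorem IsConnection.local_dLoc {b : Bool} {hor : D.forms →ₗ[ℂ] D.forms}
    (h : D.IsConnection b hor) {i : I} {g : D.Local i →ₗ[ℂ] D.Local i}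
    (hg : ∀ γ, g (D.χc i γ) = D.χc i (hor γ)) (z : X.Loc i ⊗[ℂ] H) :
    g (D.dLoc i z) = D.connForm b i (D.localMap hor i) z := by
  induction z with
  | zero => simp
  | add x y hx hy => simp only [map_add, hx, hy]
  | tmul a k =>
    obtain ⟨c, hc⟩ := Ideal.Quotient.mk_surjective a
    have hd : ∀ j, D.χc j (D.dP (X.ι c)) = D.inL j ((D.ΓB j).dB (Ideal.Quotient.mk _ c)) := by
      intro j
      rw [χc_dP, X.χ_ι, dLoc_tmul, dB_one, map_one, map_zero, mul_one, mul_zero, add_zero]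
    -- Horizontality is a condition over all patches at once; this is why a is lifted to an element
    -- c of the base.
    have hfix : hor (D.dP (X.ι c)) = D.dP (X.ι c) :=
      h.apply_of_mem (D.mem_horForms.2 fun j => by rw [hd]; exact D.inL_mem_horizontal j _)
    have e₁ := h.local_sideMul hg (1 ⊗ₜ k) (D.dP (X.ι c))
    rw [hg, hfix, hd, hc, skewIncl_tmul, map_one, map_one, one_mul, sideMul_inH_inL] at e₁
    have e₂ := h.local_sideMul hg (a ⊗ₜ 1) (D.dP (liftH X i k))
    have e₃ : g (D.inR i (D.ΓH.dB k)) =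
        -convolve ((D.inL i).toLinearMap ∘ₗ D.localMap hor i) (D.inH i).toLinearMap k :=
      LinearMap.congr_fun (h.local_inR_dB hg) k
    rw [D.χc_dP_liftH', skewIncl_tmul, map_one, mul_one, e₃, sideMul_inL_incl_inR, map_neg] at e₂
    rw [dLoc_tmul, map_add, e₁, e₂, ← sub_eq_add_neg, connForm, formMap_tmul]
    rfl

variable (D) in
/-- Maps of the local calculus agree on one-forms if they agree on the forms `x d y`. -/
theorem eqOn_one_forms (b : Bool) (i : I) {V : Type*} [AddCommGroup V] [Module ℂ V]
    {f f' : D.Local i →ₗ[ℂ] V} (h : ∀ p q, f (sideMul b (D.inZero i (X.χ i p))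
      (D.dLoc i (X.χ i q))) = f' (sideMul b (D.inZero i (X.χ i p)) (D.dLoc i (X.χ i q))))
    {y : D.ΓP.carrier} (hy : y ∈ D.ΓP.deg 1) : f (D.χΓ i y) = f' (D.χΓ i y) := by
  have hle : D.ΓP.deg 1 ≤ LinearMap.eqLocus (f ∘ₗ (D.χΓ i).toLinearMap)
      (f' ∘ₗ (D.χΓ i).toLinearMap) := by
    refine (D.ΓP.deg_one_le_span b).trans (Submodule.span_le.2 ?_)
    rintro _ ⟨p, q, rfl⟩
    change f (D.χΓ i _) = f' (D.χΓ i _)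
    rw [map_sideMul, D.χΓ_incl, χΓ_dB]
    exact h p q
  exact hle hy

/-- A connection is determined by its local connection maps. -/
theorem IsConnection.eq_of_localMap_eq {b : Bool} {hor hor' : D.forms →ₗ[ℂ] D.forms}
    (h : D.IsConnection b hor) (h' : D.IsConnection b hor')
    (e : D.localMap hor = D.localMap hor') : hor = hor' := by
  refine LinearMap.ext fun γ => D.forms_ext fun i => ?_
  obtain ⟨g, hg⟩ := h.exists_local i
  obtain ⟨g', hg'⟩ := h'.exists_local i
  obtain ⟨y, hy, hγ⟩ := D.exists_lift γ i
  rw [← hg, ← hg', ← hγ]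
  refine D.eqOn_one_forms b i (fun p q => ?_) hy
  rw [← χc_dP, h.local_sideMul hg, h'.local_sideMul hg', χc_dP, h.local_dLoc hg,
    h'.local_dLoc hg', e]

/-- In total degree one, id ⊗ ε kills the part with a one-form of H and leaves one-forms of B_i. -/
theorem IsProjection.localMap_mem {hor : D.forms →ₗ[ℂ] D.forms} (i : I) (k : H) :
    D.localMap hor i k ∈ (D.ΓB i).deg 1 := by
  have key : ∀ w : D.Local i, D.idCounit i (skewProjOne _ _ w) ∈ (D.ΓB i).deg 1 := by
    intro w
    induction w using skew_induction with
    | hadd x y hx hy => rw [map_add, map_add]; exact add_mem hx hy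
    | hmul γ ω =>
      rw [skewProjOne_mul_inRight, map_add, idCounit_mul, idCounit_mul,
        counitΓ_of_mem _ (proj_mem _ _ _), zero_smul, zero_add]
      exact Submodule.smul_mem _ _ (proj_mem _ _ _)
  obtain ⟨y, hy, e⟩ := D.exists_lift (hor (D.dP (liftH X i k))) i
  have e' : D.localMap hor i k = -D.idCounit i (D.χc i (hor (D.dP (liftH X i k)))) := rfl
  rw [e', ← e, ← D.ΓP.proj_of_mem hy, (D.χΓ_proj i y).2]
  exact neg_mem (key _)

theorem IsProjection.localMap_one {hor : D.forms →ₗ[ℂ] D.forms} (h : D.IsProjection hor) (i : I) :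
    D.localMap hor i 1 = 0 := by
  rw [D.localMap_eq h i 1 0, map_zero, map_zero, map_zero, neg_zero]
  rw [map_zero, map_one, D.ΓH.d_one, map_zero]

/-- The forms over the patches i and j are components of the single element hor(dp) of the
completion, so they agree over the overlap. -/
theorem IsConnection.isCompatible {τ : ∀ i j, H →ₐ[ℂ] X.Overlap i j} (hτ : X.IsTransition τ)
    {b : Bool} {hor : D.forms →ₗ[ℂ] D.forms} (h : D.IsConnection b hor) :
    D.IsCompatible τ (D.localMap hor) := by
  rw [D.isCompatible_iff hτ b]
  intro i j p
  have e : ∀ i, D.connForm b i (D.localMap hor i) (X.χ i p) = D.χc i (hor (D.dP p)) := by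
    intro i
    obtain ⟨g, hg⟩ := h.exists_local i
    rw [← h.local_dLoc hg, ← hg, χc_dP]
  obtain ⟨y, _, hi, hj⟩ := D.exists_common_lift (hor (D.dP p)) i j
  rw [e, e, ← hi, ← hj, projLeft_χΓ, projRight_χΓ]

/-- Apply (id ⊗ ε) hor_i to 1 ⊗ ∑ σ(k₂) dk₁ = 0. Module linearity extracts σ(k₂), the counit turns
it into ε(k₂), and -A_i(k) remains. -/
theorem IsConnection.sideKernel {b : Bool} {hor : D.forms →ₗ[ℂ] D.forms}
    (h : D.IsConnection b hor) : D.SideKernel hS b (D.localMap hor) := by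
  intro i k hk _
  obtain ⟨g, hg⟩ := h.exists_local i
  have hw : ∀ l, g (D.inR i (D.ΓH.dB l)) ∈ horizontal (D.ΓB i) D.ΓH.toDifferentialCalculus := by
    intro l
    rw [← D.χc_dP_liftH', hg]
    exact D.mem_horForms.1 (h.apply_mem _) i
  have hA : ∀ l, D.idCounit i (g (D.inR i (D.ΓH.dB l))) = -D.localMap hor i l := by
    intro l
    rw [← D.χc_dP_liftH', hg]
    exact (neg_neg _).symm
  have hs : ∀ l m, g (sideMul b (D.inH i l) (D.inR i (D.ΓH.dB m))) =
      sideMul b (D.inH i l) (g (D.inR i (D.ΓH.dB m))) := by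
    intro l m
    have e := h.local_sideMul hg (1 ⊗ₜ l) (D.dP (liftH X i m))
    rw [skewIncl_tmul, map_one, map_one, one_mul, D.χc_dP_liftH'] at e
    exact e
  have e := congr(D.idCounit i (g (D.inR i $hk)))
  rw [map_zero, map_zero, map_zero, etaSide_repr _ _ _ (ℛ ℂ k), map_sum, map_sum, map_sum] at e
  simp only [map_sideMul, inRight_incl, hs, D.idCounit_sideMul_inH b i _ (hw _), hA,
    counit_sideAntipode, smul_neg, Finset.sum_neg_distrib, neg_eq_zero, ← map_smul,
    ← map_sum] at e
  rw [sum_counit_right_smul] at e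
  exact e

end DifferentialStructure

/-! ### Untwisting the coaction of Γ(H) -/

theorem sideMul_tmul {A A' : Type*} [Ring A] [Algebra ℂ A] [Ring A'] [Algebra ℂ A'] (b : Bool)
    (x y : A) (x' y' : A') : sideMul b (x ⊗ₜ[ℂ] x') (y ⊗ₜ[ℂ] y') =
      sideMul b x y ⊗ₜ sideMul b x' y' := by
  cases b <;> simp

namespace RightCovariantCalculus

open Coalgebra HopfAlgebra

variable {H : Type*} [Ring H] [HopfAlgebra ℂ H] (Λ : RightCovariantCalculus H)
  (hS : Function.Bijective (antipode ℂ : H →ₗ[ℂ] H))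

theorem sideAntipode_sideMul (b : Bool) (x y : H) : sideAntipode H hS b (sideMul b x y) =
    sideMul b (sideAntipode H hS b y) (sideAntipode H hS b x) := by
  cases b
  · exact antipode_mul_antidistrib y x
  · apply hS.1
    simp [sideAntipode, antipode_mul_antidistrib]

theorem sum_sideAntipode (b : Bool) {h : H} {ι : Type*} (r : Repr ℂ h ι) :
    ∑ m ∈ r.index, sideMul b (sideAntipode H hS b (r.right m)) (r.left m) =
      algebraMap ℂ H (counit h) := by
  cases b
  · exact sum_mul_antipode_eq_algebraMap_counit r
  · exact sum_antipodeInv_mul hS r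

theorem sum_sideAntipode_lift (b : Bool) (h : H) :
    TensorProduct.lift ((sideMul b).flip.compl₁₂ LinearMap.id (sideAntipode H hS b))
      (comul (R := ℂ) h) = algebraMap ℂ H (counit h) := by
  rw [← sum_sideAntipode hS b (ℛ ℂ h), ← (ℛ ℂ h).eq, map_sum]
  simp

/-- The map `ω ⊗ m ↦ σ(m₁) ω ⊗ m₂`, where `σ(m₁)` acts from the side `b`. -/
def untwist (b : Bool) : Λ.carrier ⊗[ℂ] H →ₗ[ℂ] Λ.carrier ⊗[ℂ] H :=
  (TensorProduct.lift
    ((sideMul b ∘ₗ Λ.incl.toLinearMap ∘ₗ sideAntipode H hS b).flip)).rTensor H ∘ₗ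
      (TensorProduct.assoc ℂ Λ.carrier H H).symm.toLinearMap ∘ₗ
        (comul (R := ℂ) (A := H)).lTensor Λ.carrier

theorem untwist_rTensor_dB (b : Bool) (k : H) :
    Λ.untwist hS b (Λ.dB.rTensor H (comul (R := ℂ) k)) =
      (Λ.etaSide b (sideAntipode H hS b)).rTensor H (comul (R := ℂ) k) := by
  have e : ∀ t : H ⊗[ℂ] H, Λ.untwist hS b (Λ.dB.rTensor H t) =
      (TensorProduct.lift ((sideMul b).compl₁₂ (Λ.incl.toLinearMap ∘ₗ sideAntipode H hS b)
        Λ.dB) ∘ₗ (TensorProduct.comm ℂ H H).toLinearMap).rTensor H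
        ((TensorProduct.assoc ℂ H H H).symm ((comul (R := ℂ) (A := H)).lTensor H t)) := by
    intro t
    induction t with
    | zero => simp
    | add x y hx hy => simp only [map_add, hx, hy]
    | tmul l m =>
      simp only [untwist, LinearMap.comp_apply, LinearMap.rTensor_tmul, LinearMap.lTensor_tmul,
        LinearEquiv.coe_coe]
      induction (comul (R := ℂ) m : H ⊗[ℂ] H) with
      | zero => simp
      | add x y hx hy => simp only [map_add, TensorProduct.tmul_add, hx, hy]
      | tmul x y => simp
  rw [e, coassoc_symm_apply, ← LinearMap.rTensor_comp_apply]
  rfl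

/-- Because σ is antimultiplicative, σ(h₂) ends up next to h₁, and their product collapses to a
counit; only the last leg of h survives, in the factor H. -/
theorem untwist_sideMul (b : Bool) (h : H) (t : Λ.carrier ⊗[ℂ] H) :
    Λ.untwist hS b (sideMul b (Λ.incl.toLinearMap.rTensor H (comul (R := ℂ) h)) t) =
      sideMul b (1 ⊗ₜ h) (Λ.untwist hS b t) := by
  induction t with
  | zero => simp
  | add x y hx hy => simp only [map_add, hx, hy]
  | tmul ω m =>
    -- For left action, W x (u ⊗ v) = σ(x) σ(v) u ω; on a coproduct the middle product is a counit.
    let W : H → H ⊗[ℂ] H →ₗ[ℂ] Λ.carrier := fun x =>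
      sideMul b (Λ.incl (sideAntipode H hS b x)) ∘ₗ (sideMul b).flip ω ∘ₗ Λ.incl.toLinearMap ∘ₗ
        TensorProduct.lift ((sideMul b).flip.compl₁₂ LinearMap.id (sideAntipode H hS b))
    have hW : ∀ x l, W x (comul (R := ℂ) l) =
        counit (R := ℂ) l • sideMul b (Λ.incl (sideAntipode H hS b x)) ω := by
      intro x l
      have e := sum_sideAntipode_lift hS b l
      simp only [W, LinearMap.comp_apply, e, AlgHom.toLinearMap_apply, map_one,
        LinearMap.flip_apply, Algebra.algebraMap_eq_smul_one, map_smul, one_sideMul]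
    have e : ∀ t : H ⊗[ℂ] H,
        Λ.untwist hS b (sideMul b (Λ.incl.toLinearMap.rTensor H t) (ω ⊗ₜ m)) =
          ∑ n ∈ (ℛ ℂ m).index, TensorProduct.map (W ((ℛ ℂ m).left n))
            ((sideMul b).flip ((ℛ ℂ m).right n))
            ((TensorProduct.assoc ℂ H H H).symm ((comul (R := ℂ) (A := H)).lTensor H t)) := by
      intro t
      induction t with
      | zero => simp
      | add x y hx hy => simp only [map_add, LinearMap.add_apply, hx, hy, Finset.sum_add_distrib]
      | tmul l q =>
        have hm : comul (R := ℂ) (sideMul b q m) =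
            ∑ n ∈ (ℛ ℂ m).index, sideMul b (comul (R := ℂ) q)
              ((ℛ ℂ m).left n ⊗ₜ (ℛ ℂ m).right n) := by
          rw [← map_sum, (ℛ ℂ m).eq]
          exact map_sideMul b (Bialgebra.comulAlgHom ℂ H) q m
        rw [LinearMap.rTensor_tmul, sideMul_tmul, untwist, LinearMap.comp_apply,
          LinearMap.comp_apply, LinearMap.lTensor_tmul, hm, TensorProduct.tmul_sum, map_sum,
          map_sum]
        refine Finset.sum_congr rfl fun n _ => ?_
        rw [LinearMap.lTensor_tmul]
        induction (comul (R := ℂ) q : H ⊗[ℂ] H) with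
        | zero => simp
        | add x y hx hy =>
          simp only [map_add, LinearMap.add_apply, TensorProduct.tmul_add, hx, hy]
        | tmul x y =>
          simp [sideMul_tmul, W, sideAntipode_sideMul, map_sideMul, sideMul_sideMul]
    rw [e, coassoc_symm_apply]
    have hR : Λ.untwist hS b (ω ⊗ₜ m) = ∑ n ∈ (ℛ ℂ m).index,
        sideMul b (Λ.incl (sideAntipode H hS b ((ℛ ℂ m).left n))) ω ⊗ₜ (ℛ ℂ m).right n := by
      rw [untwist, LinearMap.comp_apply, LinearMap.comp_apply, LinearMap.lTensor_tmul]
      conv_lhs => rw [← (ℛ ℂ m).eq]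
      simp [TensorProduct.tmul_sum]
    rw [hR, map_sum]
    refine Finset.sum_congr rfl fun n _ => ?_
    rw [sideMul_tmul, one_sideMul]
    conv_rhs => rw [← sum_counit_smul (ℛ ℂ h)]
    rw [← (ℛ ℂ h).eq, map_sum, map_sum, map_sum, LinearMap.sum_apply, TensorProduct.tmul_sum]
    refine Finset.sum_congr rfl fun l _ => ?_
    rw [LinearMap.rTensor_tmul, TensorProduct.map_tmul, hW, map_smul, LinearMap.smul_apply,
      TensorProduct.smul_tmul]
    rfl

/-- The form h dk is taken to ∑ η(k₁) ⊗ h k₂ (for left action), so a map that factors through η can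
be applied without choosing a presentation of the form. -/
theorem untwist_coact (b : Bool) (h k : H) :
    Λ.untwist hS b (Λ.coact (sideMul b (Λ.incl h) (Λ.dB k))) =
      sideMul b (1 ⊗ₜ h)
        ((Λ.etaSide b (sideAntipode H hS b)).rTensor H (comul (R := ℂ) k)) := by
  have e : Λ.coact (Λ.dB k) = Λ.dB.rTensor H (comul (R := ℂ) k) := Λ.coact_d k
  rw [map_sideMul, Λ.coact_incl, e, untwist_sideMul, untwist_rTensor_dB]

end RightCovariantCalculus

/-! ### From local connection maps to projections of the local calculi -/

namespace DifferentialStructure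

open Coalgebra HopfAlgebra RightCovariantCalculus

variable {I H B P : Type*} [Ring H] [HopfAlgebra ℂ H] [Ring B] [Algebra ℂ B]
  [Ring P] [Algebra ℂ P] {X : LocallyTrivialQPFB I H B P} (D : DifferentialStructure X)
  (hS : Function.Bijective (antipode ℂ : H →ₗ[ℂ] H))

theorem sideMul_inL_inH (b : Bool) (i : I) (γ : (D.ΓB i).carrier) (h : H) :
    sideMul b (D.inL i γ) (D.inH i h) = D.inL i γ * D.inH i h := by
  cases b
  · exact (commute_inRight₀_inLeft _ _ h γ).eq
  · rfl

theorem inZero_tmul (b : Bool) (i : I) (a : X.Loc i) (h : H) :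
    D.inZero i (a ⊗ₜ h) = sideMul b (D.inL i ((D.ΓB i).incl a)) (D.inH i h) := by
  rw [skewIncl_tmul, sideMul_inL_inH]

theorem sideMul_inL_comm (b : Bool) (i : I) (γ : (D.ΓB i).carrier) (h : H) (w : D.Local i) :
    sideMul b (D.inL i γ) (sideMul b (D.inH i h) w) =
      sideMul b (D.inH i h) (sideMul b (D.inL i γ) w) := by
  rw [← sideMul_sideMul, ← sideMul_sideMul, sideMul_inL_inH, sideMul_inH_inL]

/-- The vertical part `h d k ↦ ∑ h A(k₁) k₂` of a connection over a patch. -/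
theorem exists_vertical (b : Bool) {i : I} {A : H →ₗ[ℂ] (D.ΓB i).carrier} (hA₁ : A 1 = 0)
    (hA : ∀ h, D.ΓH.etaSide b (sideAntipode H hS b) h = 0 → counit (R := ℂ) h = 0 → A h = 0) :
    ∃ T : D.ΓH.carrier →ₗ[ℂ] D.Local i, (∀ h, T (D.ΓH.incl h) = 0) ∧
      ∀ h k, T (sideMul b (D.ΓH.incl h) (D.ΓH.dB k)) = sideMul b (D.inH i h)
        (convolve ((D.inL i).toLinearMap ∘ₗ A) (D.inH i).toLinearMap k) := by
  -- The kernel condition only concerns ker ε. Subtracting ε(h)1, where both η and A vanish, extends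
  -- it to the whole kernel of η.
  obtain ⟨A', hA'⟩ := exists_comp_eq_of_ker_le (D.ΓH.etaSide b (sideAntipode H hS b)) A (by
    intro h hh
    have e := hA (h - counit (R := ℂ) h • 1) (by
      rw [map_sub, map_smul, etaSide_one, smul_zero, sub_zero]; exact hh) (by simp)
    rw [map_sub, map_smul, hA₁, smul_zero, sub_zero] at e
    exact e)
  refine ⟨LinearMap.mul' ℂ (D.Local i) ∘ₗ TensorProduct.map ((D.inL i).toLinearMap ∘ₗ A')
    (D.inH i).toLinearMap ∘ₗ D.ΓH.untwist hS b ∘ₗ D.ΓH.coact.toLinearMap ∘ₗ D.ΓH.proj 1,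
    fun h => ?_, fun h k => ?_⟩
  · simp only [LinearMap.comp_apply, proj_of_mem_ne _ (incl_mem _ h) zero_ne_one, map_zero]
  · have hm : sideMul b (D.ΓH.incl h) (D.ΓH.dB k) ∈ D.ΓH.deg 1 := by
      cases b
      · simpa using SetLike.mul_mem_graded (dB_mem D.ΓH.toDifferentialCalculus k) (incl_mem _ h)
      · simpa using SetLike.mul_mem_graded (incl_mem _ h) (dB_mem D.ΓH.toDifferentialCalculus k)
    have e : ∀ l, A' (D.ΓH.etaSide b (sideAntipode H hS b) l) = A l := LinearMap.congr_fun hA'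
    simp only [LinearMap.comp_apply, proj_of_mem _ hm, AlgHom.toLinearMap_apply, untwist_coact]
    rw [convolve_repr (ℛ ℂ k), ← (ℛ ℂ k).eq]
    simp only [map_sum, LinearMap.rTensor_tmul, sideMul_tmul, one_sideMul, TensorProduct.map_tmul,
      LinearMap.mul'_apply, LinearMap.comp_apply, e, AlgHom.toLinearMap_apply]
    refine Finset.sum_congr rfl fun n _ => ?_
    rw [← sideMul_inL_inH _ b, ← sideMul_inL_inH _ b, map_sideMul, sideMul_inL_comm]

theorem connForm_tmul (b : Bool) (i : I) (A : H →ₗ[ℂ] (D.ΓB i).carrier) (a : X.Loc i) (h : H) :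
    D.connForm b i A (a ⊗ₜ h) = D.inL i ((D.ΓB i).dB a) * D.inH i h -
      sideMul b (D.inL i ((D.ΓB i).incl a))
        (convolve ((D.inL i).toLinearMap ∘ₗ A) (D.inH i).toLinearMap h) :=
  formMap_tmul _ _ _ _ _ _ _

/-- The projection onto the horizontal forms over a patch with local connection map `A`. -/
theorem exists_local_projection (b : Bool) {i : I} {A : H →ₗ[ℂ] (D.ΓB i).carrier}
    (hA₁ : A 1 = 0) (hA : ∀ h, D.ΓH.etaSide b (sideAntipode H hS b) h = 0 →
      counit (R := ℂ) h = 0 → A h = 0) :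
    ∃ g : D.Local i →ₗ[ℂ] D.Local i,
      (∀ w ∈ horizontal (D.ΓB i) D.ΓH.toDifferentialCalculus, g w = w) ∧
      ∀ x y, g (sideMul b (D.inZero i x) (D.dLoc i y)) =
        sideMul b (D.inZero i x) (D.connForm b i A y) := by
  obtain ⟨T, hT₀, hT⟩ := D.exists_vertical hS b hA₁ hA
  -- On γ ⊗ ω the map keeps the degree zero part of ω and replaces its degree one part by -T(ω); it
  -- is the required projection on total degree one.
  let g : D.Local i →ₗ[ℂ] D.Local i := formMap b (D.inL i).toLinearMap (D.inL i).toLinearMap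
    ((D.inR i).toLinearMap ∘ₗ D.ΓH.proj 0) T ∘ₗ
      (GradedTensorProduct.of ℂ (D.ΓB i).deg D.ΓH.deg).symm.toLinearMap
  have hg : ∀ γ ω, g (D.inL i γ * D.inR i ω) =
      D.inL i γ * D.inR i (D.ΓH.proj 0 ω) - sideMul b (D.inL i γ) (T ω) := by
    intro γ ω
    simp only [g, LinearMap.comp_apply, LinearEquiv.coe_coe]
    rw [of_symm_mul, formMap_tmul]
    rfl
  have hfix : ∀ w ∈ horizontal (D.ΓB i) D.ΓH.toDifferentialCalculus, g w = w := by
    intro w hw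
    refine D.horizontal_induction i hw (fun γ h => ?_) fun x y hx hy => ?_
    · rw [← inRight_incl, hg, proj_of_mem _ (incl_mem _ h), hT₀, map_zero, sub_zero]
    · rw [map_add, hx, hy]
  refine ⟨g, hfix, fun x y => ?_⟩
  induction x with
  | zero => simp
  | add x x' hx hx' => simp only [map_add, LinearMap.add_apply, hx, hx']
  | tmul a h =>
    induction y with
    | zero => simp
    | add y y' hy hy' => simp only [map_add, hy, hy']
    | tmul c k =>
      rw [dLoc_tmul, connForm_tmul, map_add, map_sub, map_add, sub_eq_add_neg]
      congr 1
      · exact hfix _ (D.sideMul_mem_horizontal b i _ (D.mul_inH_mem_horizontal i _ _))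
      · have hm : D.ΓH.proj 0 (sideMul b (D.ΓH.incl h) (D.ΓH.dB k)) = 0 := by
          cases b
          · simp [proj_zero_mul, proj_of_mem_ne _ (dB_mem D.ΓH.toDifferentialCalculus k)]
          · simp [proj_zero_mul, proj_of_mem_ne _ (dB_mem D.ΓH.toDifferentialCalculus k)]
        have e : sideMul b (D.inZero i (a ⊗ₜ h))
            (D.inL i ((D.ΓB i).incl c) * D.inR i (D.ΓH.dB k)) =
            D.inL i ((D.ΓB i).incl (sideMul b a c)) *
              D.inR i (sideMul b (D.ΓH.incl h) (D.ΓH.dB k)) := by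
          rw [D.inZero_tmul b, ← sideMul_inL_incl_inR _ b, ← sideMul_inL_incl_inR _ b,
            sideMul_sideMul, ← sideMul_inL_comm, ← sideMul_sideMul, map_sideMul, map_sideMul,
            map_sideMul, inRight_incl]
        rw [e, hg, hm, map_zero, mul_zero, zero_sub, hT, D.inZero_tmul b, sideMul_sideMul,
          ← sideMul_inL_comm, ← sideMul_sideMul, map_sideMul, map_sideMul, sideMul_sideMul,
          sideMul_sideMul]

theorem connForm_mem_horizontal (b : Bool) (i : I) (A : H →ₗ[ℂ] (D.ΓB i).carrier)
    (z : X.Loc i ⊗[ℂ] H) :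
    D.connForm b i A z ∈ horizontal (D.ΓB i) D.ΓH.toDifferentialCalculus := by
  induction z with
  | zero => simp
  | add x y hx hy => rw [map_add]; exact add_mem hx hy
  | tmul a h =>
    rw [connForm_tmul]
    refine sub_mem (D.mul_inH_mem_horizontal i _ _) ?_
    have e := D.inZero_tmul b i a 1
    rw [map_one, sideMul_one] at e
    rw [← e]
    refine D.sideMul_mem_horizontal b i _ ?_
    rw [convolve_repr (ℛ ℂ h)]
    exact sum_mem fun n _ => D.mul_inH_mem_horizontal i _ _

theorem skewProj_inZero (i : I) (x : X.Loc i ⊗[ℂ] H) :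
    skewProjZero _ _ (D.inZero i x) = D.inZero i x ∧ skewProjOne _ _ (D.inZero i x) = 0 := by
  obtain ⟨p, rfl⟩ := X.χ_surjective i x
  rw [← D.χΓ_incl, ← (D.χΓ_proj i _).1, ← (D.χΓ_proj i _).2, proj_of_mem _ (incl_mem _ p),
    proj_of_mem_ne _ (incl_mem _ p) zero_ne_one, map_zero]
  exact ⟨rfl, rfl⟩

theorem skewProjOne_sideMul (b : Bool) (i : I) (x : X.Loc i ⊗[ℂ] H) (w : D.Local i) :
    skewProjOne _ _ (sideMul b (D.inZero i x) w) =
      sideMul b (D.inZero i x) (skewProjOne _ _ w) := by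
  obtain ⟨h₀, h₁⟩ := D.skewProj_inZero i x
  cases b
  · rw [sideMul_false, sideMul_false, (skewProj_mul _ _ _ _).2, h₀, h₁, mul_zero, zero_add]
  · rw [sideMul_true, sideMul_true, (skewProj_mul _ _ _ _).2, h₀, h₁, zero_mul, add_zero]

theorem skewProjOne_mul_inH (i : I) {γ : (D.ΓB i).carrier} (hγ : γ ∈ (D.ΓB i).deg 1) (h : H) :
    skewProjOne _ _ (D.inL i γ * D.inH i h) = D.inL i γ * D.inH i h := by
  rw [← inRight_incl, skewProjOne_mul_inRight, proj_of_mem_ne _ hγ one_ne_zero,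
    proj_of_mem _ hγ, proj_of_mem _ (incl_mem _ h), map_zero, zero_mul, zero_add]

/-- Needed for gluing: a common representative of these forms may be replaced by its degree one
component. -/
theorem skewProjOne_connForm (b : Bool) {i : I} {A : H →ₗ[ℂ] (D.ΓB i).carrier}
    (hA : ∀ h, A h ∈ (D.ΓB i).deg 1) (z : X.Loc i ⊗[ℂ] H) :
    skewProjOne _ _ (D.connForm b i A z) = D.connForm b i A z := by
  induction z with
  | zero => simp
  | add x y hx hy => rw [map_add, map_add, hx, hy]
  | tmul a h =>
    have e := D.inZero_tmul b i a 1
    rw [map_one, sideMul_one] at e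
    rw [connForm_tmul, map_sub, D.skewProjOne_mul_inH i (dB_mem _ a), ← e, skewProjOne_sideMul,
      convolve_repr (ℛ ℂ h), map_sum]
    congr 3
    exact funext fun n => D.skewProjOne_mul_inH i (hA _) _

theorem localCoact_connForm (b : Bool) (i : I) (A : H →ₗ[ℂ] (D.ΓB i).carrier)
    (z : X.Loc i ⊗[ℂ] H) : D.localCoact i (D.connForm b i A z) =
      (D.connForm b i A).rTensor H (coactZero X i z) := by
  have h₁ : ∀ γ h, D.localCoact i (D.inL i γ * D.inH i h) =
      (LinearMap.mulLeft ℂ (D.inL i γ) ∘ₗ (D.inH i).toLinearMap).rTensor H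
        (comul (R := ℂ) h) := by
    intro γ h
    rw [← inRight_incl, localCoact_mul, coactR_incl]
    induction (comul (R := ℂ) h : H ⊗[ℂ] H) with
    | zero => simp
    | add x y hx hy => simp only [map_add, mul_add, hx, hy]
    | tmul k l => simp
  have h₂ : ∀ h, D.localCoact i
      (convolve ((D.inL i).toLinearMap ∘ₗ A) (D.inH i).toLinearMap h) =
      (convolve ((D.inL i).toLinearMap ∘ₗ A) (D.inH i).toLinearMap).rTensor H
        (comul (R := ℂ) h) := by
    intro h
    have e : ∀ t : H ⊗[ℂ] H, D.localCoact i (LinearMap.mul' ℂ (D.Local i)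
        (TensorProduct.map ((D.inL i).toLinearMap ∘ₗ A) (D.inH i).toLinearMap t)) =
        (LinearMap.mul' ℂ (D.Local i) ∘ₗ TensorProduct.map ((D.inL i).toLinearMap ∘ₗ A)
          (D.inH i).toLinearMap).rTensor H ((TensorProduct.assoc ℂ H H H).symm
            ((comul (R := ℂ) (A := H)).lTensor H t)) := by
      intro t
      induction t with
      | zero => simp
      | add x y hx hy => simp only [map_add, hx, hy]
      | tmul k l =>
        have e₁ := h₁ (A k) l
        refine e₁.trans ?_
        rw [LinearMap.lTensor_tmul]
        induction (comul (R := ℂ) l : H ⊗[ℂ] H) with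
        | zero => simp
        | add x y hx hy => simp only [map_add, TensorProduct.tmul_add, hx, hy]
        | tmul k l => simp
    refine (e _).trans ?_
    rw [coassoc_symm_apply, ← LinearMap.rTensor_comp_apply]
    rfl
  induction z with
  | zero => simp
  | add x y hx hy => simp only [map_add, hx, hy]
  | tmul a h =>
    have e := D.inZero_tmul b i a 1
    rw [map_one, sideMul_one] at e
    have e' : D.localCoact i (D.inZero i (a ⊗ₜ 1)) = D.inL i ((D.ΓB i).incl a) ⊗ₜ 1 := by
      rw [localCoact_inZero_tmul, map_one, map_one, mul_one]
    rw [connForm_tmul, map_sub, h₁, ← e, localCoact_sideMul, e', h₂]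
    simp only [LinearMap.comp_apply, LinearMap.lTensor_tmul]
    induction (comul (R := ℂ) h : H ⊗[ℂ] H) with
    | zero => simp
    | add x y hx hy =>
      simp only [TensorProduct.tmul_add, map_add, ← hx, ← hy]
      abel
    | tmul k l =>
      simp [connForm_tmul, TensorProduct.sub_tmul, sideMul_tmul, one_sideMul]

end DifferentialStructure

/-! ### Gluing local projections, and the correspondence of left and right connections -/

namespace DifferentialStructure

open Coalgebra HopfAlgebra RightCovariantCalculus

variable {I H B P : Type*} [Ring H] [HopfAlgebra ℂ H] [Ring B] [Algebra ℂ B]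
  [Ring P] [Algebra ℂ P] {X : LocallyTrivialQPFB I H B P} (D : DifferentialStructure X)

theorem inZero_sideMul (b : Bool) (i : I) (x y : X.Loc i ⊗[ℂ] H) :
    D.inZero i (sideMul b x y) = sideMul b (D.inZero i x) (D.inZero i y) := by
  cases b
  · rw [sideMul_false, sideMul_false, skewIncl_mul]
  · rw [sideMul_true, sideMul_true, skewIncl_mul]

theorem exists_of_projLeft_eq_projRight {i j : I} {u : D.Local i} {v : D.Local j}
    (h : D.projLeft i j u = D.projRight i j v) : ∃ y, D.χΓ i y = u ∧ D.χΓ j y = v := by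
  obtain ⟨x, rfl⟩ := D.χΓ_surjective i u
  obtain ⟨z, rfl⟩ := D.χΓ_surjective j v
  rw [projLeft_χΓ, projRight_χΓ] at h
  obtain ⟨k, hk, l, hl, e⟩ := Submodule.mem_sup.1 (Ideal.Quotient.eq.1 h)
  rw [RingHom.mem_ker] at hk hl
  refine ⟨x - k, by rw [map_sub, hk, sub_zero], ?_⟩
  rw [sub_eq_iff_eq_add.2 (show x = (z + l) + k by rw [add_assoc, add_comm l, e, add_sub_cancel]),
    map_add, hl, add_zero]

/-- Local projections that agree on the overlaps glue to a map of the one-forms. -/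
theorem exists_hor {τ : ∀ i j, H →ₐ[ℂ] X.Overlap i j} (hτ : X.IsTransition τ) (b : Bool)
    {A : ∀ i, H →ₗ[ℂ] (D.ΓB i).carrier} (hA : D.IsNormalized A) (hc : D.IsCompatible τ A)
    {g : ∀ i, D.Local i →ₗ[ℂ] D.Local i}
    (hg : ∀ i x y, g i (sideMul b (D.inZero i x) (D.dLoc i y)) =
      sideMul b (D.inZero i x) (D.connForm b i (A i) y)) :
    ∃ hor : D.forms →ₗ[ℂ] D.forms, ∀ i γ, D.χc i (hor γ) = g i (D.χc i γ) := by
  have hglue : ∀ i j, ∀ y ∈ D.ΓP.deg 1, ∃ y' ∈ D.ΓP.deg 1, D.χΓ i y' = g i (D.χΓ i y) ∧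
      D.χΓ j y' = g j (D.χΓ j y) := by
    intro i j y hy
    replace hy := D.ΓP.deg_one_le_span b hy
    induction hy using Submodule.span_induction with
    | zero => exact ⟨0, zero_mem _, by simp, by simp⟩
    | add x y _ _ hx hy =>
      obtain ⟨x', hx', hxi, hxj⟩ := hx
      obtain ⟨y', hy', hyi, hyj⟩ := hy
      exact ⟨x' + y', add_mem hx' hy', by simp only [map_add, hxi, hyi],
        by simp only [map_add, hxj, hyj]⟩
    | smul c x _ hx =>
      obtain ⟨x', hx', hxi, hxj⟩ := hx
      exact ⟨c • x', Submodule.smul_mem _ _ hx', by simp only [map_smul, hxi],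
        by simp only [map_smul, hxj]⟩
    | mem x hx =>
      obtain ⟨p, q, rfl⟩ := hx
      -- Compatibility supplies one z in Γ(P) that represents hor(dq) over both patches; the value
      -- at p dq (or dq p) is then p times the degree one part of z.
      obtain ⟨z, hzi, hzj⟩ :=
        D.exists_of_projLeft_eq_projRight ((D.isCompatible_iff hτ b A).1 hc i j q)
      have key : ∀ k, D.χΓ k z = D.connForm b k (A k) (X.χ k q) →
          D.χΓ k (sideMul b (D.ΓP.incl p) (D.ΓP.proj 1 z)) =
            g k (D.χΓ k (sideMul b (D.ΓP.incl p) (D.ΓP.dB q))) := by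
        intro k hk
        rw [map_sideMul, map_sideMul, D.χΓ_incl, χΓ_dB, hg, (D.χΓ_proj k z).2, hk,
          D.skewProjOne_connForm b (hA.1 k)]
      refine ⟨sideMul b (D.ΓP.incl p) (D.ΓP.proj 1 z), ?_, key i hzi, key j hzj⟩
      cases b
      · simpa using SetLike.mul_mem_graded (D.ΓP.proj_mem 1 z) (D.ΓP.incl_mem p)
      · simpa using SetLike.mul_mem_graded (D.ΓP.incl_mem p) (D.ΓP.proj_mem 1 z)
  have hex : ∀ γ : D.forms, ∃ δ : D.forms, ∀ i, D.χc i δ = g i (D.χc i γ) := by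
    intro γ
    refine D.exists_forms _ fun i j => ?_
    obtain ⟨y, hy, hi, hj⟩ := D.exists_common_lift γ i j
    rw [← hi, ← hj]
    exact hglue i j y hy
  choose f hf using hex
  exact ⟨{
    toFun := f
    map_add' := fun γ δ => D.forms_ext fun i => by simp only [map_add, hf]
    map_smul' := fun c γ => D.forms_ext fun i => by simp only [map_smul, hf, RingHom.id_apply] },
    fun i γ => hf γ i⟩

theorem rTensor_sideMul {V W : Type*} [AddCommGroup V] [Module ℂ V] [AddCommGroup W] [Module ℂ W]
    (b : Bool) {A : Type*} [Ring A] [Algebra ℂ A] {g : A →ₗ[ℂ] A} {o : V →ₗ[ℂ] A}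
    {f f' : W →ₗ[ℂ] A} (h : ∀ x y, g (sideMul b (o x) (f y)) = sideMul b (o x) (f' y))
    (s : V ⊗[ℂ] H) (t : W ⊗[ℂ] H) :
    g.rTensor H (sideMul b (o.rTensor H s) (f.rTensor H t)) =
      sideMul b (o.rTensor H s) (f'.rTensor H t) := by
  induction s with
  | zero => simp
  | add x y hx hy => simp only [map_add, LinearMap.add_apply, hx, hy]
  | tmul v k =>
    induction t with
    | zero => simp
    | add x y hx hy => simp only [map_add, hx, hy]
    | tmul w l => simp only [LinearMap.rTensor_tmul, sideMul_tmul, h]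

theorem localMap_eq_of_local {b : Bool} {A : ∀ i, H →ₗ[ℂ] (D.ΓB i).carrier}
    {g : ∀ i, D.Local i →ₗ[ℂ] D.Local i}
    (hg : ∀ i y, g i (D.dLoc i y) = D.connForm b i (A i) y)
    {hor : D.forms →ₗ[ℂ] D.forms} (hhor : ∀ i γ, D.χc i (hor γ) = g i (D.χc i γ)) :
    D.localMap hor = A := by
  ext i h
  have e : D.localMap hor i h = -D.idCounit i (D.χc i (hor (D.dP (liftH X i h)))) := rfl
  rw [e, hhor, χc_dP, χ_liftH, hg, connForm_tmul, dB_one, map_zero, zero_mul, zero_sub, map_one,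
    map_one, one_sideMul, map_neg, neg_neg, convolve_repr (ℛ ℂ h), map_sum]
  simp only [LinearMap.comp_apply, AlgHom.toLinearMap_apply, idCounit_mul_inH]
  simp only [← map_smul, ← map_sum]
  rw [sum_counit_right_smul]

/-- Every family of maps that satisfies the conditions on local connection maps comes from a
connection. -/
theorem exists_isConnection [Finite I]
    (hS : Function.Bijective (antipode ℂ : H →ₗ[ℂ] H)) {τ : ∀ i j, H →ₐ[ℂ] X.Overlap i j}
    (hτ : X.IsTransition τ) (b : Bool) {A : ∀ i, H →ₗ[ℂ] (D.ΓB i).carrier}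
    (hA : D.IsNormalized A) (hc : D.IsCompatible τ A) (hk : D.SideKernel hS b A) :
    ∃ hor, D.IsConnection b hor ∧ D.localMap hor = A := by
  choose g hfix hg using fun i => D.exists_local_projection hS b (hA.2 i) (hk i)
  obtain ⟨hor, hhor⟩ := D.exists_hor hτ b hA hc hg
  have hg' : ∀ i y, g i (D.dLoc i y) = D.connForm b i (A i) y := by
    intro i y
    have e := hg i (1 ⊗ₜ 1) y
    rw [skewIncl_tmul, map_one, map_one, map_one, mul_one, one_sideMul, one_sideMul] at e
    exact e
  have hmem : ∀ γ, hor γ ∈ D.horForms := by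
    intro γ
    rw [mem_horForms]
    intro i
    obtain ⟨y, hy, e⟩ := D.exists_lift γ i
    rw [hhor, ← e, ← Submodule.Quotient.mk_eq_zero]
    -- Horizontality is vanishing in the quotient by the horizontal forms, an equality of linear
    -- maps that can be tested on the spanning forms.
    refine D.eqOn_one_forms b i (f := (horizontal (D.ΓB i) D.ΓH.toDifferentialCalculus).mkQ ∘ₗ g i)
      (f' := 0) (fun p q => ?_) hy
    rw [LinearMap.comp_apply, hg, LinearMap.zero_apply, Submodule.mkQ_apply,
      Submodule.Quotient.mk_eq_zero]
    exact D.sideMul_mem_horizontal b i _ (D.connForm_mem_horizontal b i _ _)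
  have hid : ∀ γ ∈ D.horForms, hor γ = γ := by
    intro γ hγ
    refine D.forms_ext fun i => ?_
    rw [hhor, hfix i _ (D.mem_horForms.1 hγ i)]
  refine ⟨hor, ⟨⟨?_, fun γ => hid _ (hmem γ), fun γ => ?_, fun i γ h => ?_⟩, fun p γ => ?_⟩,
    D.localMap_eq_of_local hg' hhor⟩
  · refine le_antisymm ?_ fun γ hγ => ⟨γ, hid γ hγ⟩
    rintro _ ⟨γ, rfl⟩
    exact hmem γ
  · obtain ⟨t, ht⟩ := D.exists_isCoactionOf γ
    refine ⟨t, ht, fun i => ?_⟩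
    obtain ⟨y, hy, e⟩ := D.exists_lift γ i
    rw [← LinearMap.rTensor_comp_apply, show D.χc i ∘ₗ hor = g i ∘ₗ D.χc i from
      LinearMap.ext fun γ => hhor i γ, LinearMap.rTensor_comp_apply, ht i, hhor, ← e]
    refine D.eqOn_one_forms b i (f := (g i).rTensor H ∘ₗ D.localCoact i)
      (f' := D.localCoact i ∘ₗ g i) (fun p q => ?_) hy
    rw [LinearMap.comp_apply, LinearMap.comp_apply, hg, localCoact_sideMul, localCoact_sideMul,
      localCoact_inZero, localCoact_dLoc, localCoact_connForm]
    exact rTensor_sideMul b (hg i) _ _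
  · rw [hhor, h, map_zero]
  · refine D.forms_ext fun i => ?_
    obtain ⟨y, hy, e⟩ := D.exists_lift γ i
    rw [hhor, χc_sideAct, χc_sideAct, hhor, ← e]
    refine D.eqOn_one_forms b i (f := g i ∘ₗ sideMul b (D.inZero i (X.χ i p)))
      (f' := sideMul b (D.inZero i (X.χ i p)) ∘ₗ g i) (fun p' q => ?_) hy
    rw [LinearMap.comp_apply, LinearMap.comp_apply, hg, ← sideMul_sideMul, ← sideMul_sideMul,
      ← inZero_sideMul, hg]

theorem exists_isConnection_iff [Finite I]
    (hS : Function.Bijective (antipode ℂ : H →ₗ[ℂ] H)) {τ : ∀ i j, H →ₐ[ℂ] X.Overlap i j}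
    (hτ : X.IsTransition τ) (b : Bool) (A : ∀ i, H →ₗ[ℂ] (D.ΓB i).carrier) :
    (∃ hor, D.IsConnection b hor ∧ D.localMap hor = A) ↔
      D.IsNormalized A ∧ D.IsCompatible τ A ∧ D.SideKernel hS b A := by
  constructor
  · rintro ⟨hor, h, rfl⟩
    exact ⟨⟨fun i k => IsProjection.localMap_mem i k, fun i => h.localMap_one i⟩,
      h.isCompatible hτ, h.sideKernel hS⟩
  · rintro ⟨hA, hc, hk⟩
    exact D.exists_isConnection hS hτ b hA hc hk

theorem exists_leftConnection_iff [Finite I]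
    (hS : Function.Bijective (antipode ℂ : H →ₗ[ℂ] H)) {τ : ∀ i j, H →ₐ[ℂ] X.Overlap i j}
    (hτ : X.IsTransition τ) (A : ∀ i, H →ₗ[ℂ] (D.ΓB i).carrier) :
    (∃ ω : D.LeftConnection, D.localMap ω.hor = A) ↔
      D.IsNormalized A ∧ D.IsCompatible τ A ∧ D.LeftKernel hS A := by
  rw [leftKernel_iff, ← D.exists_isConnection_iff hS hτ true]
  constructor
  · rintro ⟨ω, h⟩
    exact ⟨ω.hor, ω.isConnection, h⟩
  · rintro ⟨hor, h, e⟩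
    exact ⟨⟨hor, h.toIsProjection, h.map_sideAct⟩, e⟩

theorem exists_rightConnection_iff [Finite I]
    (hS : Function.Bijective (antipode ℂ : H →ₗ[ℂ] H)) {τ : ∀ i j, H →ₐ[ℂ] X.Overlap i j}
    (hτ : X.IsTransition τ) (A : ∀ i, H →ₗ[ℂ] (D.ΓB i).carrier) :
    (∃ ω : D.RightConnection, D.localMap ω.hor = A) ↔
      D.IsNormalized A ∧ D.IsCompatible τ A ∧ D.RightKernel hS A := by
  rw [rightKernel_iff, ← D.exists_isConnection_iff hS hτ false]
  constructor
  · rintro ⟨ω, h⟩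
    exact ⟨ω.hor, ω.isConnection, h⟩
  · rintro ⟨hor, h, e⟩
    exact ⟨⟨hor, h.toIsProjection, h.map_sideAct⟩, e⟩

theorem LeftConnection.localMap_injective :
    Function.Injective fun ω : D.LeftConnection => D.localMap ω.hor := by
  intro ω ω' e
  have h := ω.isConnection.eq_of_localMap_eq ω'.isConnection e
  cases ω
  cases ω'
  simpa using h

theorem RightConnection.localMap_injective :
    Function.Injective fun ω : D.RightConnection => D.localMap ω.hor := by
  intro ω ω' e
  have h := ω.isConnection.eq_of_localMap_eq ω'.isConnection e
  cases ω
  cases ω'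
  simpa using h

/-- Left and right connections are both determined by their local maps, and A ↦ -A∘S is a bijection
of families that matches the conditions characterizing the two kinds. Uniqueness holds because the
local maps of the image are prescribed. -/
theorem existsUnique_connection_equiv [Finite I]
    (hS : Function.Bijective (antipode ℂ : H →ₗ[ℂ] H)) :
    ∃! Φ : D.LeftConnection ≃ D.RightConnection, ∀ ω : D.LeftConnection,
      D.localMap (Φ ω).hor = D.negAntipode (D.localMap ω.hor) := by
  obtain ⟨τ, hτ, -⟩ := LocallyTrivialQPFB.existsUnique_isTransition X
  have hneg : ∀ A, (∃ ω : D.LeftConnection, D.localMap ω.hor = A) ↔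
      ∃ ω : D.RightConnection, D.localMap ω.hor = D.negAntipode A := by
    intro A
    rw [D.exists_leftConnection_iff hS hτ, D.exists_rightConnection_iff hS hτ,
      D.isNormalized_negAntipode hS, D.isCompatible_negAntipode hS hτ,
      D.leftKernel_iff_rightKernel hS]
  choose f hf using fun ω : D.LeftConnection => (hneg (D.localMap ω.hor)).1 ⟨ω, rfl⟩
  have hbij : Function.Bijective f := by
    constructor
    · intro ω ω' e
      apply LeftConnection.localMap_injective
      apply D.negAntipode_injective hS
      change D.negAntipode (D.localMap ω.hor) = D.negAntipode (D.localMap ω'.hor)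
      rw [← hf, ← hf, e]
    · intro ω
      obtain ⟨A, hA⟩ := D.exists_negAntipode_eq hS (D.localMap ω.hor)
      obtain ⟨ω', rfl⟩ := (hneg A).2 ⟨ω, hA.symm⟩
      exact ⟨ω', RightConnection.localMap_injective D ((hf ω').trans hA)⟩
  refine ⟨Equiv.ofBijective f hbij, hf, fun Ψ hΨ => ?_⟩
  ext1 ω
  exact RightConnection.localMap_injective D ((hΨ ω).trans (hf ω).symm)

end DifferentialStructure

end

theorem proposition13 {I H B P : Type*} [Finite I] [Ring H] [HopfAlgebra ℂ H]
    [Ring B] [Algebra ℂ B] [Ring P] [Algebra ℂ P]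
    (hS : Function.Bijective (HopfAlgebra.antipode ℂ : H →ₗ[ℂ] H))
    (X : LocallyTrivialQPFB I H B P) (D : DifferentialStructure X) :
    (∃! Φ : D.LeftConnection ≃ D.RightConnection, ∀ ω : D.LeftConnection,
      D.localMap (Φ ω).hor = D.negAntipode (D.localMap ω.hor)) ∧
    (∃! τ : ∀ i j, H →ₐ[ℂ] X.Overlap i j, X.IsTransition τ) ∧
    ∀ τ : ∀ i j, H →ₐ[ℂ] X.Overlap i j, X.IsTransition τ →
      (∀ A : ∀ i, H →ₗ[ℂ] (D.ΓB i).carrier,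
        (∃ ω : D.LeftConnection, D.localMap ω.hor = A) ↔
          D.IsNormalized A ∧ D.IsCompatible τ A ∧ D.LeftKernel hS A) ∧
      (∀ A : ∀ i, H →ₗ[ℂ] (D.ΓB i).carrier,
        (∃ ω : D.RightConnection, D.localMap ω.hor = A) ↔
          D.IsNormalized A ∧ D.IsCompatible τ A ∧ D.RightKernel hS A) ∧
      (∀ A : ∀ i, H →ₗ[ℂ] (D.ΓB i).carrier,
        (D.IsNormalized A ↔ D.IsNormalized (D.negAntipode A)) ∧
        (D.IsCompatible τ A ↔ D.IsCompatible τ (D.negAntipode A)) ∧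
        (D.LeftKernel hS A ↔ D.RightKernel hS (D.negAntipode A))) :=
  ⟨D.existsUnique_connection_equiv hS, LocallyTrivialQPFB.existsUnique_isTransition X,
    fun _ hτ => ⟨D.exists_leftConnection_iff hS hτ, D.exists_rightConnection_iff hS hτ,
      fun A => ⟨D.isNormalized_negAntipode hS A, D.isCompatible_negAntipode hS hτ A,
        D.leftKernel_iff_rightKernel hS A⟩⟩⟩
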